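/- Let $\Gamma$ be a river network: a finite rooted binary tree of $n$ links, directed downstream, with most downstream link (root) $r$, each link having at most two tributaries. Let $\Lambda$ be its incidence matrix: $\Lambda_{e,e}=1$, $\Lambda_{e,e'}=-1$ if $e'$ is a tributary of $e$, and all other entries are $0$. Let $K_e,H_e,a_e>0$ for every link $e$, $\mathbf K=\mathrm{diag}(K_e)$, $\mathbf H=\mathrm{diag}(H_e)$, and $$\mathbf M=\begin{pmatrix}-\mathbf K\Lambda & \mathbf K\\ 0&-\mathbf H\end{pmatrix}\in\mathbb R^{2n\times 2n}.$$ Write $\mathbb R_+=(0,\infty)$, and for $x\in\mathbb R^{2n}$ write $x=(x_1,x_2)$ with $x_1,x_2\in\mathbb R^n$. Let $T_1<T_2<\cdots$ be the arrival times of a Poisson process $N$ with intensity $\lambda>0$ and let $P_1,P_2,\dots$ be i.i.d. random vectors with a probability density $f_P$ on $\mathbb R_+^n$, independent of $N$. Let $X=(Q,R)$ be the process on $\mathbb R_+^{2n}$ that solves $dX=\mathbf MX\,dt+dY$ with $Y(t)=\sum_{k=1}^{N(t)}(0,(H_ea_eP_{k,e})_e)$, that is, $$X(t)=e^{\mathbf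 Mt}X(0)+\sum_{k=1}^{N(t)}e^{\mathbf M(t-T_k)}\,(0,(H_ea_eP_{k,e})_e),$$ and let $p(t,x,\cdot)$ be the law of $X(t)$ given $X(0)=x\in\mathbb R_+^{2n}$. Let $f_{Y_2}(y)=\prod_e (H_ea_e)^{-1}\,f_P\big((y_e/(H_ea_e))_e\big)$ be the density of the jumps of $R$ and $\tilde f_{Y_2}(s)=\int_{\mathbb R_+^n}e^{-y\cdot s}f_{Y_2}(y)\,dy$. A probability measure $g$ on $\mathbb R_+^{2n}$ is invariant if $\int p(t,x,A)\,g(dx)=g(A)$ for all $t>0$ and all measurable $A\subseteq\mathbb R_+^{2n}$. Then $X$ has a unique invariant probability measure if and only if $$\int_{y\in\mathbb R_+^n:\,|y|\ge1}\log|y|\,f_{Y_2}(y)\,dy<\infty,$$ where $|\cdot|$ is the Euclidean norm. If this condition holds, then the invariant probability measure $g$ has a density with respect to Lebesgue measure, and for every $s\in\mathbb R_+^{2n}$ its Laplace transform $\tilde g(s)=\int e^{-y\cdot s}\,g(dy)$ is $$\tilde g(s)=\exp\Big\{-\frac{\lambda}{H_r}\int_0^1\frac{1-\tilde f_{Y_2}\big((u^{-\mathbf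 M^{\mathsf T}/H_r}s)_2\big)}{u}\,du\Big\},$$ where $u^{-\mathbf M^{\mathsf T}/H_r}=\exp\big(-\tfrac{\log u}{H_r}\mathbf M^{\mathsf T}\big)$ and the integral converges. Moreover, for every $x\in\mathbb R_+^{2n}$, $p(t,x,\cdot)$ converges weakly to $g$ as $t\to\infty$. -/

import Mathlib

open MeasureTheory ProbabilityTheory

/-- A river network whose links are the elements of the finite type `E`: a finite rooted binary
tree of links, directed downstream. `down e` is the link into which `e` drains; the root is the
most downstream link, for which we use the dummy value `down root = root`. -/
structure RiverNetwork (E : Type*) [Fintype E] [DecidableEq E] where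
  root : E
  down : E → E
  down_root : down root = root
  drains : ∀ e, ∃ k : ℕ, down^[k] e = root
  binary : ∀ e, (Finset.univ.filter fun e' => e' ≠ root ∧ down e' = e).card ≤ 2

/-- `e'` is a tributary of `e`. -/
def RiverNetwork.IsTributary {E : Type*} [Fintype E] [DecidableEq E] (Γ : RiverNetwork E)
    (e' e : E) : Prop :=
  e' ≠ Γ.root ∧ Γ.down e' = e

instance {E : Type*} [Fintype E] [DecidableEq E] (Γ : RiverNetwork E) (e' e : E) :
    Decidable (Γ.IsTributary e' e) :=
  inferInstanceAs (Decidable (_ ∧ _))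

/-- The incidence matrix of the network: `1` on the diagonal, `-1` at `(e, e')` for each
tributary `e'` of `e`, and `0` elsewhere. -/
def RiverNetwork.incidence {E : Type*} [Fintype E] [DecidableEq E] (Γ : RiverNetwork E) :
    Matrix E E ℝ :=
  Matrix.of fun e e' => if e = e' then 1 else if Γ.IsTributary e' e then -1 else 0

/-- The drift matrix `[[-K Λ, K], [0, -H]]`, acting on states `(Q, R)`, where `Q` is indexed by
the first copy of `E` in `E ⊕ E` and `R` by the second. -/
def driftMatrix {E : Type*} [Fintype E] [DecidableEq E] (Γ : RiverNetwork E) (K H : E → ℝ) :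
    Matrix (E ⊕ E) (E ⊕ E) ℝ :=
  Matrix.fromBlocks (-(Matrix.diagonal K * Γ.incidence)) (Matrix.diagonal K)
    0 (-Matrix.diagonal H)

/-- The open orthant `(0, ∞)^ι`. -/
def orthant (ι : Type*) : Set (ι → ℝ) := {x | ∀ i, 0 < x i}

noncomputable section

/-- The Euclidean norm (the norm that Mathlib puts on `ι → ℝ` is the sup norm). -/
def euclNorm {ι : Type*} [Fintype ι] (y : ι → ℝ) : ℝ := Real.sqrt (∑ i, y i ^ 2)

/-- `f` is a probability density function on `(0, ∞)^ι`. -/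
structure IsOrthantDensity {ι : Type*} [Fintype ι] (f : (ι → ℝ) → ℝ) : Prop where
  measurable : Measurable f
  nonneg : ∀ y ∈ orthant ι, 0 ≤ f y
  total : ∫⁻ y in orthant ι, ENNReal.ofReal (f y) = 1

/-- The law on `(0, ∞)^ι` with density `f`. -/
def densityLaw {ι : Type*} [Fintype ι] (f : (ι → ℝ) → ℝ) : Measure (ι → ℝ) :=
  (volume.restrict (orthant ι)).withDensity fun y => ENNReal.ofReal (f y)

/-- The storm times `T 1 < T 2 < ⋯` are the arrival times of a Poisson process with intensity
`lam`, that is, the waiting times (from `T 0 = 0`) are i.i.d. exponential with rate `lam`, and the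
rainfall depths `D 1, D 2, …` are i.i.d. vectors with density `f`, independent of the storm times.
The value `D 0` is not used. -/
structure IsStormSequence {E : Type*} [Fintype E] {Ω : Type*} [MeasurableSpace Ω] (P : Measure Ω)
    (lam : ℝ) (f : (E → ℝ) → ℝ) (T : ℕ → Ω → ℝ) (D : ℕ → Ω → (E → ℝ)) : Prop where
  measurable_time : ∀ n, Measurable (T n)
  measurable_depth : ∀ n, Measurable (D n)
  time_zero : ∀ ω, T 0 ω = 0
  waiting_law : ∀ n, P.map (fun ω => T (n + 1) ω - T n ω) = expMeasure lam
  depth_law : ∀ n, P.map (D (n + 1)) = densityLaw f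
  indep_pair : ∀ n, IndepFun (fun ω => T (n + 1) ω - T n ω) (D (n + 1)) P
  indep : iIndepFun (fun n ω => (T (n + 1) ω - T n ω, D (n + 1) ω)) P

/-- The number `N(t) = sup {n ≥ 1 : T n ≤ t}` of storms up to time `t` (`0` if there is none). -/
def stormCount {Ω : Type*} (T : ℕ → Ω → ℝ) (t : ℝ) (ω : Ω) : ℕ :=
  sSup {n : ℕ | 1 ≤ n ∧ T n ω ≤ t}

/-- The jump of `(Q, R)` caused by the rainfall depths `d`: `Q` does not jump, and `R e` jumps by
`H e * a e * d e`. -/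
def jump {E : Type*} (H a d : E → ℝ) : E ⊕ E → ℝ :=
  Sum.elim (fun _ => 0) fun e => H e * (a e * d e)

/-- The flow `φ(t) = exp (t M)`. -/
def flow {E : Type*} [Fintype E] [DecidableEq E] (Γ : RiverNetwork E) (K H : E → ℝ) (t : ℝ) :
    Matrix (E ⊕ E) (E ⊕ E) ℝ :=
  NormedSpace.exp (t • driftMatrix Γ K H)

/-- The state at time `t` of the process `X = (Q, R)` started from `x`: the solution of
`dX = M X dt + dY`, where `Y` is the compound Poisson process with jump `jump H a (D n)` at time
`T n`, i.e. `X` follows the flow between storms and jumps at the storm times. -/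
def process {E : Type*} [Fintype E] [DecidableEq E] (Γ : RiverNetwork E) (K H a : E → ℝ)
    {Ω : Type*} (T : ℕ → Ω → ℝ) (D : ℕ → Ω → (E → ℝ)) (x : E ⊕ E → ℝ) (t : ℝ) (ω : Ω) :
    E ⊕ E → ℝ :=
  (flow Γ K H t).mulVec x +
    ∑ n ∈ Finset.Icc 1 (stormCount T t ω), (flow Γ K H (t - T n ω)).mulVec (jump H a (D n ω))

/-- The transition law `p(t, x, ·)` of the process. -/
def transitionLaw {E : Type*} [Fintype E] [DecidableEq E] (Γ : RiverNetwork E) (K H a : E → ℝ)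
    {Ω : Type*} [MeasurableSpace Ω] (P : Measure Ω) (T : ℕ → Ω → ℝ) (D : ℕ → Ω → (E → ℝ))
    (t : ℝ) (x : E ⊕ E → ℝ) : Measure (E ⊕ E → ℝ) :=
  P.map (process Γ K H a T D x t)

/-- `π` is an invariant probability measure on the state space `(0, ∞)^ι` for the transition laws
`p t x`. -/
structure IsInvariantLaw {ι : Type*} (p : ℝ → (ι → ℝ) → Measure (ι → ℝ)) (π : Measure (ι → ℝ)) :
    Prop where
  prob : IsProbabilityMeasure π
  supported : π (orthant ι)ᶜ = 0
  invariant : ∀ t : ℝ, 0 < t → ∀ A : Set (ι → ℝ), MeasurableSet A → A ⊆ orthant ι →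
    ∫⁻ x in orthant ι, p t x A ∂π = π A

/-- The density of the runoff jumps `H e * a e * d e`, for rainfall depths `d` with density `f`. -/
def jumpDensity {E : Type*} [Fintype E] (H a : E → ℝ) (f : (E → ℝ) → ℝ) (y : E → ℝ) : ℝ :=
  1 / (∏ e, H e * a e) * f fun e => y e / (H e * a e)

/-- The log-moment condition `∫_{|y| ≥ 1} log |y| f(y) dy < ∞` over `y ∈ (0, ∞)^ι`. -/
def HasLogMoment {ι : Type*} [Fintype ι] (f : (ι → ℝ) → ℝ) : Prop :=
  ∫⁻ y in {y | y ∈ orthant ι ∧ 1 ≤ euclNorm y},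
    ENNReal.ofReal (Real.log (euclNorm y) * f y) < ⊤

/-- The Laplace transform of a density on `(0, ∞)^ι`. -/
def densityLaplace {ι : Type*} [Fintype ι] (f : (ι → ℝ) → ℝ) (s : ι → ℝ) : ℝ :=
  ∫ y in orthant ι, Real.exp (-(y ⬝ᵥ s)) * f y

/-- The Laplace transform of a measure on `(0, ∞)^ι`. -/
def measureLaplace {ι : Type*} [Fintype ι] (π : Measure (ι → ℝ)) (s : ι → ℝ) : ℝ :=
  ∫ y in orthant ι, Real.exp (-(y ⬝ᵥ s)) ∂π

/-- The matrix power `u ^ A = exp ((log u) A)`, for `u > 0`. -/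
def matrixPow {ι : Type*} [Fintype ι] [DecidableEq ι] (u : ℝ) (A : Matrix ι ι ℝ) : Matrix ι ι ℝ :=
  NormedSpace.exp (Real.log u • A)

/-- The integrand `(1 - f̃((u^{-Mᵀ/H_r} s)₂)) / u`, where `f` is the density of the runoff jumps
and `r` is the root. -/
def laplaceIntegrand {E : Type*} [Fintype E] [DecidableEq E] (Γ : RiverNetwork E)
    (K H : E → ℝ) (f : (E → ℝ) → ℝ) (s : E ⊕ E → ℝ) (u : ℝ) : ℝ :=
  (1 - densityLaplace f fun e =>
    (matrixPow u (-((1 / H Γ.root) • (driftMatrix Γ K H).transpose))).mulVec s (Sum.inr e)) / u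

end

/-! ### Exponentials of matrices with nonnegative off-diagonal entries -/

section MatrixExponential

/-! Write φ(t) = exp(tM) and let J be the jump caused by one storm. Since X(t) = φ(t)x + Z_t, where
the law of Z_t does not depend on x, everything is governed by the Laplace transform of Z_t. For s ≥
0 it is exp(-λ ∫_0^t θ_s), with θ_s(v) = 1 - E exp(-⟨φ(v)J, s⟩) (`killRate`). This Poisson formula
is obtained from a martingale: the product of the factors of the first N storms, times the solution
of a renewal equation evaluated at T_N, has constant mean (`IsStormSequence.integral_prod_mul_eq`).

The off-diagonal entries of M are nonnegative, so φ(t) ≥ 0 for t ≥ 0, and a weighted count of the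
stored water shows that φ(t) decays exponentially (`exists_flow_le_exp`). If g is invariant, then
g̃(s) = g̃(φ(t)ᵀs) exp(-λ ∫_0^t θ_s). As t → ∞ the first factor tends to 1. Because g̃(s) > 0, the
integral of θ_s must converge and g̃(s) = exp(-λ ∫_0^∞ θ_s). This yields uniqueness, the transform,
and, at s = (1,…,1), the necessity of integrability.

Integrability of θ_s for s = (1,…,1), and then for all s ≥ 0, is the log-moment condition. With y
the sum of the coordinates of J, ⟨φ(v)J, s⟩ is at most a constant times y e^{-cv} and, at s =
(1,…,1), at least y e^{-mv}. The integral over v > 0 of 1 - exp(-y e^{-cv}) grows like log⁺ y, and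
Tonelli exchanges age and depth.

Conversely, reversing time gives Z_t the law of the sum of φ(T_k)J_k over T_k ≤ t. Its terms are
nonnegative, and its Laplace transform near s = 0 shows that the full series converges almost surely
when θ_s is integrable. The law of the series is invariant, and since φ(t)x → 0 the almost sure
convergence gives weak convergence from every starting point.

For the density, the stationary law is that of φ(W₁)J₁ + φ(W₁+W₂)(J₂ + X), with X stationary and
independent of two fresh storms separated by exponential waiting times. With W₁, W₂ and X fixed,
this is an affine bijection of the two depth vectors onto the 2n-dimensional state space: the block
of φ(W₂) from runoff to discharge is triangular for the depth in the tree, with positive diagonal.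
Absolute continuity of the depths therefore passes to the state. The substitution u = exp(-H_r v)
puts the transform in its stated form. -/

theorem Matrix.smul_shift_nonneg {ι : Type*} [DecidableEq ι] {M : Matrix ι ι ℝ} {m : ℝ}
    (hM : ∀ i j, i ≠ j → 0 ≤ M i j) (hm : ∀ i, -m ≤ M i i) {t : ℝ} (ht : 0 ≤ t)
    (i j : ι) : 0 ≤ (t • (M + m • (1 : Matrix ι ι ℝ))) i j := by
  rw [Matrix.smul_apply, Matrix.add_apply, Matrix.smul_apply, smul_eq_mul, smul_eq_mul]
  refine mul_nonneg ht ?_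
  by_cases h : i = j
  · subst h
    rw [Matrix.one_apply_eq]
    linarith [hm i]
  · rw [Matrix.one_apply_ne h, mul_zero, add_zero]
    exact hM i j h

variable {ι : Type*} [Fintype ι] [DecidableEq ι]

open scoped Matrix.Norms.Operator in
theorem Matrix.hasSum_exp_apply (A : Matrix ι ι ℝ) (i j : ι) :
    HasSum (fun k : ℕ => ((k.factorial : ℝ))⁻¹ * (A ^ k) i j) (NormedSpace.exp A i j) := by
  have h := NormedSpace.exp_series_hasSum_exp' (𝕂 := ℝ) A
  have h1 := h.map (Matrix.entryAddMonoidHom ℝ i j) (by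
    change Continuous fun A : Matrix ι ι ℝ => A i j
    fun_prop)
  exact h1

open scoped Matrix.Norms.Operator in
theorem Matrix.continuous_exp_smul (A : Matrix ι ι ℝ) :
    Continuous fun t : ℝ => NormedSpace.exp (t • A) :=
  NormedSpace.exp_continuous.comp (by fun_prop)

theorem Matrix.exp_apply_nonneg {A : Matrix ι ι ℝ} (hA : ∀ i j, 0 ≤ A i j) (i j : ι) :
    0 ≤ NormedSpace.exp A i j :=
  (A.hasSum_exp_apply i j).nonneg fun k =>
    mul_nonneg (by positivity) (Matrix.pow_apply_nonneg hA k i j)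

theorem Matrix.le_exp_apply {A : Matrix ι ι ℝ} (hA : ∀ i j, 0 ≤ A i j) (k : ℕ) (i j : ι) :
    ((k.factorial : ℝ))⁻¹ * (A ^ k) i j ≤ NormedSpace.exp A i j :=
  le_hasSum (A.hasSum_exp_apply i j) k fun l _ =>
    mul_nonneg (by positivity) (Matrix.pow_apply_nonneg hA l i j)

/-- Matrices supported on a reflexive transitive relation contain the identity and are closed under
products, so every term of the exponential series keeps the zero pattern. -/
theorem Matrix.exp_apply_eq_zero {A : Matrix ι ι ℝ} {r : ι → ι → Prop} (hrefl : ∀ i, r i i)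
    (htrans : ∀ i j k, r i j → r j k → r i k) (hA : ∀ i j, ¬ r i j → A i j = 0) {i j : ι}
    (hij : ¬ r i j) : NormedSpace.exp A i j = 0 := by
  have hpow : ∀ (k : ℕ) (i j : ι), ¬ r i j → (A ^ k) i j = 0 := by
    intro k
    induction k with
    | zero =>
      intro i j h
      rw [pow_zero, Matrix.one_apply_ne]
      rintro rfl
      exact h (hrefl i)
    | succ k ih =>
      intro i j h
      rw [pow_succ, Matrix.mul_apply]
      refine Finset.sum_eq_zero fun l _ => ?_
      by_cases hil : r i l
      · rw [hA l j fun hlj => h (htrans i l j hil hlj), mul_zero]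
      · rw [ih i l hil, zero_mul]
  refine (A.hasSum_exp_apply i j).unique ?_
  simp [hpow _ i j hij]

/-- Nonnegativity of `A` allows the row inequality `p A ≤ c p` to be iterated to `p A ^ k ≤ c ^ k
p`; the exponential series is then compared term by term. -/
theorem Matrix.sum_mul_exp_apply_le {A : Matrix ι ι ℝ} (hA : ∀ i j, 0 ≤ A i j) {p : ι → ℝ} {c : ℝ}
    (hc : 0 ≤ c) (hp : ∀ j, ∑ i, p i * A i j ≤ c * p j) (j : ι) :
    ∑ i, p i * NormedSpace.exp A i j ≤ Real.exp c * p j := by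
  have hpow : ∀ (k : ℕ) (j : ι), ∑ i, p i * (A ^ k) i j ≤ c ^ k * p j := by
    intro k
    induction k with
    | zero => intro j; simp [Matrix.one_apply]
    | succ k ih =>
      intro j
      calc ∑ i, p i * (A ^ (k + 1)) i j = ∑ l, (∑ i, p i * (A ^ k) i l) * A l j := by
            simp_rw [pow_succ, Matrix.mul_apply, Finset.mul_sum, Finset.sum_mul]
            rw [Finset.sum_comm]
            simp_rw [mul_assoc]
        _ ≤ ∑ l, c ^ k * p l * A l j :=
            Finset.sum_le_sum fun l _ => mul_le_mul_of_nonneg_right (ih l) (hA l j)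
        _ = c ^ k * ∑ l, p l * A l j := by rw [Finset.mul_sum]; simp_rw [mul_assoc]
        _ ≤ c ^ k * (c * p j) := mul_le_mul_of_nonneg_left (hp j) (pow_nonneg hc k)
        _ = c ^ (k + 1) * p j := by ring
  have h1 : HasSum (fun k : ℕ => ∑ i, p i * (((k.factorial : ℝ))⁻¹ * (A ^ k) i j))
      (∑ i, p i * NormedSpace.exp A i j) :=
    hasSum_sum fun i _ => (A.hasSum_exp_apply i j).mul_left (p i)
  have h2 : HasSum (fun k : ℕ => c ^ k / (k.factorial : ℝ) * p j) (Real.exp c * p j) := by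
    rw [Real.exp_eq_exp_ℝ]
    exact (NormedSpace.expSeries_div_hasSum_exp c).mul_right (p j)
  refine hasSum_le (fun k => ?_) h1 h2
  calc ∑ i, p i * (((k.factorial : ℝ))⁻¹ * (A ^ k) i j)
      = ((k.factorial : ℝ))⁻¹ * ∑ i, p i * (A ^ k) i j := by
        rw [Finset.mul_sum]; exact Finset.sum_congr rfl fun i _ => by ring
    _ ≤ ((k.factorial : ℝ))⁻¹ * (c ^ k * p j) :=
        mul_le_mul_of_nonneg_left (hpow k j) (by positivity)
    _ = c ^ k / (k.factorial : ℝ) * p j := by ring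

/-- A multiple of the identity commutes with everything and contributes only a scalar factor. A
large enough shift makes the matrix entrywise nonnegative, which reduces bounds for `exp (t • M)` to
bounds for a series with nonnegative terms. -/
theorem Matrix.exp_smul_eq_exp_smul_shift (M : Matrix ι ι ℝ) (m t : ℝ) :
    NormedSpace.exp (t • M) =
      Real.exp (-(m * t)) • NormedSpace.exp (t • (M + m • (1 : Matrix ι ι ℝ))) := by
  have h1 : t • M = (-(m * t)) • (1 : Matrix ι ι ℝ) + t • (M + m • (1 : Matrix ι ι ℝ)) := by
    rw [smul_add, smul_smul, neg_smul, mul_comm m t]; abel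
  have h2 : NormedSpace.exp ((-(m * t)) • (1 : Matrix ι ι ℝ)) =
      Real.exp (-(m * t)) • (1 : Matrix ι ι ℝ) := by
    rw [Matrix.smul_one_eq_diagonal, Matrix.exp_diagonal, Matrix.smul_one_eq_diagonal]
    congr 1
    funext i
    rw [Pi.coe_exp, Real.exp_eq_exp_ℝ]
  conv_lhs => rw [h1]
  rw [Matrix.exp_add_of_commute _ _ ((Commute.one_left _).smul_left _), h2, smul_mul_assoc, one_mul]

variable {M : Matrix ι ι ℝ} {m : ℝ}

theorem Matrix.metzler_exp_nonneg (hM : ∀ i j, i ≠ j → 0 ≤ M i j) (hm : ∀ i, -m ≤ M i i) {t : ℝ}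
    (ht : 0 ≤ t) (i j : ι) : 0 ≤ NormedSpace.exp (t • M) i j := by
  rw [M.exp_smul_eq_exp_smul_shift m t, Matrix.smul_apply, smul_eq_mul]
  exact mul_nonneg (Real.exp_pos _).le
    (Matrix.exp_apply_nonneg (Matrix.smul_shift_nonneg hM hm ht) i j)

theorem Matrix.le_metzler_exp_diag (hM : ∀ i j, i ≠ j → 0 ≤ M i j) (hm : ∀ i, -m ≤ M i i) {t : ℝ}
    (ht : 0 ≤ t) (i : ι) : Real.exp (-(m * t)) ≤ NormedSpace.exp (t • M) i i := by
  rw [M.exp_smul_eq_exp_smul_shift m t, Matrix.smul_apply, smul_eq_mul]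
  have := Matrix.le_exp_apply (Matrix.smul_shift_nonneg hM hm ht) 0 i i
  rw [pow_zero, Matrix.one_apply_eq, Nat.factorial_zero, Nat.cast_one, inv_one, one_mul] at this
  exact le_mul_of_one_le_right (Real.exp_pos _).le this

theorem Matrix.le_metzler_exp_of_ne (hM : ∀ i j, i ≠ j → 0 ≤ M i j) (hm : ∀ i, -m ≤ M i i) {t : ℝ}
    (ht : 0 ≤ t) {i j : ι} (hij : i ≠ j) :
    Real.exp (-(m * t)) * (t * M i j) ≤ NormedSpace.exp (t • M) i j := by
  rw [M.exp_smul_eq_exp_smul_shift m t, Matrix.smul_apply, smul_eq_mul]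
  have := Matrix.le_exp_apply (Matrix.smul_shift_nonneg hM hm ht) 1 i j
  rw [pow_one, Nat.factorial_one, Nat.cast_one, inv_one, one_mul] at this
  refine mul_le_mul_of_nonneg_left ?_ (Real.exp_pos _).le
  simpa [Matrix.one_apply_ne hij] using this

/-- A linear Lyapunov function: if `p · x` decays at rate at least `c` under the generator, it does
so along the semigroup. -/
theorem Matrix.sum_mul_metzler_exp_le (hM : ∀ i j, i ≠ j → 0 ≤ M i j) (hm : ∀ i, -m ≤ M i i)
    {p : ι → ℝ} {c : ℝ}
    (hp : ∀ j, ∑ i, p i * M i j ≤ -c * p j) {t : ℝ} (ht : 0 ≤ t) (j : ι) :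
    ∑ i, p i * NormedSpace.exp (t • M) i j ≤ Real.exp (-(c * t)) * p j := by
  -- The shift must dominate `m` to make the matrix nonnegative, and `c` to make the growth rate of
  -- the shifted inequality nonnegative.
  have hm' : ∀ i, -max m c ≤ M i i := fun i => (neg_le_neg (le_max_left m c)).trans (hm i)
  have hc : 0 ≤ t * (max m c - c) := mul_nonneg ht (sub_nonneg.2 (le_max_right m c))
  have key := Matrix.sum_mul_exp_apply_le (Matrix.smul_shift_nonneg hM hm' ht) (p := p) hc
    (fun j => by
      have h1 : ∑ i, p i * (t • (M + max m c • (1 : Matrix ι ι ℝ))) i j =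
          t * (∑ i, p i * M i j + max m c * p j) := by
        simp only [Matrix.smul_apply, Matrix.add_apply, smul_eq_mul, Matrix.one_apply, mul_add,
          Finset.sum_add_distrib, Finset.mul_sum]
        congr 1
        · exact Finset.sum_congr rfl fun i _ => by ring
        · simp; ring
      rw [h1]
      nlinarith [hp j, mul_le_mul_of_nonneg_left (hp j) ht]) j
  rw [M.exp_smul_eq_exp_smul_shift (max m c) t]
  simp only [Matrix.smul_apply, smul_eq_mul]
  calc ∑ i, p i * (Real.exp (-(max m c * t)) *
        NormedSpace.exp (t • (M + max m c • (1 : Matrix ι ι ℝ))) i j)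
      = Real.exp (-(max m c * t)) *
        ∑ i, p i * NormedSpace.exp (t • (M + max m c • (1 : Matrix ι ι ℝ))) i j := by
        rw [Finset.mul_sum]; exact Finset.sum_congr rfl fun i _ => by ring
    _ ≤ Real.exp (-(max m c * t)) * (Real.exp (t * (max m c - c)) * p j) :=
        mul_le_mul_of_nonneg_left key (Real.exp_pos _).le
    _ = Real.exp (-(c * t)) * p j := by
        rw [← mul_assoc, ← Real.exp_add]; congr 2; ring

end MatrixExponential

/-! ### The flow of the network: positivity, triangular structure and exponential decay -/

section Flow

variable {E : Type*} [Fintype E] [DecidableEq E] (Γ : RiverNetwork E)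

/-- The number of links between `e` and the root. -/
def RiverNetwork.depth (e : E) : ℕ := Nat.find (Γ.drains e)

theorem RiverNetwork.depth_eq_depth_down_add_one {e : E} (he : e ≠ Γ.root) :
    Γ.depth e = Γ.depth (Γ.down e) + 1 := by
  have h0 : Γ.depth e ≠ 0 := by
    intro h
    have := Nat.find_spec (Γ.drains e)
    rw [show Nat.find (Γ.drains e) = 0 from h] at this
    exact he this
  obtain ⟨k, hk⟩ := Nat.exists_eq_succ_of_ne_zero h0
  have hspec : Γ.down^[k] (Γ.down e) = Γ.root := by
    have := Nat.find_spec (Γ.drains e)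
    rwa [show Nat.find (Γ.drains e) = k.succ from hk, Function.iterate_succ_apply] at this
  rw [hk, Nat.succ_eq_add_one]
  congr 1
  refine le_antisymm ?_ (Nat.find_min' _ hspec)
  have h2 : Γ.down^[Γ.depth (Γ.down e) + 1] e = Γ.root := by
    rw [Function.iterate_succ_apply]
    exact Nat.find_spec (Γ.drains (Γ.down e))
  have : Γ.depth e ≤ Γ.depth (Γ.down e) + 1 := Nat.find_min' _ h2
  omega

theorem RiverNetwork.depth_root : Γ.depth Γ.root = 0 :=
  (Nat.find_eq_zero _).2 rfl

variable {Γ} {K H : E → ℝ}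

theorem RiverNetwork.incidence_apply_of_ne {e e' : E} (h : e ≠ e') :
    Γ.incidence e e' = if Γ.IsTributary e' e then -1 else 0 := by
  simp [RiverNetwork.incidence, h]

theorem RiverNetwork.not_isTributary_self (e : E) : ¬ Γ.IsTributary e e := by
  rintro ⟨h1, h2⟩
  have := Γ.depth_eq_depth_down_add_one h1
  rw [h2] at this
  omega

theorem RiverNetwork.incidence_apply (e e' : E) :
    Γ.incidence e e' = (if e = e' then 1 else 0) - (if Γ.IsTributary e' e then 1 else 0) := by
  by_cases h : e = e'
  · subst h; simp [RiverNetwork.incidence, RiverNetwork.not_isTributary_self]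
  · simp only [RiverNetwork.incidence_apply_of_ne h, h, if_false]
    split_ifs <;> norm_num

theorem driftMatrix_offDiag_nonneg (hK : ∀ e, 0 < K e) (i j : E ⊕ E) (hij : i ≠ j) :
    0 ≤ driftMatrix Γ K H i j := by
  rcases i with e | e <;> rcases j with e' | e'
  · have h : e ≠ e' := fun h => hij (by rw [h])
    simp only [driftMatrix, Matrix.fromBlocks_apply₁₁, Matrix.neg_apply, Matrix.diagonal_mul,
      RiverNetwork.incidence_apply_of_ne h]
    split_ifs
    · linarith [hK e]
    · simp
  · simp only [driftMatrix, Matrix.fromBlocks_apply₁₂, Matrix.diagonal_apply]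
    split_ifs
    · exact (hK e).le
    · exact le_rfl
  · simp [driftMatrix]
  · have h : e ≠ e' := fun h => hij (by rw [h])
    simp [driftMatrix, Matrix.diagonal_apply_ne _ h]

theorem exists_neg_le_driftMatrix_diag (Γ : RiverNetwork E) (hK : ∀ e, 0 < K e)
    (hH : ∀ e, 0 < H e) :
    ∃ m : ℝ, 0 < m ∧ ∀ i, -m ≤ driftMatrix Γ K H i i := by
  refine ⟨∑ e, K e + ∑ e, H e, ?_, ?_⟩
  · have : (Finset.univ : Finset E).Nonempty := ⟨Γ.root, Finset.mem_univ _⟩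
    exact add_pos (Finset.sum_pos (fun e _ => hK e) this) (Finset.sum_pos (fun e _ => hH e) this)
  · have hK' : ∀ e, K e ≤ ∑ e, K e := fun e =>
      Finset.single_le_sum (fun e _ => (hK e).le) (Finset.mem_univ e)
    have hH' : ∀ e, H e ≤ ∑ e, H e := fun e =>
      Finset.single_le_sum (fun e _ => (hH e).le) (Finset.mem_univ e)
    rintro (e | e)
    · have : driftMatrix Γ K H (Sum.inl e) (Sum.inl e) = -K e := by
        simp [driftMatrix, RiverNetwork.incidence]
      rw [this]
      linarith [hK' e, hH' e, hH e]
    · have : driftMatrix Γ K H (Sum.inr e) (Sum.inr e) = -H e := by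
        simp [driftMatrix]
      rw [this]
      linarith [hK' e, hH' e, hK e]

theorem flow_zero : flow Γ K H 0 = 1 := by
  rw [flow, zero_smul, NormedSpace.exp_zero]

theorem flow_add (s t : ℝ) : flow Γ K H (s + t) = flow Γ K H s * flow Γ K H t := by
  rw [flow, add_smul]
  exact Matrix.exp_add_of_commute _ _ (((Commute.refl _).smul_left _).smul_right _)

theorem continuous_flow : Continuous (flow Γ K H) :=
  Matrix.continuous_exp_smul _

theorem flow_nonneg (hK : ∀ e, 0 < K e) (hH : ∀ e, 0 < H e) {t : ℝ} (ht : 0 ≤ t) (i j : E ⊕ E) :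
    0 ≤ flow Γ K H t i j := by
  obtain ⟨m, -, hm⟩ := exists_neg_le_driftMatrix_diag Γ hK hH
  exact Matrix.metzler_exp_nonneg (driftMatrix_offDiag_nonneg hK) hm ht i j

theorem exists_exp_le_flow_diag (Γ : RiverNetwork E) (hK : ∀ e, 0 < K e) (hH : ∀ e, 0 < H e) :
    ∃ m : ℝ, 0 < m ∧ ∀ t, 0 ≤ t → ∀ i, Real.exp (-(m * t)) ≤ flow Γ K H t i i := by
  obtain ⟨m, hm0, hm⟩ := exists_neg_le_driftMatrix_diag Γ hK hH
  exact ⟨m, hm0, fun t ht i =>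
    Matrix.le_metzler_exp_diag (driftMatrix_offDiag_nonneg hK) hm ht i⟩

theorem flow_diag_pos (hK : ∀ e, 0 < K e) (hH : ∀ e, 0 < H e) {t : ℝ} (ht : 0 ≤ t) (i : E ⊕ E) :
    0 < flow Γ K H t i i := by
  obtain ⟨m, -, hm⟩ := exists_exp_le_flow_diag Γ hK hH
  exact (Real.exp_pos _).trans_le (hm t ht i)

theorem flow_inl_inr_pos (hK : ∀ e, 0 < K e) (hH : ∀ e, 0 < H e) {t : ℝ} (ht : 0 < t) (e : E) :
    0 < flow Γ K H t (Sum.inl e) (Sum.inr e) := by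
  obtain ⟨m, -, hm⟩ := exists_neg_le_driftMatrix_diag Γ hK hH
  have h := Matrix.le_metzler_exp_of_ne (driftMatrix_offDiag_nonneg hK) hm ht.le
    (i := Sum.inl e) (j := Sum.inr e) (by simp)
  have h2 : driftMatrix Γ K H (Sum.inl e) (Sum.inr e) = K e := by simp [driftMatrix]
  rw [h2] at h
  exact (mul_pos (Real.exp_pos _) (mul_pos ht (hK e))).trans_le h

/-- Water moves only downstream, so the runoff of `e'` reaches another link `e` only if `e'` is
strictly deeper in the tree. Forgetting which block an index lies in, the relation "same link or
strictly smaller depth" is a preorder containing the support of the drift matrix. -/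
theorem flow_inl_inr_eq_zero {t : ℝ} {e e' : E} (hne : e ≠ e') (h : Γ.depth e' ≤ Γ.depth e) :
    flow Γ K H t (Sum.inl e) (Sum.inr e') = 0 := by
  let π : E ⊕ E → E := Sum.elim id id
  refine Matrix.exp_apply_eq_zero
    (r := fun i j => π i = π j ∨ Γ.depth (π i) < Γ.depth (π j)) (fun i => Or.inl rfl) ?_ ?_ ?_
  · rintro i j k (h1 | h1) (h2 | h2)
    · exact Or.inl (h1.trans h2)
    · rw [h1]; exact Or.inr h2
    · rw [← h2]; exact Or.inr h1
    · exact Or.inr (h1.trans h2)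
  · intro i j hij
    rw [Matrix.smul_apply, smul_eq_mul]
    refine mul_eq_zero_of_right _ ?_
    push Not at hij
    rcases i with e | e <;> rcases j with e' | e'
    · have hne : e ≠ e' := hij.1
      have ht : ¬ Γ.IsTributary e' e := by
        rintro ⟨h1, h2⟩
        have h3 := Γ.depth_eq_depth_down_add_one h1
        have h4 : Γ.depth e' ≤ Γ.depth e := hij.2
        rw [h2] at h3
        omega
      simp [driftMatrix, RiverNetwork.incidence_apply_of_ne hne, ht]
    · have hne : e ≠ e' := hij.1
      simp [driftMatrix, hne]
    · simp [driftMatrix]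
    · have hne : e ≠ e' := hij.1
      simp [driftMatrix, hne]
  · rintro (h1 | h1)
    · exact hne h1
    · exact absurd h1 (not_lt.2 h)

/-- A weight vector `p > 0` with `p M = -1` is a Lyapunov function: if `b` bounds its entries, then
`p M ≤ -b⁻¹ p`, hence `p φ(t) ≤ exp (-t / b) p`. Since the flow is nonnegative, this controls each
entry. -/
theorem exists_flow_le_exp (Γ : RiverNetwork E) (hK : ∀ e, 0 < K e) (hH : ∀ e, 0 < H e) :
    ∃ C c : ℝ, 0 < C ∧ 0 < c ∧ ∀ t, 0 ≤ t → ∀ i j, flow Γ K H t i j ≤ C * Real.exp (-(c * t)) := by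
  obtain ⟨m, -, hm⟩ := exists_neg_le_driftMatrix_diag Γ hK hH
  -- `q e` is the number of links from `e` to the root, both included. The stored water `Q e / K e`
  -- of a link is weighted by `q e` and the runoff storage `R e / H e` by `q e + 1`, the number of
  -- reservoirs still to be passed. Water leaving a reservoir loses exactly one unit of weight, so
  -- the weighted storage falls at rate `∑ Q + ∑ R`, that is, `p M = -1`.
  let q : E → ℝ := fun e => Γ.depth e + 1
  have hq : ∀ e, 0 < q e := fun e => by positivity
  let p : E ⊕ E → ℝ := Sum.elim (fun e => q e / K e) fun e => (q e + 1) / H e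
  have hp : ∀ i, 0 < p i := by
    rintro (e | e)
    · exact div_pos (hq e) (hK e)
    · exact div_pos (by linarith [hq e]) (hH e)
  have hpM : ∀ j, ∑ i, p i * driftMatrix Γ K H i j = -1 := by
    rintro (e' | e')
    · rw [Fintype.sum_sum_type]
      have h1 : ∀ e, p (Sum.inl e) * driftMatrix Γ K H (Sum.inl e) (Sum.inl e') =
          (if Γ.IsTributary e' e then q e else 0) - (if e = e' then q e else 0) := by
        intro e
        simp only [p, Sum.elim_inl, driftMatrix, Matrix.fromBlocks_apply₁₁, Matrix.neg_apply,
          Matrix.diagonal_mul, RiverNetwork.incidence_apply]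
        have := (hK e).ne'
        split_ifs <;> field_simp <;> ring
      have h2 : ∀ e, p (Sum.inr e) * driftMatrix Γ K H (Sum.inr e) (Sum.inl e') = 0 := by
        intro e; simp [driftMatrix]
      simp_rw [h1, h2]
      rw [Finset.sum_sub_distrib]
      simp only [Finset.sum_ite_eq', Finset.mem_univ, if_true, Finset.sum_const_zero, add_zero]
      by_cases hr : e' = Γ.root
      · have : ∀ e, ¬ Γ.IsTributary e' e := fun e h => h.1 hr
        simp only [this, if_false, Finset.sum_const_zero]
        simp [q, hr, Γ.depth_root]
      · have h3 : ∑ e, (if Γ.IsTributary e' e then q e else 0) = q (Γ.down e') := by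
          rw [Finset.sum_eq_single (Γ.down e')]
          · simp [RiverNetwork.IsTributary, hr]
          · intro b _ hb
            have : ¬ Γ.IsTributary e' b := fun h => hb h.2.symm
            simp [this]
          · simp
        rw [h3]
        simp only [q, Γ.depth_eq_depth_down_add_one hr]
        push_cast
        ring
    · rw [Fintype.sum_sum_type]
      have h1 : ∀ e, p (Sum.inl e) * driftMatrix Γ K H (Sum.inl e) (Sum.inr e') =
          if e = e' then q e else 0 := by
        intro e
        simp only [p, Sum.elim_inl, driftMatrix, Matrix.fromBlocks_apply₁₂,
          Matrix.diagonal_apply]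
        have := (hK e).ne'
        split_ifs
        · field_simp
        · simp
      have h2 : ∀ e, p (Sum.inr e) * driftMatrix Γ K H (Sum.inr e) (Sum.inr e') =
          if e = e' then -(q e + 1) else 0 := by
        intro e
        simp only [p, Sum.elim_inr, driftMatrix, Matrix.fromBlocks_apply₂₂, Matrix.neg_apply,
          Matrix.diagonal_apply]
        have := (hH e).ne'
        split_ifs <;> field_simp
        simp
      simp_rw [h1, h2]
      simp
  let b : ℝ := ∑ i, p i
  have hpb : ∀ i, p i ≤ b := fun i =>
    Finset.single_le_sum (fun i _ => (hp i).le) (Finset.mem_univ i)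
  have hb : 0 < b := (hp (Sum.inl Γ.root)).trans_le (hpb _)
  let d : ℝ := ∑ i, (p i)⁻¹
  have hpd : ∀ i, (p i)⁻¹ ≤ d := fun i =>
    Finset.single_le_sum (fun i _ => (inv_pos.2 (hp i)).le) (Finset.mem_univ i)
  have hd : 0 < d := (inv_pos.2 (hp (Sum.inl Γ.root))).trans_le (hpd _)
  refine ⟨d * b, b⁻¹, mul_pos hd hb, inv_pos.2 hb, fun t ht i j => ?_⟩
  have key := Matrix.sum_mul_metzler_exp_le (driftMatrix_offDiag_nonneg hK) hm (p := p) (c := b⁻¹)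
    (fun j => by
      rw [hpM j]
      have : b⁻¹ * p j ≤ 1 := by
        rw [inv_mul_le_iff₀ hb, mul_one]; exact hpb j
      linarith) ht j
  have h1 : p i * flow Γ K H t i j ≤ Real.exp (-(b⁻¹ * t)) * p j :=
    (Finset.single_le_sum (f := fun i => p i * flow Γ K H t i j)
      (fun i _ => mul_nonneg (hp i).le (flow_nonneg hK hH ht i j)) (Finset.mem_univ i)).trans key
  calc flow Γ K H t i j = (p i)⁻¹ * (p i * flow Γ K H t i j) := by
        rw [inv_mul_cancel_left₀ (hp i).ne']
    _ ≤ (p i)⁻¹ * (Real.exp (-(b⁻¹ * t)) * p j) :=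
        mul_le_mul_of_nonneg_left h1 (inv_pos.2 (hp i)).le
    _ ≤ d * (Real.exp (-(b⁻¹ * t)) * b) := by
        gcongr
        · exact mul_nonneg (Real.exp_pos _).le (hp j).le
        · exact hpd i
        · exact hpb j
    _ = d * b * Real.exp (-(b⁻¹ * t)) := by ring

/-- The block of the flow through which runoff feeds the discharge is injective: it is triangular
with respect to depth, with positive diagonal. -/
theorem eq_zero_of_flow_inl_inr_sum_eq_zero (hK : ∀ e, 0 < K e) (hH : ∀ e, 0 < H e) {t : ℝ}
    (ht : 0 < t) {z : E → ℝ}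
    (hz : ∀ e, ∑ e', flow Γ K H t (Sum.inl e) (Sum.inr e') * z e' = 0) : z = 0 := by
  by_contra hne
  obtain ⟨e₀, he₀⟩ := Function.ne_iff.1 hne
  let S : Finset E := Finset.univ.filter fun e => z e ≠ 0
  -- At a deepest link of the support of `z`, only the diagonal term of the corresponding row
  -- survives.
  obtain ⟨e, heS, hmax⟩ := S.exists_max_image Γ.depth ⟨e₀, by simpa [S] using he₀⟩
  have h := hz e
  rw [Finset.sum_eq_single e] at h
  · rcases mul_eq_zero.1 h with h | h
    · exact (flow_inl_inr_pos hK hH ht e).ne' h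
    · exact (Finset.mem_filter.1 heS).2 h
  · intro e' _ hne'
    by_cases hz' : z e' = 0
    · rw [hz', mul_zero]
    · rw [flow_inl_inr_eq_zero hne'.symm (hmax e' (by simpa [S] using hz')), zero_mul]
  · simp

end Flow

/-! ### Laplace transforms determine finite measures on the nonnegative orthant -/

section LaplaceUniqueness

open scoped NNReal BoundedContinuousFunction

variable {ι : Type*} [Fintype ι]

/-- The exponential `x ↦ exp (-(x ⬝ᵥ s))` as a bounded continuous function on `[0, ∞)^ι`. -/
noncomputable def laplaceKernel (s : ι → ℝ≥0) : (ι → ℝ≥0) →ᵇ ℝ :=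
  BoundedContinuousFunction.ofNormedAddCommGroup
    (fun x => Real.exp (-∑ i, (x i : ℝ) * s i)) (by fun_prop) 1 (fun x => by
      rw [Real.norm_eq_abs, abs_of_pos (Real.exp_pos _), Real.exp_le_one_iff, neg_nonpos]
      exact Finset.sum_nonneg fun i _ => by positivity)

theorem laplaceKernel_apply (s x : ι → ℝ≥0) :
    laplaceKernel s x = Real.exp (-∑ i, (x i : ℝ) * s i) := rfl

/-- The functions `laplaceKernel s` as a multiplicative family. -/
noncomputable def laplaceKernelHom : Multiplicative (ι → ℝ≥0) →* ((ι → ℝ≥0) →ᵇ ℝ) where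
  toFun s := laplaceKernel s.toAdd
  map_one' := by ext x; simp [laplaceKernel_apply]
  map_mul' s t := by
    ext x
    simp only [BoundedContinuousFunction.coe_mul, Pi.mul_apply, laplaceKernel_apply, toAdd_mul,
      ← Real.exp_add, Pi.add_apply, NNReal.coe_add, mul_add, Finset.sum_add_distrib, neg_add]

/-- The algebra spanned by the exponentials. -/
noncomputable def laplaceAlgebra (ι : Type*) [Fintype ι] :
    StarSubalgebra ℝ ((ι → ℝ≥0) →ᵇ ℝ) where
  toSubalgebra := Algebra.adjoin ℝ (MonoidHom.mrange (laplaceKernelHom (ι := ι)))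
  star_mem' := by
    intro f hf
    have : star f = f := by ext x; simp
    rwa [this]

theorem laplaceKernel_mem_laplaceAlgebra (s : ι → ℝ≥0) : laplaceKernel s ∈ laplaceAlgebra ι :=
  Algebra.subset_adjoin ⟨Multiplicative.ofAdd s, rfl⟩

/-- The exponentials separate points, so integrals over the algebra they generate determine a finite
measure on a Polish space. Being closed under multiplication, they span that algebra linearly, and
agreement on exponentials suffices. Working over `ℝ≥0` makes them bounded. -/
theorem ext_of_laplaceKernel {μ ν : Measure (ι → ℝ≥0)} [IsFiniteMeasure μ] [IsFiniteMeasure ν]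
    (h : ∀ s, ∫ x, laplaceKernel s x ∂μ = ∫ x, laplaceKernel s x ∂ν) : μ = ν := by
  classical
  refine ext_of_forall_mem_subalgebra_integral_eq_of_polish (𝕜 := ℝ) (A := laplaceAlgebra ι) ?_ ?_
  · intro x y hxy
    obtain ⟨i, hi⟩ := Function.ne_iff.1 hxy
    refine ⟨laplaceKernel (Pi.single i 1), ⟨_, ⟨laplaceKernel (Pi.single i 1),
      laplaceKernel_mem_laplaceAlgebra _, rfl⟩, rfl⟩, ?_⟩
    have hz : ∀ z : ι → ℝ≥0, laplaceKernel (Pi.single i 1) z = Real.exp (-(z i : ℝ)) := by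
      intro z
      rw [laplaceKernel_apply, Finset.sum_eq_single i]
      · simp
      · intro j _ hj; simp [hj]
      · simp
    rw [hz, hz]
    intro h
    rw [Real.exp_eq_exp, neg_inj] at h
    exact hi (NNReal.coe_injective h)
  · intro f hf
    have hf' : f ∈ Submodule.span ℝ
        ((MonoidHom.mrange (laplaceKernelHom (ι := ι)) : Submonoid _) : Set ((ι → ℝ≥0) →ᵇ ℝ)) := by
      have h1 := Algebra.adjoin_eq_span (R := ℝ)
        ((MonoidHom.mrange (laplaceKernelHom (ι := ι)) : Submonoid _) : Set ((ι → ℝ≥0) →ᵇ ℝ))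
      rw [Submonoid.closure_eq] at h1
      rw [← h1]
      exact hf
    induction hf' using Submodule.span_induction with
    | mem x hx =>
      obtain ⟨s, rfl⟩ := hx
      exact h s.toAdd
    | zero => simp
    | add x y hx' hy' hx hy =>
      have e1 : x ∈ laplaceAlgebra ι := by
        have := Algebra.span_le_adjoin ℝ _ hx'
        exact this
      have e2 : y ∈ laplaceAlgebra ι := by
        have := Algebra.span_le_adjoin ℝ _ hy'
        exact this
      simp only [BoundedContinuousFunction.coe_add, Pi.add_apply]
      rw [integral_add (x.integrable _) (y.integrable _),
        integral_add (x.integrable _) (y.integrable _), hx e1, hy e2]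
    | smul c x hx' hx =>
      have e1 : x ∈ laplaceAlgebra ι := Algebra.span_le_adjoin ℝ _ hx'
      simp only [BoundedContinuousFunction.coe_smul]
      rw [integral_smul, integral_smul, hx e1]

theorem exp_neg_dotProduct_le_one {x s : ι → ℝ} (hx : ∀ i, 0 ≤ x i) (hs : ∀ i, 0 ≤ s i) :
    Real.exp (-(x ⬝ᵥ s)) ≤ 1 := by
  rw [Real.exp_le_one_iff, neg_nonpos]
  exact Finset.sum_nonneg fun i _ => mul_nonneg (hx i) (hs i)

theorem norm_exp_neg_dotProduct_le_one {x s : ι → ℝ} (hx : ∀ i, 0 ≤ x i) (hs : ∀ i, 0 ≤ s i) :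
    ‖Real.exp (-(x ⬝ᵥ s))‖ ≤ 1 := by
  rw [Real.norm_eq_abs, abs_of_pos (Real.exp_pos _)]
  exact exp_neg_dotProduct_le_one hx hs

/-- The Laplace transform of a finite measure on `[0, ∞)^ι` is continuous along sequences. -/
theorem tendsto_integral_exp_neg_dotProduct {α : Type*} {l : Filter α} [l.IsCountablyGenerated]
    {μ : Measure (ι → ℝ)} [IsFiniteMeasure μ] (hμ : ∀ᵐ x ∂μ, ∀ i, 0 ≤ x i)
    {u : α → ι → ℝ} (hu : ∀ᶠ n in l, ∀ i, 0 ≤ u n i) {s : ι → ℝ}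
    (hus : Filter.Tendsto u l (nhds s)) :
    Filter.Tendsto (fun n => ∫ x, Real.exp (-(x ⬝ᵥ u n)) ∂μ) l
      (nhds (∫ x, Real.exp (-(x ⬝ᵥ s)) ∂μ)) := by
  refine tendsto_integral_filter_of_dominated_convergence (fun _ => (1 : ℝ)) ?_ ?_
    (integrable_const _) ?_
  · refine Filter.Eventually.of_forall fun n => Continuous.aestronglyMeasurable ?_
    simp only [dotProduct]
    fun_prop
  · filter_upwards [hu] with n hn
    filter_upwards [hμ] with x hx
    exact norm_exp_neg_dotProduct_le_one hx hn
  · refine Filter.Eventually.of_forall fun x => ?_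
    have hc : Continuous fun s : ι → ℝ => Real.exp (-(x ⬝ᵥ s)) := by
      simp only [dotProduct]
      fun_prop
    exact (hc.tendsto s).comp hus

/-- A finite measure on `[0, ∞)^ι` is determined by its Laplace transform on `(0, ∞)^ι`. -/
theorem ext_of_integral_exp_neg_dotProduct {μ ν : Measure (ι → ℝ)} [IsFiniteMeasure μ]
    [IsFiniteMeasure ν] (hμ : ∀ᵐ x ∂μ, ∀ i, 0 ≤ x i) (hν : ∀ᵐ x ∂ν, ∀ i, 0 ≤ x i)
    (h : ∀ s ∈ orthant ι, ∫ x, Real.exp (-(x ⬝ᵥ s)) ∂μ = ∫ x, Real.exp (-(x ⬝ᵥ s)) ∂ν) :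
    μ = ν := by
  -- Equality extends to the boundary of the orthant by continuity, approaching `s` from its
  -- interior. The algebra of exponentials needs these values, since it contains the constant
  -- function and the exponentials of single coordinates.
  have h0 : ∀ s : ι → ℝ, (∀ i, 0 ≤ s i) →
      ∫ x, Real.exp (-(x ⬝ᵥ s)) ∂μ = ∫ x, Real.exp (-(x ⬝ᵥ s)) ∂ν := by
    intro s hs
    let u : ℕ → ι → ℝ := fun n i => s i + 1 / ((n : ℝ) + 1)
    have hpos : ∀ n i, 0 < u n i := fun n i =>
      add_pos_of_nonneg_of_pos (hs i) (by positivity)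
    have hu : Filter.Tendsto u Filter.atTop (nhds s) := by
      rw [tendsto_pi_nhds]
      intro i
      have := (tendsto_const_nhds (x := s i)).add (tendsto_one_div_add_atTop_nhds_zero_nat (𝕜 := ℝ))
      rwa [add_zero] at this
    have h1 := tendsto_integral_exp_neg_dotProduct hμ
      (Filter.Eventually.of_forall fun n i => (hpos n i).le) hu
    have h2 := tendsto_integral_exp_neg_dotProduct hν
      (Filter.Eventually.of_forall fun n i => (hpos n i).le) hu
    have h3 : (fun n => ∫ x, Real.exp (-(x ⬝ᵥ u n)) ∂μ) =
        fun n => ∫ x, Real.exp (-(x ⬝ᵥ u n)) ∂ν := by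
      funext n; exact h _ (hpos n)
    rw [h3] at h1
    exact tendsto_nhds_unique h1 h2
  -- Truncation to `ℝ≥0` followed by the inclusion is the identity almost everywhere, so both
  -- measures are recovered from their images on `ℝ≥0`.
  let F : (ι → ℝ) → ι → ℝ≥0 := fun x i => (x i).toNNReal
  let G : (ι → ℝ≥0) → ι → ℝ := fun x i => x i
  have hF : Measurable F := measurable_pi_lambda _ fun i => (measurable_pi_apply i).real_toNNReal
  have hG : Measurable G := measurable_pi_lambda _ fun i => (measurable_pi_apply i).coe_nnreal_real
  have hback : ∀ ρ : Measure (ι → ℝ), (∀ᵐ x ∂ρ, ∀ i, 0 ≤ x i) → (ρ.map F).map G = ρ := by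
    intro ρ hρ
    rw [Measure.map_map hG hF]
    conv_rhs => rw [← Measure.map_id (μ := ρ)]
    refine Measure.map_congr ?_
    filter_upwards [hρ] with x hx
    funext i
    exact Real.coe_toNNReal _ (hx i)
  rw [← hback μ hμ, ← hback ν hν]
  congr 1
  refine ext_of_laplaceKernel fun s => ?_
  have htr : ∀ ρ : Measure (ι → ℝ), (∀ᵐ x ∂ρ, ∀ i, 0 ≤ x i) →
      ∫ x, laplaceKernel s x ∂(ρ.map F) = ∫ x, Real.exp (-(x ⬝ᵥ fun i => (s i : ℝ))) ∂ρ := by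
    intro ρ hρ
    rw [integral_map hF.aemeasurable (laplaceKernel s).continuous.aestronglyMeasurable]
    refine integral_congr_ae ?_
    filter_upwards [hρ] with x hx
    simp only [laplaceKernel_apply, dotProduct, F, Real.coe_toNNReal _ (hx _)]
  rw [htr μ hμ, htr ν hν]
  exact h0 _ fun i => (s i).2

end LaplaceUniqueness

/-! ### Poisson storms and their Laplace functional -/

section Storms

open Filter Topology

theorem measurableSet_orthant {ι : Type*} [Fintype ι] : MeasurableSet (orthant ι) := by
  have : orthant ι = ⋂ i, {x | 0 < x i} := by ext x; simp [orthant]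
  rw [this]
  exact MeasurableSet.iInter fun i => measurableSet_lt measurable_const (measurable_pi_apply i)

theorem ae_mem_orthant_densityLaw {ι : Type*} [Fintype ι] (f : (ι → ℝ) → ℝ) :
    ∀ᵐ d ∂(densityLaw f), d ∈ orthant ι :=
  (withDensity_absolutelyContinuous _ _).ae_le (ae_restrict_mem measurableSet_orthant)

theorem expMeasure_eq_withDensity (lam : ℝ) :
    expMeasure lam = (volume.restrict (Set.Ioi 0)).withDensity
      fun w => ENNReal.ofReal (lam * Real.exp (-(lam * w))) := by
  have h1 : expMeasure lam = volume.withDensity (exponentialPDF lam) := rfl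
  rw [h1, ← withDensity_indicator measurableSet_Ioi]
  refine withDensity_congr_ae ?_
  have h0 : ∀ᵐ w : ℝ, w ≠ 0 := by simp [ae_iff]
  filter_upwards [h0] with w hw
  rcases lt_or_gt_of_ne hw with h | h
  · rw [exponentialPDF_of_neg h, Set.indicator_of_notMem (by simpa using h.le)]
  · rw [exponentialPDF_of_nonneg h.le, Set.indicator_of_mem (by simpa using h)]

theorem ae_pos_expMeasure (lam : ℝ) : ∀ᵐ w ∂(expMeasure lam), 0 < w := by
  rw [expMeasure_eq_withDensity]
  exact (withDensity_absolutelyContinuous _ _).ae_le (ae_restrict_mem measurableSet_Ioi)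

theorem integral_expMeasure {lam : ℝ} (hlam : 0 < lam) (F : ℝ → ℝ) :
    ∫ w, F w ∂(expMeasure lam) = ∫ w in Set.Ioi 0, lam * Real.exp (-(lam * w)) * F w := by
  rw [expMeasure_eq_withDensity, integral_withDensity_eq_integral_toReal_smul (by fun_prop)
    (by simp)]
  refine integral_congr_ae (Eventually.of_forall fun w => ?_)
  simp only [smul_eq_mul]
  rw [ENNReal.toReal_ofReal (by positivity)]

theorem integrableOn_mul_exp_neg {lam : ℝ} (hlam : 0 < lam) (c : ℝ) :
    IntegrableOn (fun w => lam * Real.exp (-(lam * w))) (Set.Ioi c) := by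
  have := (integrableOn_exp_mul_Ioi (a := -lam) (neg_lt_zero.2 hlam) c).const_mul lam
  simpa [IntegrableOn] using this

theorem integral_mul_exp_neg_Ioi {lam : ℝ} (hlam : 0 < lam) (c : ℝ) :
    ∫ w in Set.Ioi c, lam * Real.exp (-(lam * w)) = Real.exp (-(lam * c)) := by
  have := integral_exp_mul_Ioi (a := -lam) (neg_lt_zero.2 hlam) c
  simp only [neg_mul] at this
  rw [integral_const_mul, this]
  field_simp

/-- The solution `exp (-λ ∫_v^t θ)` of the renewal equation with killing rate `λ θ` on `[0, t]`,
extended by constants outside `[0, t]`. -/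
noncomputable def survival (lam : ℝ) (θ : ℝ → ℝ) (t v : ℝ) : ℝ :=
  Real.exp (-lam * ∫ x in (min (max v 0) t)..t, θ x)

theorem continuous_survival (lam : ℝ) {θ : ℝ → ℝ} (hθ : Continuous θ) (t : ℝ) :
    Continuous (survival lam θ t) := by
  have h1 : Continuous fun v : ℝ => ∫ x in v..t, θ x := by
    simp_rw [fun v => intervalIntegral.integral_symm (f := θ) (μ := volume) t v]
    exact (intervalIntegral.continuous_primitive (fun a b => hθ.intervalIntegrable a b) t).neg
  exact Real.continuous_exp.comp (continuous_const.mul (h1.comp (by fun_prop)))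

theorem survival_of_ge (lam : ℝ) (θ : ℝ → ℝ) {t v : ℝ} (h : t ≤ v) : survival lam θ t v = 1 := by
  rw [survival, min_eq_right (h.trans (le_max_left v 0))]
  simp

theorem survival_of_mem (lam : ℝ) (θ : ℝ → ℝ) {t v : ℝ} (h0 : 0 ≤ v) (ht : v ≤ t) :
    survival lam θ t v = Real.exp (-lam * ∫ x in v..t, θ x) := by
  rw [survival, max_eq_left h0, min_eq_left ht]

theorem survival_mem_Icc {lam : ℝ} (hlam : 0 < lam) {θ : ℝ → ℝ} {t : ℝ} (ht : 0 ≤ t)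
    (hθ : ∀ v ∈ Set.Icc 0 t, 0 ≤ θ v) (v : ℝ) : survival lam θ t v ∈ Set.Icc (0 : ℝ) 1 := by
  refine ⟨(Real.exp_pos _).le, ?_⟩
  rw [survival, Real.exp_le_one_iff]
  have : 0 ≤ ∫ x in (min (max v 0) t)..t, θ x :=
    intervalIntegral.integral_nonneg (min_le_right _ _) fun u hu =>
      hθ u ⟨(le_min (le_max_right v 0) ht).trans hu.1, hu.2⟩
  nlinarith

/-- `survival` solves the renewal equation. -/
theorem integral_expMeasure_survival {lam : ℝ} (hlam : 0 < lam) {θ ψ : ℝ → ℝ} {t : ℝ}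
    (hθ : Continuous θ) (hψ : ∀ v ∈ Set.Icc 0 t, ψ v = 1 - θ v) (hψ1 : ∀ v, t < v → ψ v = 1)
    {v : ℝ} (hv : 0 ≤ v) :
    ∫ w, ψ (v + w) * survival lam θ t (v + w) ∂(expMeasure lam) = survival lam θ t v := by
  rw [integral_expMeasure hlam]
  rcases lt_or_ge t v with htv | hvt
  · rw [survival_of_ge lam θ htv.le]
    have : ∀ w ∈ Set.Ioi (0 : ℝ), lam * Real.exp (-(lam * w)) *
        (ψ (v + w) * survival lam θ t (v + w)) = lam * Real.exp (-(lam * w)) := by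
      intro w hw
      have hw : 0 < w := hw
      rw [hψ1 _ (by linarith), survival_of_ge lam θ (by linarith)]
      ring
    rw [setIntegral_congr_fun measurableSet_Ioi this, integral_mul_exp_neg_Ioi hlam]
    simp
  · have hsplit : Set.Ioi (0 : ℝ) = Set.Ioc 0 (t - v) ∪ Set.Ioi (t - v) :=
      (Set.Ioc_union_Ioi_eq_Ioi (by linarith)).symm
    -- `G` is an explicit antiderivative of the integrand for arrivals before `t`. Its increment
    -- over `[0, t - v]` is the claimed value minus `exp (-(lam * (t - v)))`, which is exactly the
    -- contribution of a first arrival after `t`.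
    let G : ℝ → ℝ := fun w => -(Real.exp (-(lam * w)) * Real.exp (-lam * ∫ x in (v + w)..t, θ x))
    let G' : ℝ → ℝ := fun w =>
      lam * Real.exp (-(lam * w)) * ((1 - θ (v + w)) * Real.exp (-lam * ∫ x in (v + w)..t, θ x))
    have hGc : Continuous fun w : ℝ => ∫ x in (v + w)..t, θ x := by
      simp_rw [fun v => intervalIntegral.integral_symm (f := θ) (μ := volume) t v]
      exact ((intervalIntegral.continuous_primitive (fun a b => hθ.intervalIntegrable a b) t).comp
        (by fun_prop : Continuous fun w : ℝ => v + w)).neg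
    have hG'c : Continuous G' := by fun_prop
    have hGd : ∀ w, HasDerivAt G (G' w) w := by
      intro w
      have h1 : HasDerivAt (fun u => ∫ x in u..t, θ x) (-θ (v + w)) (v + w) :=
        intervalIntegral.integral_hasDerivAt_left (hθ.intervalIntegrable _ _)
          hθ.stronglyMeasurable.stronglyMeasurableAtFilter hθ.continuousAt
      have h2 : HasDerivAt (fun w => ∫ x in (v + w)..t, θ x) (-θ (v + w)) w := by
        simpa using HasDerivAt.comp_const_add v w h1
      have h3 := (h2.const_mul (-lam)).exp
      have h4 : HasDerivAt (fun w => Real.exp (-(lam * w)))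
          (Real.exp (-(lam * w)) * -(lam * 1)) w :=
        ((hasDerivAt_id w).const_mul lam).neg.exp
      have h5 := (h4.mul h3).neg
      convert! h5 using 1
      simp only [G']
      ring
    have e1 : ∀ w ∈ Set.Ioc 0 (t - v), lam * Real.exp (-(lam * w)) *
        (ψ (v + w) * survival lam θ t (v + w)) = G' w := by
      intro w hw
      rw [hψ _ ⟨by linarith [hw.1], by linarith [hw.2]⟩,
        survival_of_mem lam θ (by linarith [hw.1]) (by linarith [hw.2])]
    have e2 : ∀ w ∈ Set.Ioi (t - v), lam * Real.exp (-(lam * w)) *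
        (ψ (v + w) * survival lam θ t (v + w)) = lam * Real.exp (-(lam * w)) := by
      intro w hw
      have hw : t - v < w := hw
      rw [hψ1 _ (by linarith), survival_of_ge lam θ (by linarith)]
      ring
    have i1 : IntegrableOn (fun w => lam * Real.exp (-(lam * w)) *
        (ψ (v + w) * survival lam θ t (v + w))) (Set.Ioc 0 (t - v)) :=
      (integrableOn_congr_fun e1 measurableSet_Ioc).2
        ((intervalIntegrable_iff_integrableOn_Ioc_of_le (by linarith)).1
          (hG'c.intervalIntegrable _ _))
    have i2 : IntegrableOn (fun w => lam * Real.exp (-(lam * w)) *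
        (ψ (v + w) * survival lam θ t (v + w))) (Set.Ioi (t - v)) :=
      (integrableOn_congr_fun e2 measurableSet_Ioi).2 (integrableOn_mul_exp_neg hlam _)
    rw [hsplit, setIntegral_union (Set.Ioc_disjoint_Ioi le_rfl) measurableSet_Ioi i1 i2,
      setIntegral_congr_fun measurableSet_Ioc e1, setIntegral_congr_fun measurableSet_Ioi e2,
      integral_mul_exp_neg_Ioi hlam, ← intervalIntegral.integral_of_le (by linarith),
      intervalIntegral.integral_eq_sub_of_hasDerivAt (fun w _ => hGd w)
        (hG'c.intervalIntegrable _ _), survival_of_mem lam θ hv hvt]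
    simp [G]

variable {E : Type*} [Fintype E] {Ω : Type*} [MeasurableSpace Ω] {P : Measure Ω}
  {lam : ℝ} {f : (E → ℝ) → ℝ} {T : ℕ → Ω → ℝ} {D : ℕ → Ω → (E → ℝ)}

namespace IsStormSequence

theorem measurable_pair (hTD : IsStormSequence P lam f T D) (n : ℕ) :
    Measurable fun ω => (T (n + 1) ω - T n ω, D (n + 1) ω) :=
  ((hTD.measurable_time _).sub (hTD.measurable_time _)).prodMk (hTD.measurable_depth _)

theorem time_eq_sum (hTD : IsStormSequence P lam f T D) (n : ℕ) (ω : Ω) :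
    T n ω = ∑ i ∈ Finset.range n, (T (i + 1) ω - T i ω) := by
  rw [Finset.sum_range_sub (fun i => T i ω), hTD.time_zero, sub_zero]

theorem ae_depth_mem_orthant (hTD : IsStormSequence P lam f T D) :
    ∀ᵐ ω ∂P, ∀ n, D (n + 1) ω ∈ orthant E := by
  rw [ae_all_iff]
  intro n
  have h := ae_mem_orthant_densityLaw f
  rw [← hTD.depth_law n] at h
  exact ae_of_ae_map (hTD.measurable_depth _).aemeasurable h

theorem ae_strictMono_time (hTD : IsStormSequence P lam f T D) :
    ∀ᵐ ω ∂P, StrictMono fun n => T n ω := by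
  have : ∀ᵐ ω ∂P, ∀ n, 0 < T (n + 1) ω - T n ω := by
    rw [ae_all_iff]
    intro n
    have h := ae_pos_expMeasure lam
    rw [← hTD.waiting_law n] at h
    exact ae_of_ae_map ((hTD.measurable_time _).sub (hTD.measurable_time _)).aemeasurable h
  filter_upwards [this] with ω hω
  exact strictMono_nat_of_lt_succ fun n => by linarith [hω n]

/-- A functional of the first `N` storms is independent of the next one. -/
theorem indepFun_history (hTD : IsStormSequence P lam f T D) (N : ℕ) {β : Type*}
    [MeasurableSpace β] {v : (ℕ → ℝ × (E → ℝ)) → β} (hv : Measurable v)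
    (hdep : ∀ x y, (∀ i < N, x i = y i) → v x = v y) :
    IndepFun (fun ω => v fun n => (T (n + 1) ω - T n ω, D (n + 1) ω))
      (fun ω => (T (N + 1) ω - T N ω, D (N + 1) ω)) P := by
  have h := hTD.indep.indepFun_finset (Finset.range N) {N} (by simp) hTD.measurable_pair
  -- A finite history is padded with zeros to a full sequence; `v` does not see the padding by
  -- `hdep`.
  let ext : ((i : Finset.range N) → ℝ × (E → ℝ)) → ℕ → ℝ × (E → ℝ) := fun η i =>
    if hi : i ∈ Finset.range N then η ⟨i, hi⟩ else 0
  have hext : Measurable ext := by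
    refine measurable_pi_lambda _ fun i => ?_
    by_cases hi : i ∈ Finset.range N
    · simp only [ext, hi, dif_pos]; exact measurable_pi_apply _
    · simp only [ext, hi, dif_neg, not_false_iff]; exact measurable_const
  have h2 := h.comp (hv.comp hext)
    (measurable_pi_apply (⟨N, Finset.mem_singleton_self N⟩ : ({N} : Finset ℕ)))
  refine h2.congr (Eventually.of_forall fun ω => ?_) (Eventually.of_forall fun ω => rfl)
  refine hdep _ _ fun i hi => ?_
  simp [ext, hi]

variable [IsProbabilityMeasure P]

theorem isProbabilityMeasure_densityLaw (hTD : IsStormSequence P lam f T D) :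
    IsProbabilityMeasure (densityLaw f) := by
  rw [← hTD.depth_law 0]
  exact Measure.isProbabilityMeasure_map (hTD.measurable_depth 1).aemeasurable

theorem isProbabilityMeasure_expMeasure (hTD : IsStormSequence P lam f T D) :
    IsProbabilityMeasure (expMeasure lam) := by
  rw [← hTD.waiting_law 0]
  exact Measure.isProbabilityMeasure_map
    ((hTD.measurable_time 1).sub (hTD.measurable_time 0)).aemeasurable

theorem pair_law (hTD : IsStormSequence P lam f T D) (n : ℕ) :
    P.map (fun ω => (T (n + 1) ω - T n ω, D (n + 1) ω)) =
      (expMeasure lam).prod (densityLaw f) := by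
  have h := (indepFun_iff_map_prod_eq_prod_map_map
    ((hTD.measurable_time (n + 1)).sub (hTD.measurable_time n)).aemeasurable
    (hTD.measurable_depth (n + 1)).aemeasurable).1 (hTD.indep_pair n)
  rw [← hTD.waiting_law n, ← hTD.depth_law n]
  exact h

/-- The strong law applied to the waiting times truncated to `[0, 1]`: truncation makes them
integrable at once, their mean is positive because waiting times are almost surely positive, and
their partial sums bound `T n` from below. -/
theorem ae_tendsto_time (hTD : IsStormSequence P lam f T D) :
    ∀ᵐ ω ∂P, Tendsto (fun n => T n ω) atTop atTop := by
  let u : ℝ × (E → ℝ) → ℝ := fun p => min (max p.1 0) 1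
  have hu : Measurable u := by fun_prop
  let X : ℕ → Ω → ℝ := fun n ω => u (T (n + 1) ω - T n ω, D (n + 1) ω)
  have hX : ∀ n, Measurable (X n) := fun n => hu.comp (hTD.measurable_pair n)
  have hkill_int : Integrable (X 0) P := by
    refine Integrable.of_bound (hX 0).aestronglyMeasurable 1 (Eventually.of_forall fun ω => ?_)
    rw [Real.norm_eq_abs, abs_le]
    exact ⟨by linarith [show 0 ≤ X 0 ω from le_min (le_max_right _ _) zero_le_one],
      min_le_right _ _⟩
  have hlaw : ∀ i, IdentDistrib (X i) (X 0) P P := fun i =>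
    IdentDistrib.comp (u := u) ⟨(hTD.measurable_pair i).aemeasurable,
      (hTD.measurable_pair 0).aemeasurable, by rw [hTD.pair_law, hTD.pair_law]⟩ hu
  have hind : Pairwise (Function.onFun (fun x1 x2 => x1 ⟂ᵢ[P] x2) X) := fun i j hij =>
    (hTD.indep.indepFun hij).comp hu hu
  have hpos : 0 < ∫ ω, X 0 ω ∂P := by
    have hX0 : 0 ≤ᵐ[P] X 0 :=
      Eventually.of_forall fun ω => le_min (le_max_right _ _) zero_le_one
    rw [integral_pos_iff_support_of_nonneg_ae hX0 hkill_int]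
    have : ∀ᵐ ω ∂P, ω ∈ Function.support (X 0) := by
      filter_upwards [hTD.ae_strictMono_time] with ω hω
      have h1 : 0 < T 1 ω - T 0 ω := sub_pos.2 (hω zero_lt_one)
      have : 0 < X 0 ω := lt_min (lt_max_of_lt_left h1) zero_lt_one
      exact this.ne'
    have h1 : P (Function.support (X 0)) = P Set.univ := measure_congr (eventuallyEq_univ.2 this)
    rw [h1]
    simp
  filter_upwards [strong_law_ae_real X hkill_int hind hlaw, hTD.ae_strictMono_time] with ω h1 h2
  have h3 : Tendsto (fun n : ℕ => (∑ i ∈ Finset.range n, X i ω) / n * n) atTop atTop :=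
    h1.pos_mul_atTop hpos tendsto_natCast_atTop_atTop
  refine tendsto_atTop_mono' _ ?_ h3
  filter_upwards [eventually_gt_atTop 0] with n hn
  rw [div_mul_cancel₀ _ (by positivity), hTD.time_eq_sum]
  refine Finset.sum_le_sum fun i _ => ?_
  have : 0 < T (i + 1) ω - T i ω := sub_pos.2 (h2 (Nat.lt_succ_self i))
  exact (min_le_left _ _).trans (max_le le_rfl this.le)

/-- The product over the first `N` storms times `Ψ (T N)` is a martingale. Given these storms, the
next waiting time and depth are fresh, and averaging `g * Ψ` at the next storm returns `Ψ (T N)` by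
the renewal equation. -/
theorem integral_prod_mul_eq (hTD : IsStormSequence P lam f T D) {g : ℝ → (E → ℝ) → ℝ}
    (hg : Measurable (Function.uncurry g)) (hg01 : ∀ v d, g v d ∈ Set.Icc (0 : ℝ) 1)
    {Ψ : ℝ → ℝ} (hΨ : Measurable Ψ) (hΨ01 : ∀ v, Ψ v ∈ Set.Icc (0 : ℝ) 1)
    (hrenew : ∀ v, 0 ≤ v →
      ∫ w, (∫ d, g (v + w) d ∂(densityLaw f)) * Ψ (v + w) ∂(expMeasure lam) = Ψ v) (N : ℕ) :
    ∫ ω, (∏ n ∈ Finset.range N, g (T (n + 1) ω) (D (n + 1) ω)) * Ψ (T N ω) ∂P = Ψ 0 := by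
  have := hTD.isProbabilityMeasure_densityLaw
  have := hTD.isProbabilityMeasure_expMeasure
  induction N with
  | zero => simp [hTD.time_zero]
  | succ N ih =>
    rw [← ih]
    let V : Ω → ℝ × ℝ := fun ω => (∏ n ∈ Finset.range N, g (T (n + 1) ω) (D (n + 1) ω), T N ω)
    have hV : Measurable V := by
      refine Measurable.prodMk ?_ (hTD.measurable_time N)
      refine Finset.measurable_fun_prod _ fun n _ => ?_
      exact hg.comp ((hTD.measurable_time _).prodMk (hTD.measurable_depth _))
    have hV01 : ∀ ω, ∏ n ∈ Finset.range N, g (T (n + 1) ω) (D (n + 1) ω) ∈ Set.Icc (0 : ℝ) 1 :=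
      fun ω => ⟨Finset.prod_nonneg fun n _ => (hg01 _ _).1,
        Finset.prod_le_one (fun n _ => (hg01 _ _).1) fun n _ => (hg01 _ _).2⟩
    have hind : IndepFun V (fun ω => (T (N + 1) ω - T N ω, D (N + 1) ω)) P := by
      let v : (ℕ → ℝ × (E → ℝ)) → ℝ × ℝ := fun x =>
        (∏ n ∈ Finset.range N, g (∑ i ∈ Finset.range (n + 1), (x i).1) (x n).2,
          ∑ i ∈ Finset.range N, (x i).1)
      have hv : Measurable v := by
        refine Measurable.prodMk (Finset.measurable_fun_prod _ fun n _ => ?_) (by fun_prop)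
        have h1 : Measurable fun x : ℕ → ℝ × (E → ℝ) => ∑ i ∈ Finset.range (n + 1), (x i).1 :=
          Finset.measurable_fun_sum _ fun i _ => by fun_prop
        have h2 : Measurable fun x : ℕ → ℝ × (E → ℝ) => (x n).2 := by fun_prop
        exact hg.comp (h1.prodMk h2)
      have h := hTD.indepFun_history N hv (fun x y hxy => by
        have hsum : ∀ n ≤ N, ∑ i ∈ Finset.range n, (x i).1 = ∑ i ∈ Finset.range n, (y i).1 :=
          fun n hn => Finset.sum_congr rfl fun i hi => by
            rw [hxy i ((Finset.mem_range.1 hi).trans_le hn)]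
        have hprod : ∏ n ∈ Finset.range N, g (∑ i ∈ Finset.range (n + 1), (x i).1) (x n).2 =
            ∏ n ∈ Finset.range N, g (∑ i ∈ Finset.range (n + 1), (y i).1) (y n).2 :=
          Finset.prod_congr rfl fun n hn => by
            rw [hxy n (Finset.mem_range.1 hn), hsum (n + 1) (Finset.mem_range.1 hn)]
        exact Prod.ext hprod (hsum N le_rfl))
      convert h using 1
      funext ω
      simp only [v, V, ← hTD.time_eq_sum]
    have hjoint := (indepFun_iff_map_prod_eq_prod_map_map hV.aemeasurable
      (hTD.measurable_pair N).aemeasurable).1 hind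
    rw [hTD.pair_law] at hjoint
    -- The first coordinate is clipped to `[0, 1]` only to make `F` bounded everywhere; the
    -- products, which lie there already, are unchanged.
    let F : (ℝ × ℝ) × (ℝ × (E → ℝ)) → ℝ := fun p =>
      min (max p.1.1 0) 1 * (g (p.1.2 + p.2.1) p.2.2 * Ψ (p.1.2 + p.2.1))
    have hF : Measurable F := by
      have h1 : Measurable fun p : (ℝ × ℝ) × (ℝ × (E → ℝ)) => g (p.1.2 + p.2.1) p.2.2 :=
        hg.comp (Measurable.prodMk (by fun_prop) (by fun_prop))
      have h2 : Measurable fun p : (ℝ × ℝ) × (ℝ × (E → ℝ)) => Ψ (p.1.2 + p.2.1) :=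
        hΨ.comp (by fun_prop)
      exact (by fun_prop : Measurable fun p : (ℝ × ℝ) × (ℝ × (E → ℝ)) =>
        min (max p.1.1 0) 1).mul (h1.mul h2)
    have hbound : ∀ a b c : ℝ, a ∈ Set.Icc (0 : ℝ) 1 → b ∈ Set.Icc (0 : ℝ) 1 →
        c ∈ Set.Icc (0 : ℝ) 1 → ‖a * (b * c)‖ ≤ 1 := by
      intro a b c ha hb hc
      rw [Real.norm_eq_abs, abs_of_nonneg (mul_nonneg ha.1 (mul_nonneg hb.1 hc.1))]
      exact mul_le_one₀ ha.2 (mul_nonneg hb.1 hc.1) (mul_le_one₀ hb.2 hc.1 hc.2)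
    have hFb : ∀ p, ‖F p‖ ≤ 1 := fun p =>
      hbound _ _ _ ⟨le_min (le_max_right _ _) zero_le_one, min_le_right _ _⟩ (hg01 _ _) (hΨ01 _)
    have hmm : ∀ ω, min (max (V ω).1 0) 1 = (V ω).1 := fun ω => by
      rw [max_eq_left (hV01 ω).1, min_eq_left (hV01 ω).2]
    have h1 : ∫ ω, (∏ n ∈ Finset.range (N + 1), g (T (n + 1) ω) (D (n + 1) ω)) *
        Ψ (T (N + 1) ω) ∂P =
        ∫ p, F p ∂(P.map fun ω => (V ω, (T (N + 1) ω - T N ω, D (N + 1) ω))) := by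
      rw [integral_map (hV.prodMk (hTD.measurable_pair N)).aemeasurable
        hF.aestronglyMeasurable]
      refine integral_congr_ae (Eventually.of_forall fun ω => ?_)
      simp only [F, hmm]
      simp only [V, add_sub_cancel, Finset.prod_range_succ]
      ring
    have : IsProbabilityMeasure (P.map V) := Measure.isProbabilityMeasure_map hV.aemeasurable
    rw [h1, hjoint, integral_prod _ (Integrable.of_bound hF.aestronglyMeasurable 1
      (Eventually.of_forall hFb)), integral_map hV.aemeasurable
      (hF.stronglyMeasurable.integral_prod_right.aestronglyMeasurable)]
    refine integral_congr_ae ?_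
    filter_upwards [hTD.ae_strictMono_time] with ω hω
    have hT : 0 ≤ T N ω := by
      rw [← hTD.time_zero ω]
      exact hω.monotone (Nat.zero_le N)
    rw [integral_prod (fun y => F (V ω, y)) (Integrable.of_bound
      (hF.comp measurable_prodMk_left).aestronglyMeasurable
      1 (Eventually.of_forall fun _ => hFb _))]
    simp only [F, hmm, V]
    simp_rw [integral_const_mul, integral_mul_const]
    rw [hrenew _ hT]

/-- The Laplace functional of the storms up to time `t`. -/
theorem tendsto_integral_prod (hTD : IsStormSequence P lam f T D) (hlam : 0 < lam)
    {g : ℝ → (E → ℝ) → ℝ} (hg : Measurable (Function.uncurry g))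
    (hg01 : ∀ v d, g v d ∈ Set.Icc (0 : ℝ) 1) {t : ℝ} (ht : 0 ≤ t)
    (hgt : ∀ v d, t < v → g v d = 1) {θ : ℝ → ℝ} (hθ : Continuous θ)
    (hgθ : ∀ v ∈ Set.Icc 0 t, ∫ d, g v d ∂(densityLaw f) = 1 - θ v) :
    Tendsto (fun N => ∫ ω, ∏ n ∈ Finset.range N, g (T (n + 1) ω) (D (n + 1) ω) ∂P) atTop
      (𝓝 (Real.exp (-lam * ∫ v in (0 : ℝ)..t, θ v))) := by
  have := hTD.isProbabilityMeasure_densityLaw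
  have hθ0 : ∀ v ∈ Set.Icc 0 t, 0 ≤ θ v := by
    intro v hv
    have h1 : ∫ d, g v d ∂(densityLaw f) ≤ ∫ d, (1 : ℝ) ∂(densityLaw f) :=
      integral_mono_of_nonneg (Eventually.of_forall fun d => (hg01 v d).1) (integrable_const _)
        (Eventually.of_forall fun d => (hg01 v d).2)
    rw [hgθ v hv] at h1
    simp at h1
    linarith
  have hS01 := survival_mem_Icc hlam ht hθ0
  have hSm : Measurable (survival lam θ t) := (continuous_survival lam hθ t).measurable
  have hmart := hTD.integral_prod_mul_eq hg hg01 hSm hS01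
    (fun v hv => integral_expMeasure_survival hlam (ψ := fun v => ∫ d, g v d ∂(densityLaw f)) hθ hgθ
      (fun v hv => by simp [hgt v _ hv]) hv)
  rw [survival_of_mem lam θ le_rfl ht] at hmart
  have hprod : ∀ N ω, ∏ n ∈ Finset.range N, g (T (n + 1) ω) (D (n + 1) ω) ∈ Set.Icc (0 : ℝ) 1 :=
    fun N ω => ⟨Finset.prod_nonneg fun n _ => (hg01 _ _).1,
        Finset.prod_le_one (fun n _ => (hg01 _ _).1) fun n _ => (hg01 _ _).2⟩
  have hpm : ∀ N, Measurable fun ω => ∏ n ∈ Finset.range N, g (T (n + 1) ω) (D (n + 1) ω) :=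
    fun N => Finset.measurable_fun_prod _ fun n _ =>
      hg.comp ((hTD.measurable_time _).prodMk (hTD.measurable_depth _))
  have hpi : ∀ N, Integrable
      (fun ω => ∏ n ∈ Finset.range N, g (T (n + 1) ω) (D (n + 1) ω)) P := fun N =>
    Integrable.of_bound (hpm N).aestronglyMeasurable 1 (Eventually.of_forall fun ω => by
      rw [Real.norm_eq_abs, abs_of_nonneg (hprod N ω).1]; exact (hprod N ω).2)
  have hsm : ∀ N, Measurable fun ω => survival lam θ t (T N ω) := fun N =>
    hSm.comp (hTD.measurable_time N)
  -- The constant-mean identity leaves an error carrying the factor `1 - survival`, which vanishes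
  -- as soon as `T N ≥ t`, hence eventually almost surely.
  have hsplit : ∀ N, ∫ ω, ∏ n ∈ Finset.range N, g (T (n + 1) ω) (D (n + 1) ω) ∂P =
      Real.exp (-lam * ∫ v in (0 : ℝ)..t, θ v) +
      ∫ ω, (∏ n ∈ Finset.range N, g (T (n + 1) ω) (D (n + 1) ω)) *
        (1 - survival lam θ t (T N ω)) ∂P := by
    intro N
    have hi : Integrable (fun ω => (∏ n ∈ Finset.range N, g (T (n + 1) ω) (D (n + 1) ω)) *
        survival lam θ t (T N ω)) P :=
      Integrable.of_bound ((hpm N).mul (hsm N)).aestronglyMeasurable 1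
        (Eventually.of_forall fun ω => by
          rw [Real.norm_eq_abs, abs_of_nonneg (mul_nonneg (hprod N ω).1 (hS01 _).1)]
          exact mul_le_one₀ (hprod N ω).2 (hS01 _).1 (hS01 _).2)
    simp_rw [mul_sub, mul_one]
    rw [integral_sub (hpi N) hi, hmart N]
    ring
  simp_rw [hsplit]
  have hlim : Tendsto (fun N => ∫ ω, (∏ n ∈ Finset.range N, g (T (n + 1) ω) (D (n + 1) ω)) *
      (1 - survival lam θ t (T N ω)) ∂P) atTop (𝓝 (∫ _, (0 : ℝ) ∂P)) := by
    refine tendsto_integral_of_dominated_convergence (fun _ => (1 : ℝ))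
      (fun N => ((hpm N).mul (measurable_const.sub (hsm N))).aestronglyMeasurable)
      (integrable_const _) (fun N => Eventually.of_forall fun ω => ?_) ?_
    · have h1 := hS01 (T N ω)
      rw [Real.norm_eq_abs, abs_of_nonneg (mul_nonneg (hprod N ω).1 (sub_nonneg.2 h1.2))]
      exact mul_le_one₀ (hprod N ω).2 (sub_nonneg.2 h1.2) (by linarith [h1.1])
    · filter_upwards [hTD.ae_tendsto_time] with ω hω
      refine tendsto_const_nhds.congr' ?_
      filter_upwards [hω.eventually_ge_atTop t] with N hN
      rw [survival_of_ge lam θ hN, sub_self, mul_zero]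
  simpa using tendsto_const_nhds.add hlim

end IsStormSequence

end Storms

/-! ### The kill rate of a storm, and its integrability as a logarithmic moment -/

section KillRate

open Filter Topology

variable {E : Type*}

theorem jump_nonneg {H a d : E → ℝ} (hH : ∀ e, 0 < H e) (ha : ∀ e, 0 < a e) (hd : d ∈ orthant E)
    (i : E ⊕ E) : 0 ≤ jump H a d i := by
  rcases i with e | e
  · exact le_rfl
  · exact (mul_pos (hH e) (mul_pos (ha e) (hd e))).le

theorem measurable_jump (H a : E → ℝ) : Measurable (jump H a) := by
  refine measurable_pi_lambda _ fun i => ?_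
  rcases i with e | e
  · exact measurable_const
  · exact measurable_const.mul (measurable_const.mul (measurable_pi_apply e))

variable [Fintype E]

theorem sum_jump (H a d : E → ℝ) : ∑ i, jump H a d i = ∑ e, H e * (a e * d e) := by
  simp [jump]

theorem mulVec_nonneg_of_nonneg {ι : Type*} [Fintype ι] {A : Matrix ι ι ℝ} {x : ι → ℝ}
    (hA : ∀ i j, 0 ≤ A i j) (hx : ∀ i, 0 ≤ x i) (i : ι) : 0 ≤ A.mulVec x i :=
  Finset.sum_nonneg fun j _ => mul_nonneg (hA i j) (hx j)

theorem dotProduct_nonneg_of_forall_nonneg {ι : Type*} [Fintype ι] {x s : ι → ℝ}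
    (hx : ∀ i, 0 ≤ x i) (hs : ∀ i, 0 ≤ s i) : 0 ≤ x ⬝ᵥ s :=
  Finset.sum_nonneg fun j _ => mul_nonneg (hx j) (hs j)

theorem one_sub_exp_neg_mem_Icc {q : ℝ} (hq : 0 ≤ q) : 1 - Real.exp (-q) ∈ Set.Icc (0 : ℝ) 1 :=
  ⟨by linarith [Real.exp_le_one_iff.2 (neg_nonpos.2 hq)], by linarith [Real.exp_pos (-q)]⟩

variable [DecidableEq E]

/-- The probability that a storm of age `v` is seen by an independent exponential clock of rate
`s`: `1 - 𝔼 exp (-⟨φ(v) J, s⟩)`, where `J` is the jump caused by a storm; extended evenly to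
negative ages. -/
noncomputable def killRate (Γ : RiverNetwork E) (K H a : E → ℝ) (f : (E → ℝ) → ℝ)
    (s : E ⊕ E → ℝ) (v : ℝ) : ℝ :=
  1 - ∫ d, Real.exp (-((flow Γ K H |v|).mulVec (jump H a d) ⬝ᵥ s)) ∂(densityLaw f)

variable {Γ : RiverNetwork E} {K H a : E → ℝ} {f : (E → ℝ) → ℝ}

theorem flow_jump_dotProduct_nonneg (hK : ∀ e, 0 < K e) (hH : ∀ e, 0 < H e) (ha : ∀ e, 0 < a e)
    {d : E → ℝ} (hd : d ∈ orthant E) {v : ℝ} (hv : 0 ≤ v) {s : E ⊕ E → ℝ} (hs : ∀ i, 0 ≤ s i) :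
    0 ≤ (flow Γ K H v).mulVec (jump H a d) ⬝ᵥ s :=
  dotProduct_nonneg_of_forall_nonneg
    (mulVec_nonneg_of_nonneg (flow_nonneg hK hH hv) (jump_nonneg hH ha hd)) hs

theorem continuous_flow_apply (i j : E ⊕ E) : Continuous fun v => flow Γ K H v i j :=
  (continuous_apply_apply i j).comp continuous_flow

theorem measurable_flow_jump_dotProduct (s : E ⊕ E → ℝ) :
    Measurable fun p : ℝ × (E → ℝ) => (flow Γ K H p.1).mulVec (jump H a p.2) ⬝ᵥ s := by
  simp only [Matrix.mulVec, dotProduct]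
  refine Finset.measurable_fun_sum _ fun i _ => Measurable.mul_const ?_ _
  refine Finset.measurable_fun_sum _ fun j _ => Measurable.mul ?_ ?_
  · exact (continuous_flow_apply i j).measurable.comp measurable_fst
  · exact (measurable_pi_apply j).comp ((measurable_jump H a).comp measurable_snd)

/-- Using the age `|v|` keeps the exponent nonpositive on the whole line, so the constant 1
dominates. -/
theorem continuous_killRate [IsProbabilityMeasure (densityLaw f)] (hK : ∀ e, 0 < K e)
    (hH : ∀ e, 0 < H e) (ha : ∀ e, 0 < a e) {s : E ⊕ E → ℝ} (hs : ∀ i, 0 ≤ s i) :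
    Continuous (killRate Γ K H a f s) := by
  refine continuous_const.sub ?_
  refine continuous_of_dominated (bound := fun _ => (1 : ℝ)) (fun v => ?_) (fun v => ?_)
    (integrable_const _) (Eventually.of_forall fun d => ?_)
  · exact ((measurable_flow_jump_dotProduct s).comp
      measurable_prodMk_left).neg.exp.aestronglyMeasurable
  · filter_upwards [ae_mem_orthant_densityLaw f] with d hd
    rw [Real.norm_eq_abs, abs_of_pos (Real.exp_pos _), Real.exp_le_one_iff, neg_nonpos]
    exact flow_jump_dotProduct_nonneg hK hH ha hd (abs_nonneg v) hs
  · simp only [Matrix.mulVec, dotProduct]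
    refine Real.continuous_exp.comp (continuous_finsetSum _ fun i _ => ?_).neg
    refine (continuous_finsetSum _ fun j _ => ?_).mul continuous_const
    exact ((continuous_flow_apply i j).comp continuous_abs).mul continuous_const

theorem killRate_eq_integral [IsProbabilityMeasure (densityLaw f)] (hK : ∀ e, 0 < K e)
    (hH : ∀ e, 0 < H e) (ha : ∀ e, 0 < a e) {s : E ⊕ E → ℝ} (hs : ∀ i, 0 ≤ s i) (v : ℝ) :
    killRate Γ K H a f s v =
      ∫ d, (1 - Real.exp (-((flow Γ K H |v|).mulVec (jump H a d) ⬝ᵥ s))) ∂(densityLaw f) := by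
  rw [integral_sub (integrable_const _)]
  · simp [killRate]
  · refine Integrable.of_bound ((measurable_flow_jump_dotProduct s).comp
      measurable_prodMk_left).neg.exp.aestronglyMeasurable 1 ?_
    filter_upwards [ae_mem_orthant_densityLaw f] with d hd
    rw [Real.norm_eq_abs, abs_of_pos (Real.exp_pos _), Real.exp_le_one_iff, neg_nonpos]
    exact flow_jump_dotProduct_nonneg hK hH ha hd (abs_nonneg v) hs

theorem killRate_nonneg [IsProbabilityMeasure (densityLaw f)] (hK : ∀ e, 0 < K e)
    (hH : ∀ e, 0 < H e) (ha : ∀ e, 0 < a e) {s : E ⊕ E → ℝ} (hs : ∀ i, 0 ≤ s i) (v : ℝ) :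
    0 ≤ killRate Γ K H a f s v := by
  rw [killRate_eq_integral hK hH ha hs]
  refine integral_nonneg_of_ae ?_
  filter_upwards [ae_mem_orthant_densityLaw f] with d hd
  exact (one_sub_exp_neg_mem_Icc
    (flow_jump_dotProduct_nonneg hK hH ha hd (abs_nonneg v) hs)).1

theorem integrable_one_sub_exp [IsProbabilityMeasure (densityLaw f)] (hK : ∀ e, 0 < K e)
    (hH : ∀ e, 0 < H e) (ha : ∀ e, 0 < a e) {s : E ⊕ E → ℝ} (hs : ∀ i, 0 ≤ s i) (v : ℝ) :
    Integrable (fun d => 1 - Real.exp (-((flow Γ K H |v|).mulVec (jump H a d) ⬝ᵥ s)))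
      (densityLaw f) := by
  refine Integrable.of_bound (measurable_const.sub ((measurable_flow_jump_dotProduct s).comp
      measurable_prodMk_left).neg.exp).aestronglyMeasurable 1 ?_
  filter_upwards [ae_mem_orthant_densityLaw f] with d hd
  have h := one_sub_exp_neg_mem_Icc
    (flow_jump_dotProduct_nonneg (Γ := Γ) hK hH ha hd (abs_nonneg v) hs)
  rw [Real.norm_eq_abs, abs_of_nonneg h.1]
  exact h.2

theorem killRate_mono [IsProbabilityMeasure (densityLaw f)] (hK : ∀ e, 0 < K e)
    (hH : ∀ e, 0 < H e) (ha : ∀ e, 0 < a e) {s s' : E ⊕ E → ℝ} (hs : ∀ i, 0 ≤ s i)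
    (hss' : ∀ i, s i ≤ s' i) (v : ℝ) :
    killRate Γ K H a f s v ≤ killRate Γ K H a f s' v := by
  have hs' : ∀ i, 0 ≤ s' i := fun i => (hs i).trans (hss' i)
  rw [killRate_eq_integral hK hH ha hs, killRate_eq_integral hK hH ha hs']
  refine integral_mono_ae (integrable_one_sub_exp hK hH ha hs v)
    (integrable_one_sub_exp hK hH ha hs' v) ?_
  filter_upwards [ae_mem_orthant_densityLaw f] with d hd
  refine sub_le_sub_left (Real.exp_le_exp.2 (neg_le_neg ?_)) _
  exact Finset.sum_le_sum fun i _ => mul_le_mul_of_nonneg_left (hss' i)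
    (mulVec_nonneg_of_nonneg (flow_nonneg hK hH (abs_nonneg v)) (jump_nonneg hH ha hd) i)

/-- Moving `φ(t)` from the observer `s` to the jump adds `t` to the age of the storm, by the
semigroup law. -/
theorem killRate_flow_transpose {t v : ℝ} (ht : 0 ≤ t) (hv : 0 ≤ v) (s : E ⊕ E → ℝ) :
    killRate Γ K H a f ((flow Γ K H t).transpose.mulVec s) v = killRate Γ K H a f s (t + v) := by
  simp only [killRate]
  rw [abs_of_nonneg hv, abs_of_nonneg (add_nonneg ht hv), flow_add]
  simp only [Matrix.mulVec_transpose, ← Matrix.mulVec_mulVec]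
  simp only [dotProduct_comm _ (Matrix.vecMul s _), ← Matrix.dotProduct_mulVec,
    dotProduct_comm _ s]

theorem tendsto_killRate_zero [IsProbabilityMeasure (densityLaw f)] (hK : ∀ e, 0 < K e)
    (hH : ∀ e, 0 < H e) (ha : ∀ e, 0 < a e) {u : ℕ → E ⊕ E → ℝ} (hu : ∀ n i, 0 ≤ u n i)
    (hu0 : Tendsto u atTop (𝓝 0)) (v : ℝ) :
    Tendsto (fun n => killRate Γ K H a f (u n) v) atTop (𝓝 0) := by
  have h : Tendsto (fun n => ∫ d, Real.exp (-((flow Γ K H |v|).mulVec (jump H a d) ⬝ᵥ u n))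
      ∂(densityLaw f)) atTop (𝓝 (∫ _, (1 : ℝ) ∂(densityLaw f))) := by
    refine tendsto_integral_of_dominated_convergence (fun _ => (1 : ℝ)) (fun n => ?_)
      (integrable_const _) (fun n => ?_) (Eventually.of_forall fun d => ?_)
    · exact ((measurable_flow_jump_dotProduct (u n)).comp
        measurable_prodMk_left).neg.exp.aestronglyMeasurable
    · filter_upwards [ae_mem_orthant_densityLaw f] with d hd
      rw [Real.norm_eq_abs, abs_of_pos (Real.exp_pos _), Real.exp_le_one_iff, neg_nonpos]
      exact flow_jump_dotProduct_nonneg hK hH ha hd (abs_nonneg v) (hu n)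
    · have hc : Continuous fun s : E ⊕ E → ℝ =>
          Real.exp (-((flow Γ K H |v|).mulVec (jump H a d) ⬝ᵥ s)) := by
        simp only [dotProduct]
        fun_prop
      simpa [Function.comp_def] using (hc.tendsto 0).comp hu0
  simpa [killRate] using (tendsto_const_nhds (x := (1 : ℝ))).sub h

/-- The function `b * exp (-(c * v))` falls to 1 or below by the time `log⁺ b / c`. Before that time
the minimum is bounded by 1; afterwards the exponential tail contributes at most `1 / c`. -/
theorem lintegral_min_exp_le {b c : ℝ} (hb : 0 ≤ b) (hc : 0 < c) :
    ∫⁻ v in Set.Ioi (0 : ℝ), ENNReal.ofReal (min 1 (b * Real.exp (-(c * v)))) ≤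
      ENNReal.ofReal ((Real.posLog b + 1) / c) := by
  have hv0 : 0 ≤ Real.posLog b / c := div_nonneg Real.posLog_nonneg hc.le
  rw [← Set.Ioc_union_Ioi_eq_Ioi hv0,
    lintegral_union measurableSet_Ioi (Set.Ioc_disjoint_Ioi le_rfl), add_div,
    ENNReal.ofReal_add hv0 (by positivity)]
  refine add_le_add ?_ ?_
  · calc ∫⁻ v in Set.Ioc 0 (Real.posLog b / c), ENNReal.ofReal (min 1 (b * Real.exp (-(c * v))))
        ≤ ∫⁻ _ in Set.Ioc 0 (Real.posLog b / c), 1 := lintegral_mono fun v => by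
          rw [← ENNReal.ofReal_one]
          exact ENNReal.ofReal_le_ofReal (min_le_left _ _)
      _ = ENNReal.ofReal (Real.posLog b / c) := by simp
  · have hble : b ≤ Real.exp (Real.posLog b) := by
      rcases hb.eq_or_lt with h | h
      · rw [← h]; exact (Real.exp_pos _).le
      · calc b = Real.exp (Real.log b) := (Real.exp_log h).symm
          _ ≤ _ := Real.exp_le_exp.2 (le_max_right _ _)
    have hkill_int : IntegrableOn (fun v => b * Real.exp (-(c * v)))
        (Set.Ioi (Real.posLog b / c)) := by
      have := (integrableOn_exp_mul_Ioi (a := -c) (neg_lt_zero.2 hc) (Real.posLog b / c)).const_mul b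
      simpa [IntegrableOn] using this
    calc ∫⁻ v in Set.Ioi (Real.posLog b / c), ENNReal.ofReal (min 1 (b * Real.exp (-(c * v))))
        ≤ ∫⁻ v in Set.Ioi (Real.posLog b / c), ENNReal.ofReal (b * Real.exp (-(c * v))) :=
          lintegral_mono fun v => ENNReal.ofReal_le_ofReal (min_le_right _ _)
      _ = ENNReal.ofReal (∫ v in Set.Ioi (Real.posLog b / c), b * Real.exp (-(c * v))) :=
          (ofReal_integral_eq_lintegral_ofReal hkill_int
            (Eventually.of_forall fun v => by positivity)).symm
      _ ≤ ENNReal.ofReal (1 / c) := by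
          refine ENNReal.ofReal_le_ofReal ?_
          have := integral_exp_mul_Ioi (a := -c) (neg_lt_zero.2 hc) (Real.posLog b / c)
          simp only [neg_mul] at this
          rw [integral_const_mul, this, mul_div_cancel₀ _ hc.ne', neg_div_neg_eq, ← mul_div_assoc]
          refine div_le_div_of_nonneg_right ?_ hc.le
          calc b * Real.exp (-Real.posLog b)
              ≤ Real.exp (Real.posLog b) * Real.exp (-Real.posLog b) := by gcongr
            _ = 1 := by rw [← Real.exp_add]; simp

/-- Up to time `log⁺ y / m`, when `y ≥ 1`, the quantity `y * exp (-(m * v))` stays at least 1, so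
the integrand is at least `1 - exp (-b)` there. -/
theorem le_lintegral_one_sub_exp {b m y : ℝ} (hb : 0 < b) (hm : 0 < m) (hy : 0 ≤ y) :
    ENNReal.ofReal ((1 - Real.exp (-b)) / m) * ENNReal.ofReal (Real.posLog y) ≤
      ∫⁻ v in Set.Ioi (0 : ℝ), ENNReal.ofReal (1 - Real.exp (-(b * (y * Real.exp (-(m * v)))))) := by
  rcases lt_or_ge y 1 with h1 | h1
  · have : Real.posLog y = 0 := by
      rw [Real.posLog_eq_zero_iff, abs_of_nonneg hy]; exact h1.le
    rw [this]; simp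
  have hb0 : 0 ≤ 1 - Real.exp (-b) := (one_sub_exp_neg_mem_Icc hb.le).1
  calc ENNReal.ofReal ((1 - Real.exp (-b)) / m) * ENNReal.ofReal (Real.posLog y)
      = ∫⁻ _ in Set.Ioc 0 (Real.posLog y / m), ENNReal.ofReal (1 - Real.exp (-b)) := by
        rw [setLIntegral_const, Real.volume_Ioc, sub_zero,
          ← ENNReal.ofReal_mul (div_nonneg hb0 hm.le), ← ENNReal.ofReal_mul hb0]
        congr 1
        ring
    _ ≤ ∫⁻ v in Set.Ioc 0 (Real.posLog y / m),
          ENNReal.ofReal (1 - Real.exp (-(b * (y * Real.exp (-(m * v)))))) := by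
        refine setLIntegral_mono_ae' measurableSet_Ioc (Eventually.of_forall fun v hv => ?_)
        refine ENNReal.ofReal_le_ofReal (sub_le_sub_left (Real.exp_le_exp.2 (neg_le_neg ?_)) _)
        have hylog : y = Real.exp (Real.posLog y) := by
          rw [Real.posLog_eq_log (by rwa [abs_of_nonneg hy]), Real.exp_log (by linarith)]
        have : 1 ≤ y * Real.exp (-(m * v)) := by
          conv_rhs => rw [hylog]
          rw [← Real.exp_add]
          refine Real.one_le_exp ?_
          have := (le_div_iff₀ hm).1 hv.2
          linarith
        nlinarith
    _ ≤ _ := lintegral_mono_set Set.Ioc_subset_Ioi_self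

theorem lintegral_killRate [IsProbabilityMeasure (densityLaw f)] (hK : ∀ e, 0 < K e)
    (hH : ∀ e, 0 < H e) (ha : ∀ e, 0 < a e) {s : E ⊕ E → ℝ} (hs : ∀ i, 0 ≤ s i) :
    ∫⁻ v in Set.Ioi 0, ENNReal.ofReal (killRate Γ K H a f s v) =
      ∫⁻ d, (∫⁻ v in Set.Ioi 0,
        ENNReal.ofReal (1 - Real.exp (-((flow Γ K H v).mulVec (jump H a d) ⬝ᵥ s))))
        ∂(densityLaw f) := by
  rw [lintegral_lintegral_swap]
  · refine setLIntegral_congr_fun measurableSet_Ioi fun v hv => ?_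
    have hv : 0 < v := hv
    rw [killRate_eq_integral hK hH ha hs,
      ofReal_integral_eq_lintegral_ofReal (integrable_one_sub_exp hK hH ha hs v), abs_of_pos hv]
    filter_upwards [ae_mem_orthant_densityLaw f] with d hd
    exact (one_sub_exp_neg_mem_Icc
      (flow_jump_dotProduct_nonneg hK hH ha hd (abs_nonneg v) hs)).1
  · refine Measurable.aemeasurable ?_
    exact (measurable_const.sub ((measurable_flow_jump_dotProduct s).comp
      measurable_swap).neg.exp).ennreal_ofReal

/-- After Tonelli, the age integral for fixed depths is estimated by `1 - exp (-q) ≤ min 1 q`, with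
`q` decaying exponentially in the age. It costs a logarithm of the jump size, and `log⁺` of a
product splits into a sum, leaving the moment plus a constant. -/
theorem integrableOn_killRate_of_lintegral_posLog [IsProbabilityMeasure (densityLaw f)]
    (hK : ∀ e, 0 < K e) (hH : ∀ e, 0 < H e) (ha : ∀ e, 0 < a e) {s : E ⊕ E → ℝ}
    (hs : ∀ i, 0 ≤ s i)
    (hlog : ∫⁻ d, ENNReal.ofReal (Real.posLog (∑ e, H e * (a e * d e))) ∂(densityLaw f) < ⊤) :
    IntegrableOn (killRate Γ K H a f s) (Set.Ioi 0) := by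
  obtain ⟨C, c, hC, hc, hflow⟩ := exists_flow_le_exp Γ hK hH
  refine ⟨(continuous_killRate hK hH ha hs).aestronglyMeasurable, ?_⟩
  rw [hasFiniteIntegral_iff_ofReal (Eventually.of_forall fun v => killRate_nonneg hK hH ha hs v),
    lintegral_killRate hK hH ha hs]
  have hS : 0 ≤ ∑ i, s i := Finset.sum_nonneg fun i _ => hs i
  calc ∫⁻ d, (∫⁻ v in Set.Ioi 0,
        ENNReal.ofReal (1 - Real.exp (-((flow Γ K H v).mulVec (jump H a d) ⬝ᵥ s))))
        ∂(densityLaw f)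
      ≤ ∫⁻ d, ENNReal.ofReal ((Real.posLog (C * ∑ i, s i) +
          Real.posLog (∑ e, H e * (a e * d e)) + 1) / c) ∂(densityLaw f) := by
        refine lintegral_mono_ae ?_
        filter_upwards [ae_mem_orthant_densityLaw f] with d hd
        have hy : 0 ≤ ∑ e, H e * (a e * d e) := by
          rw [← sum_jump]; exact Finset.sum_nonneg fun i _ => jump_nonneg hH ha hd i
        calc ∫⁻ v in Set.Ioi 0,
              ENNReal.ofReal (1 - Real.exp (-((flow Γ K H v).mulVec (jump H a d) ⬝ᵥ s)))
            ≤ ∫⁻ v in Set.Ioi (0 : ℝ), ENNReal.ofReal (min 1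
                ((C * ∑ i, s i) * (∑ e, H e * (a e * d e)) * Real.exp (-(c * v)))) := by
              refine setLIntegral_mono_ae' measurableSet_Ioi (Eventually.of_forall fun v hv => ?_)
              have hv : 0 < v := hv
              refine ENNReal.ofReal_le_ofReal (le_min ?_ ?_)
              · exact (one_sub_exp_neg_mem_Icc
                  (flow_jump_dotProduct_nonneg hK hH ha hd hv.le hs)).2
              · have h1 := Real.add_one_le_exp (-((flow Γ K H v).mulVec (jump H a d) ⬝ᵥ s))
                have h2 : (flow Γ K H v).mulVec (jump H a d) ⬝ᵥ s ≤
                    (C * ∑ i, s i) * (∑ e, H e * (a e * d e)) * Real.exp (-(c * v)) := by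
                  calc (flow Γ K H v).mulVec (jump H a d) ⬝ᵥ s
                      ≤ ∑ i, (C * Real.exp (-(c * v)) * ∑ j, jump H a d j) * s i := by
                        refine Finset.sum_le_sum fun i _ =>
                          mul_le_mul_of_nonneg_right ?_ (hs i)
                        rw [Finset.mul_sum]
                        exact Finset.sum_le_sum fun j _ => mul_le_mul_of_nonneg_right
                          (hflow v hv.le i j) (jump_nonneg hH ha hd j)
                    _ = _ := by rw [← Finset.mul_sum, sum_jump]; ring
                linarith
          _ ≤ ENNReal.ofReal ((Real.posLog ((C * ∑ i, s i) * (∑ e, H e * (a e * d e))) + 1) / c) :=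
              lintegral_min_exp_le (by positivity) hc
          _ ≤ _ := by
              refine ENNReal.ofReal_le_ofReal (div_le_div_of_nonneg_right ?_ hc.le)
              linarith [Real.posLog_mul (x := C * ∑ i, s i) (y := ∑ e, H e * (a e * d e))]
    _ = ∫⁻ d, (ENNReal.ofReal ((Real.posLog (C * ∑ i, s i) + 1) / c) +
          ENNReal.ofReal (1 / c) * ENNReal.ofReal (Real.posLog (∑ e, H e * (a e * d e))))
          ∂(densityLaw f) := by
        refine lintegral_congr fun d => ?_
        rw [← ENNReal.ofReal_mul (by positivity), ← ENNReal.ofReal_add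
          (div_nonneg (by linarith [Real.posLog_nonneg (x := C * ∑ i, s i)]) hc.le)
          (mul_nonneg (by positivity) Real.posLog_nonneg)]
        congr 1
        ring
    _ = ENNReal.ofReal ((Real.posLog (C * ∑ i, s i) + 1) / c) + ENNReal.ofReal (1 / c) *
          ∫⁻ d, ENNReal.ofReal (Real.posLog (∑ e, H e * (a e * d e))) ∂(densityLaw f) := by
        rw [lintegral_add_left measurable_const, lintegral_const_mul' _ _ ENNReal.ofReal_ne_top]
        simp
    _ < ⊤ := ENNReal.add_lt_top.2 ⟨ENNReal.ofReal_lt_top,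
        ENNReal.mul_lt_top ENNReal.ofReal_lt_top hlog⟩

/-- At `s = 1` the diagonal of the flow alone retains a fraction `exp (-(m * v))` of the total jump,
so the age integral for fixed depths is at least a positive constant times `log⁺` of the jump size.
-/
theorem lintegral_posLog_lt_top_of_integrableOn_killRate [IsProbabilityMeasure (densityLaw f)]
    (hK : ∀ e, 0 < K e) (hH : ∀ e, 0 < H e) (ha : ∀ e, 0 < a e)
    (hkill_int : IntegrableOn (killRate Γ K H a f 1) (Set.Ioi 0)) :
    ∫⁻ d, ENNReal.ofReal (Real.posLog (∑ e, H e * (a e * d e))) ∂(densityLaw f) < ⊤ := by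
  obtain ⟨m, hm, hflow⟩ := exists_exp_le_flow_diag Γ hK hH
  have hs : ∀ i : E ⊕ E, 0 ≤ (1 : E ⊕ E → ℝ) i := fun i => zero_le_one
  have hfin := hkill_int.2
  rw [hasFiniteIntegral_iff_ofReal (Eventually.of_forall fun v => killRate_nonneg hK hH ha hs v),
    lintegral_killRate hK hH ha hs] at hfin
  have hc : 0 < (1 - Real.exp (-1)) / m := by
    refine div_pos (sub_pos.2 ?_) hm
    rw [Real.exp_lt_one_iff]
    norm_num
  have hle : ENNReal.ofReal ((1 - Real.exp (-1)) / m) *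
      ∫⁻ d, ENNReal.ofReal (Real.posLog (∑ e, H e * (a e * d e))) ∂(densityLaw f) ≤
      ∫⁻ d, (∫⁻ v in Set.Ioi 0,
        ENNReal.ofReal (1 - Real.exp (-((flow Γ K H v).mulVec (jump H a d) ⬝ᵥ 1))))
        ∂(densityLaw f) := by
    rw [← lintegral_const_mul' _ _ ENNReal.ofReal_ne_top]
    refine lintegral_mono_ae ?_
    filter_upwards [ae_mem_orthant_densityLaw f] with d hd
    have hy : 0 ≤ ∑ e, H e * (a e * d e) := by
      rw [← sum_jump]; exact Finset.sum_nonneg fun i _ => jump_nonneg hH ha hd i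
    refine (le_lintegral_one_sub_exp one_pos hm hy).trans ?_
    refine setLIntegral_mono_ae' measurableSet_Ioi (Eventually.of_forall fun v hv => ?_)
    have hv : 0 < v := hv
    refine ENNReal.ofReal_le_ofReal (sub_le_sub_left (Real.exp_le_exp.2 (neg_le_neg ?_)) _)
    rw [one_mul, ← sum_jump, Finset.sum_mul]
    refine Finset.sum_le_sum fun i _ => ?_
    rw [Pi.one_apply, mul_one, mul_comm]
    calc Real.exp (-(m * v)) * jump H a d i ≤ flow Γ K H v i i * jump H a d i :=
          mul_le_mul_of_nonneg_right (hflow v hv.le i) (jump_nonneg hH ha hd i)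
      _ ≤ _ := Finset.single_le_sum (f := fun j => flow Γ K H v i j * jump H a d j)
          (fun j _ => mul_nonneg (flow_nonneg hK hH hv.le i j) (jump_nonneg hH ha hd j))
          (Finset.mem_univ i)
  by_contra htop
  rw [not_lt, top_le_iff] at htop
  rw [htop, ENNReal.mul_top (ENNReal.ofReal_pos.2 hc).ne'] at hle
  exact hfin.ne (top_le_iff.1 hle)

end KillRate

/-! ### Superpositions of storms up to a fixed time -/

section StormSum

open Filter Topology

section Count

variable {Ω : Type*} {T : ℕ → Ω → ℝ}

/-- Divergence of the storm times bounds the set in `stormCount`, so its supremum is attained when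
it is nonempty; for the empty set the supremum in `ℕ` is 0, which is the correct count. -/
theorem lt_stormCount_iff {ω : Ω} (hmono : StrictMono fun n => T n ω)
    (htend : Tendsto (fun n => T n ω) atTop atTop) {t : ℝ} {n : ℕ} :
    n < stormCount T t ω ↔ T (n + 1) ω ≤ t := by
  have hbdd : BddAbove {n : ℕ | 1 ≤ n ∧ T n ω ≤ t} := by
    obtain ⟨N, hN⟩ := (htend.eventually_gt_atTop t).exists
    exact ⟨N, fun n hn => (hmono.lt_iff_lt.1 (hn.2.trans_lt hN)).le⟩
  constructor
  · intro h
    have hne : {n : ℕ | 1 ≤ n ∧ T n ω ≤ t}.Nonempty := by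
      by_contra hne
      rw [Set.not_nonempty_iff_eq_empty] at hne
      rw [stormCount, hne, csSup_empty] at h
      exact absurd h (Nat.not_lt_zero n)
    exact (hmono.monotone (Nat.succ_le_of_lt h)).trans (Nat.sSup_mem hne hbdd).2
  · intro h
    exact le_csSup hbdd ⟨Nat.succ_le_succ (Nat.zero_le n), h⟩

theorem tendsto_stormCount {ω : Ω} (hmono : StrictMono fun n => T n ω)
    (htend : Tendsto (fun n => T n ω) atTop atTop) :
    Tendsto (fun t => stormCount T t ω) atTop atTop := by
  rw [tendsto_atTop]
  intro b
  filter_upwards [eventually_ge_atTop (T (b + 1) ω)] with t ht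
  exact ((lt_stormCount_iff hmono htend).2 ht).le

end Count

theorem measurableSet_forall_nonneg {ι : Type*} [Fintype ι] :
    MeasurableSet {x : ι → ℝ | ∀ i, 0 ≤ x i} := by
  rw [Set.ofPred_forall]
  exact MeasurableSet.iInter fun i => measurableSet_le measurable_const (measurable_pi_apply i)

theorem continuous_exp_neg_dotProduct {ι : Type*} [Fintype ι] (s : ι → ℝ) :
    Continuous fun x : ι → ℝ => Real.exp (-(x ⬝ᵥ s)) := by
  simp only [dotProduct]
  fun_prop

variable {E : Type*} [Fintype E] {Ω : Type*}

/-- The superposition of the first `N` storms, with the storm at time `v` propagated by `A v`. -/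
noncomputable def stormSum (A : ℝ → Matrix (E ⊕ E) (E ⊕ E) ℝ) (H a : E → ℝ) (T : ℕ → Ω → ℝ)
    (D : ℕ → Ω → (E → ℝ)) (N : ℕ) (ω : Ω) : E ⊕ E → ℝ :=
  ∑ n ∈ Finset.range N, (A (T (n + 1) ω)).mulVec (jump H a (D (n + 1) ω))

theorem process_eq_stormSum [DecidableEq E] (Γ : RiverNetwork E) (K H a : E → ℝ)
    (T : ℕ → Ω → ℝ) (D : ℕ → Ω → (E → ℝ)) (x : E ⊕ E → ℝ) (t : ℝ) (ω : Ω) :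
    process Γ K H a T D x t ω = (flow Γ K H t).mulVec x +
      stormSum (fun v => flow Γ K H (t - v)) H a T D (stormCount T t ω) ω := by
  rw [process, stormSum, Finset.range_eq_Ico, Finset.sum_Ico_add' (fun n =>
    (flow Γ K H (t - T n ω)).mulVec (jump H a (D n ω))) 0 _ 1]
  rfl

variable [MeasurableSpace Ω] {P : Measure Ω} {lam : ℝ} {f : (E → ℝ) → ℝ} {T : ℕ → Ω → ℝ}
  {D : ℕ → Ω → (E → ℝ)} {A : ℝ → Matrix (E ⊕ E) (E ⊕ E) ℝ} {H a : E → ℝ}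

theorem measurable_mulVec_jump (hA : Continuous A) (H a : E → ℝ) :
    Measurable fun p : ℝ × (E → ℝ) => (A p.1).mulVec (jump H a p.2) := by
  refine measurable_pi_lambda _ fun i => Finset.measurable_fun_sum _ fun j _ => Measurable.mul ?_ ?_
  · exact ((continuous_apply_apply i j).comp hA).measurable.comp measurable_fst
  · exact (measurable_pi_apply j).comp ((measurable_jump H a).comp measurable_snd)

namespace IsStormSequence

theorem measurable_stormSum (hTD : IsStormSequence P lam f T D) (hA : Continuous A)
    (H a : E → ℝ) (N : ℕ) : Measurable (stormSum A H a T D N) := by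
  have : stormSum A H a T D N = fun ω => ∑ n ∈ Finset.range N,
      (A (T (n + 1) ω)).mulVec (jump H a (D (n + 1) ω)) := rfl
  rw [this]
  exact Finset.measurable_fun_sum _ fun n _ => (measurable_mulVec_jump hA H a).comp
    ((hTD.measurable_time _).prodMk (hTD.measurable_depth _))

variable [IsProbabilityMeasure P]

/-- The number of terms is random. The sum is the almost sure limit of sums of fixed length in which
the storms after `t` are switched off, and these are eventually constant in the length. -/
theorem aemeasurable_stormSum_stormCount (hTD : IsStormSequence P lam f T D) (hA : Continuous A)
    (H a : E → ℝ) (t : ℝ) :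
    AEMeasurable (fun ω => stormSum A H a T D (stormCount T t ω) ω) P := by
  refine aemeasurable_of_tendsto_metrizable_ae atTop (f := fun N ω => ∑ n ∈ Finset.range N,
    if T (n + 1) ω ≤ t then (A (T (n + 1) ω)).mulVec (jump H a (D (n + 1) ω)) else 0) ?_ ?_
  · intro N
    refine (Finset.measurable_fun_sum _ fun n _ => ?_).aemeasurable
    exact Measurable.ite (measurableSet_le (hTD.measurable_time _) measurable_const)
      ((measurable_mulVec_jump hA H a).comp
        ((hTD.measurable_time _).prodMk (hTD.measurable_depth _))) measurable_const
  · filter_upwards [hTD.ae_strictMono_time, hTD.ae_tendsto_time] with ω h1 h2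
    refine tendsto_const_nhds.congr' ?_
    filter_upwards [eventually_ge_atTop (stormCount T t ω)] with N hN
    rw [stormSum, ← Finset.sum_subset (Finset.range_subset_range.2 hN)]
    · refine Finset.sum_congr rfl fun n hn => ?_
      rw [if_pos ((lt_stormCount_iff h1 h2).1 (Finset.mem_range.1 hn))]
    · intro n _ hn
      rw [if_neg fun h => hn (Finset.mem_range.2 ((lt_stormCount_iff h1 h2).2 h))]

theorem ae_stormSum_nonneg (hTD : IsStormSequence P lam f T D) (hH : ∀ e, 0 < H e)
    (ha : ∀ e, 0 < a e) {t : ℝ} (hA0 : ∀ v ∈ Set.Icc 0 t, ∀ i j, 0 ≤ A v i j) :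
    ∀ᵐ ω ∂P, ∀ i, 0 ≤ stormSum A H a T D (stormCount T t ω) ω i := by
  filter_upwards [hTD.ae_strictMono_time, hTD.ae_tendsto_time, hTD.ae_depth_mem_orthant]
    with ω h1 h2 h3 i
  rw [stormSum, Finset.sum_apply]
  refine Finset.sum_nonneg fun n hn => mulVec_nonneg_of_nonneg
    (hA0 _ ⟨?_, (lt_stormCount_iff h1 h2).1 (Finset.mem_range.1 hn)⟩) (jump_nonneg hH ha (h3 n)) i
  rw [← hTD.time_zero ω]
  exact h1.monotone (Nat.zero_le _)

theorem integral_exp_neg_stormSum (hTD : IsStormSequence P lam f T D) (hlam : 0 < lam)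
    (hH : ∀ e, 0 < H e) (ha : ∀ e, 0 < a e) (hA : Continuous A) {t : ℝ} (ht : 0 ≤ t)
    (hA0 : ∀ v ∈ Set.Icc 0 t, ∀ i j, 0 ≤ A v i j) {s : E ⊕ E → ℝ} (hs : ∀ i, 0 ≤ s i)
    {θ : ℝ → ℝ} (hθ : Continuous θ)
    (hAθ : ∀ v ∈ Set.Icc 0 t,
      ∫ d, Real.exp (-((A v).mulVec (jump H a d) ⬝ᵥ s)) ∂(densityLaw f) = 1 - θ v) :
    ∫ ω, Real.exp (-(stormSum A H a T D (stormCount T t ω) ω ⬝ᵥ s)) ∂P =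
      Real.exp (-lam * ∫ v in (0 : ℝ)..t, θ v) := by
  classical
  -- Setting the factor to 1 outside `[0, t]` and outside the orthant keeps it in `[0, 1]`
  -- everywhere and makes storms after `t` invisible, so long products equal the exponential of the
  -- sum up to `t`.
  let g : ℝ → (E → ℝ) → ℝ := fun v d =>
    if v ∈ Set.Icc 0 t ∧ d ∈ orthant E then Real.exp (-((A v).mulVec (jump H a d) ⬝ᵥ s)) else 1
  have hg : Measurable (Function.uncurry g) := by
    refine Measurable.ite ?_ ?_ measurable_const
    · exact (measurable_fst measurableSet_Icc).inter (measurable_snd measurableSet_orthant)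
    · refine Measurable.exp (Measurable.neg ?_)
      refine Finset.measurable_fun_sum _ fun i _ => Measurable.mul_const ?_ _
      exact (measurable_pi_apply i).comp (measurable_mulVec_jump hA H a)
  have hg01 : ∀ v d, g v d ∈ Set.Icc (0 : ℝ) 1 := by
    intro v d
    simp only [g]
    split_ifs with h
    · exact ⟨(Real.exp_pos _).le, exp_neg_dotProduct_le_one
        (mulVec_nonneg_of_nonneg (hA0 v h.1) (jump_nonneg hH ha h.2)) hs⟩
    · simp
  have hgt : ∀ v d, t < v → g v d = 1 := by
    intro v d hv
    simp only [g]
    rw [if_neg fun h => absurd h.1.2 (not_le.2 hv)]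
  have hgθ : ∀ v ∈ Set.Icc 0 t, ∫ d, g v d ∂(densityLaw f) = 1 - θ v := by
    intro v hv
    rw [← hAθ v hv]
    refine integral_congr_ae ?_
    filter_upwards [ae_mem_orthant_densityLaw f] with d hd
    exact if_pos ⟨hv, hd⟩
  have hlim := hTD.tendsto_integral_prod hlam hg hg01 ht hgt hθ hgθ
  refine tendsto_nhds_unique ?_ hlim
  refine tendsto_integral_of_dominated_convergence (fun _ => (1 : ℝ)) (fun N => ?_)
    (integrable_const _) (fun N => Eventually.of_forall fun ω => ?_) ?_
  · exact (Finset.measurable_fun_prod _ fun n _ => hg.comp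
      ((hTD.measurable_time _).prodMk (hTD.measurable_depth _))).aestronglyMeasurable
  · rw [Real.norm_eq_abs, abs_of_nonneg (Finset.prod_nonneg fun n _ => (hg01 _ _).1)]
    exact Finset.prod_le_one (fun n _ => (hg01 _ _).1) fun n _ => (hg01 _ _).2
  · filter_upwards [hTD.ae_strictMono_time, hTD.ae_tendsto_time, hTD.ae_depth_mem_orthant]
      with ω h1 h2 h3
    refine tendsto_const_nhds.congr' ?_
    filter_upwards [eventually_ge_atTop (stormCount T t ω)] with N hN
    rw [← Finset.prod_subset (Finset.range_subset_range.2 hN), stormSum, sum_dotProduct,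
      ← Finset.sum_neg_distrib, Real.exp_sum]
    · refine Finset.prod_congr rfl fun n hn => ?_
      refine (if_pos ⟨⟨?_, (lt_stormCount_iff h1 h2).1 (Finset.mem_range.1 hn)⟩, h3 n⟩).symm
      rw [← hTD.time_zero ω]
      exact h1.monotone (Nat.zero_le _)
    · intro n _ hn
      refine hgt _ _ (lt_of_not_ge fun h => hn (Finset.mem_range.2 ?_))
      exact (lt_stormCount_iff h1 h2).2 h

variable [DecidableEq E] {Γ : RiverNetwork E} {K : E → ℝ}

theorem integral_exp_neg_stormSum_flow (hTD : IsStormSequence P lam f T D) (hlam : 0 < lam)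
    (hK : ∀ e, 0 < K e) (hH : ∀ e, 0 < H e) (ha : ∀ e, 0 < a e) {t : ℝ} (ht : 0 ≤ t)
    {s : E ⊕ E → ℝ} (hs : ∀ i, 0 ≤ s i) :
    ∫ ω, Real.exp (-(stormSum (flow Γ K H) H a T D (stormCount T t ω) ω ⬝ᵥ s)) ∂P =
      Real.exp (-lam * ∫ v in (0 : ℝ)..t, killRate Γ K H a f s v) := by
  have := hTD.isProbabilityMeasure_densityLaw
  refine hTD.integral_exp_neg_stormSum hlam hH ha continuous_flow ht
    (fun v hv => flow_nonneg hK hH hv.1) hs (continuous_killRate hK hH ha hs) fun v hv => ?_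
  rw [killRate, abs_of_nonneg hv.1]
  ring

/-- The substitution `v ↦ t - v` changes the integrand but not its integral over `[0, t]`. The value
thus agrees with that for storms propagated forward by their arrival times, which is the source of
time reversal in law. -/
theorem integral_exp_neg_stormSum_flow_sub (hTD : IsStormSequence P lam f T D) (hlam : 0 < lam)
    (hK : ∀ e, 0 < K e) (hH : ∀ e, 0 < H e) (ha : ∀ e, 0 < a e) {t : ℝ} (ht : 0 ≤ t)
    {s : E ⊕ E → ℝ} (hs : ∀ i, 0 ≤ s i) :
    ∫ ω, Real.exp (-(stormSum (fun v => flow Γ K H (t - v)) H a T D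
        (stormCount T t ω) ω ⬝ᵥ s)) ∂P =
      Real.exp (-lam * ∫ v in (0 : ℝ)..t, killRate Γ K H a f s v) := by
  have := hTD.isProbabilityMeasure_densityLaw
  rw [hTD.integral_exp_neg_stormSum (A := fun v => flow Γ K H (t - v)) hlam hH ha
    (continuous_flow.comp (continuous_const.sub continuous_id)) ht
    (fun v hv => flow_nonneg hK hH (sub_nonneg.2 hv.2)) hs
    (θ := fun v => killRate Γ K H a f s (t - v))
    ((continuous_killRate hK hH ha hs).comp (continuous_const.sub continuous_id)) fun v hv => ?_,
    intervalIntegral.integral_comp_sub_left (killRate Γ K H a f s) t, sub_self, sub_zero]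
  rw [killRate, abs_of_nonneg (sub_nonneg.2 hv.2)]
  ring

/-- Time reversal: the storms seen backwards from time `t` are distributed as the storms. -/
theorem map_stormSum_flow_sub_eq (hTD : IsStormSequence P lam f T D) (hlam : 0 < lam)
    (hK : ∀ e, 0 < K e) (hH : ∀ e, 0 < H e) (ha : ∀ e, 0 < a e) {t : ℝ} (ht : 0 ≤ t) :
    P.map (fun ω => stormSum (fun v => flow Γ K H (t - v)) H a T D (stormCount T t ω) ω) =
      P.map fun ω => stormSum (flow Γ K H) H a T D (stormCount T t ω) ω := by
  have h1 := hTD.aemeasurable_stormSum_stormCount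
    (A := fun v => flow Γ K H (t - v)) (continuous_flow.comp (continuous_const.sub continuous_id))
    H a t
  have h2 := hTD.aemeasurable_stormSum_stormCount (A := flow Γ K H) continuous_flow H a t
  have := Measure.isProbabilityMeasure_map h1
  have := Measure.isProbabilityMeasure_map h2
  refine ext_of_integral_exp_neg_dotProduct ?_ ?_ fun s hs => ?_
  · rw [ae_map_iff h1 measurableSet_forall_nonneg]
    exact hTD.ae_stormSum_nonneg hH ha fun v hv => flow_nonneg hK hH (sub_nonneg.2 hv.2)
  · rw [ae_map_iff h2 measurableSet_forall_nonneg]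
    exact hTD.ae_stormSum_nonneg hH ha fun v hv => flow_nonneg hK hH hv.1
  · rw [integral_map h1 (continuous_exp_neg_dotProduct s).aestronglyMeasurable,
      integral_map h2 (continuous_exp_neg_dotProduct s).aestronglyMeasurable,
      hTD.integral_exp_neg_stormSum_flow_sub hlam hK hH ha ht fun i => (hs i).le,
      hTD.integral_exp_neg_stormSum_flow hlam hK hH ha ht fun i => (hs i).le]

end IsStormSequence

end StormSum

/-! ### Consequences of invariance: Laplace transform, necessity and uniqueness -/

section InvariantLaw

open Filter Topology

variable {E : Type*} [Fintype E] [DecidableEq E] {Ω : Type*} [MeasurableSpace Ω] {P : Measure Ω}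
  {lam : ℝ} {f : (E → ℝ) → ℝ} {T : ℕ → Ω → ℝ} {D : ℕ → Ω → (E → ℝ)} {Γ : RiverNetwork E}
  {K H a : E → ℝ}

/-- The law of the contribution to the state at time `t` of the storms before time `t`. -/
noncomputable def forcingLaw (Γ : RiverNetwork E) (K H a : E → ℝ) (P : Measure Ω)
    (T : ℕ → Ω → ℝ) (D : ℕ → Ω → (E → ℝ)) (t : ℝ) : Measure (E ⊕ E → ℝ) :=
  P.map fun ω => stormSum (fun v => flow Γ K H (t - v)) H a T D (stormCount T t ω) ω

theorem mulVec_dotProduct_eq {ι : Type*} [Fintype ι] (A : Matrix ι ι ℝ) (x s : ι → ℝ) :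
    A.mulVec x ⬝ᵥ s = x ⬝ᵥ A.transpose.mulVec s := by
  rw [Matrix.mulVec_transpose, dotProduct_comm, Matrix.dotProduct_mulVec, dotProduct_comm]

theorem flow_transpose_mulVec_nonneg (hK : ∀ e, 0 < K e) (hH : ∀ e, 0 < H e) {t : ℝ} (ht : 0 ≤ t)
    {s : E ⊕ E → ℝ} (hs : ∀ i, 0 ≤ s i) (i : E ⊕ E) :
    0 ≤ (flow Γ K H t).transpose.mulVec s i :=
  mulVec_nonneg_of_nonneg (fun i j => flow_nonneg hK hH ht j i) hs i

theorem tendsto_flow_apply_zero (hK : ∀ e, 0 < K e) (hH : ∀ e, 0 < H e) (i j : E ⊕ E) :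
    Tendsto (fun t => flow Γ K H t i j) atTop (𝓝 0) := by
  obtain ⟨C, c, hC, hc, hflow⟩ := exists_flow_le_exp Γ hK hH
  have h1 : Tendsto (fun t : ℝ => C * Real.exp (-(c * t))) atTop (𝓝 0) := by
    have : Tendsto (fun t : ℝ => Real.exp (-(c * t))) atTop (𝓝 0) :=
      Real.tendsto_exp_neg_atTop_nhds_zero.comp (tendsto_id.const_mul_atTop hc)
    simpa using this.const_mul C
  refine tendsto_of_tendsto_of_tendsto_of_le_of_le' tendsto_const_nhds h1 ?_ ?_
  · filter_upwards [eventually_ge_atTop 0] with t ht using flow_nonneg hK hH ht i j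
  · filter_upwards [eventually_ge_atTop 0] with t ht using hflow t ht i j

theorem tendsto_flow_mulVec_zero (hK : ∀ e, 0 < K e) (hH : ∀ e, 0 < H e) (x : E ⊕ E → ℝ) :
    Tendsto (fun t => (flow Γ K H t).mulVec x) atTop (𝓝 0) := by
  rw [tendsto_pi_nhds]
  intro i
  have := tendsto_finsetSum Finset.univ fun j (_ : j ∈ Finset.univ) =>
    (tendsto_flow_apply_zero (Γ := Γ) hK hH i j).mul_const (x j)
  simpa [Matrix.mulVec, dotProduct] using this

theorem tendsto_flow_transpose_mulVec_zero (hK : ∀ e, 0 < K e) (hH : ∀ e, 0 < H e)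
    (s : E ⊕ E → ℝ) : Tendsto (fun t => (flow Γ K H t).transpose.mulVec s) atTop (𝓝 0) := by
  rw [tendsto_pi_nhds]
  intro i
  have := tendsto_finsetSum Finset.univ fun j (_ : j ∈ Finset.univ) =>
    (tendsto_flow_apply_zero (Γ := Γ) hK hH j i).mul_const (s j)
  simpa [Matrix.mulVec, dotProduct] using this

variable [IsProbabilityMeasure P]

namespace IsStormSequence

theorem aemeasurable_forcing (hTD : IsStormSequence P lam f T D) (Γ : RiverNetwork E)
    (K H a : E → ℝ) (t : ℝ) :
    AEMeasurable (fun ω => stormSum (fun v => flow Γ K H (t - v)) H a T D (stormCount T t ω) ω)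
      P :=
  hTD.aemeasurable_stormSum_stormCount (A := fun v => flow Γ K H (t - v))
    (continuous_flow.comp (continuous_const.sub continuous_id)) H a t

theorem isProbabilityMeasure_forcingLaw (hTD : IsStormSequence P lam f T D)
    (Γ : RiverNetwork E) (K H a : E → ℝ) (t : ℝ) :
    IsProbabilityMeasure (forcingLaw Γ K H a P T D t) :=
  Measure.isProbabilityMeasure_map (hTD.aemeasurable_forcing Γ K H a t)

theorem transitionLaw_eq_map (hTD : IsStormSequence P lam f T D) (Γ : RiverNetwork E)
    (K H a : E → ℝ) (t : ℝ) (x : E ⊕ E → ℝ) :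
    transitionLaw Γ K H a P T D t x =
      (forcingLaw Γ K H a P T D t).map fun z => (flow Γ K H t).mulVec x + z := by
  rw [forcingLaw, AEMeasurable.map_map_of_aemeasurable (by fun_prop)
    (hTD.aemeasurable_forcing Γ K H a t), transitionLaw]
  congr 1
  funext ω
  exact process_eq_stormSum Γ K H a T D x t ω

theorem ae_nonneg_forcingLaw (hTD : IsStormSequence P lam f T D) (hK : ∀ e, 0 < K e)
    (hH : ∀ e, 0 < H e) (ha : ∀ e, 0 < a e) (t : ℝ) :
    ∀ᵐ z ∂(forcingLaw Γ K H a P T D t), ∀ i, 0 ≤ z i := by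
  rw [forcingLaw, ae_map_iff (hTD.aemeasurable_forcing Γ K H a t) measurableSet_forall_nonneg]
  exact hTD.ae_stormSum_nonneg hH ha fun v hv => flow_nonneg hK hH (sub_nonneg.2 hv.2)

theorem integral_exp_neg_forcingLaw (hTD : IsStormSequence P lam f T D) (hlam : 0 < lam)
    (hK : ∀ e, 0 < K e) (hH : ∀ e, 0 < H e) (ha : ∀ e, 0 < a e) {t : ℝ} (ht : 0 ≤ t)
    {s : E ⊕ E → ℝ} (hs : ∀ i, 0 ≤ s i) :
    ∫ z, Real.exp (-(z ⬝ᵥ s)) ∂(forcingLaw Γ K H a P T D t) =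
      Real.exp (-lam * ∫ v in (0 : ℝ)..t, killRate Γ K H a f s v) := by
  rw [forcingLaw, integral_map (hTD.aemeasurable_forcing Γ K H a t)
    (continuous_exp_neg_dotProduct s).aestronglyMeasurable,
    hTD.integral_exp_neg_stormSum_flow_sub hlam hK hH ha ht hs]

theorem measurable_evolution (Γ : RiverNetwork E) (K H : E → ℝ) (t : ℝ) :
    Measurable fun p : (E ⊕ E → ℝ) × (E ⊕ E → ℝ) => (flow Γ K H t).mulVec p.1 + p.2 := by
  refine Continuous.measurable ?_
  fun_prop

/-- The forcing has a law independent of the starting point, so averaging the transition law over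
`π` is a push-forward of a product measure. -/
theorem lintegral_transitionLaw (hTD : IsStormSequence P lam f T D) (Γ : RiverNetwork E)
    (K H a : E → ℝ) (t : ℝ) {π : Measure (E ⊕ E → ℝ)}
    (hsupp : π (orthant (E ⊕ E))ᶜ = 0) {A : Set (E ⊕ E → ℝ)} (hA : MeasurableSet A) :
    ∫⁻ x in orthant (E ⊕ E), transitionLaw Γ K H a P T D t x A ∂π =
      ((π.prod (forcingLaw Γ K H a P T D t)).map
        fun p => (flow Γ K H t).mulVec p.1 + p.2) A := by
  have := hTD.isProbabilityMeasure_forcingLaw Γ K H a t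
  have hmem : ∀ᵐ x ∂π, x ∈ orthant (E ⊕ E) := mem_ae_iff.2 hsupp
  rw [Measure.map_apply (measurable_evolution Γ K H t) hA,
    Measure.prod_apply (measurable_evolution Γ K H t hA),
    Measure.restrict_eq_self_of_ae_mem (s := orthant (E ⊕ E)) hmem]
  refine lintegral_congr fun x => ?_
  rw [hTD.transitionLaw_eq_map, Measure.map_apply (by fun_prop) hA]
  rfl

/-- Invariance is tested only on subsets of the open orthant. Applied to the orthant itself, it
shows that the evolved law has full mass there, so the complement is null for both measures and
equality holds on all measurable sets. -/
theorem isInvariantLaw_iff (hTD : IsStormSequence P lam f T D) (Γ : RiverNetwork E)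
    (K H a : E → ℝ) {π : Measure (E ⊕ E → ℝ)} [IsProbabilityMeasure π]
    (hsupp : π (orthant (E ⊕ E))ᶜ = 0) :
    IsInvariantLaw (transitionLaw Γ K H a P T D) π ↔ ∀ t, 0 < t →
      (π.prod (forcingLaw Γ K H a P T D t)).map
        (fun p => (flow Γ K H t).mulVec p.1 + p.2) = π := by
  constructor
  · intro hπ t ht
    have := hTD.isProbabilityMeasure_forcingLaw Γ K H a t
    have hprob : IsProbabilityMeasure ((π.prod (forcingLaw Γ K H a P T D t)).map
        (fun p => (flow Γ K H t).mulVec p.1 + p.2)) :=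
      Measure.isProbabilityMeasure_map (measurable_evolution Γ K H t).aemeasurable
    have hinv : ∀ A, MeasurableSet A → A ⊆ orthant (E ⊕ E) →
        ((π.prod (forcingLaw Γ K H a P T D t)).map
          (fun p => (flow Γ K H t).mulVec p.1 + p.2)) A = π A := fun A hA hAo => by
      rw [← hTD.lintegral_transitionLaw Γ K H a t hsupp hA, hπ.invariant t ht A hA hAo]
    have hfull : ((π.prod (forcingLaw Γ K H a P T D t)).map
        (fun p => (flow Γ K H t).mulVec p.1 + p.2)) (orthant (E ⊕ E))ᶜ = 0 := by
      rw [prob_compl_eq_zero_iff measurableSet_orthant,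
        hinv _ measurableSet_orthant le_rfl, ← prob_compl_eq_zero_iff measurableSet_orthant]
      exact hsupp
    ext A hA
    rw [← measure_inter_add_sdiff A measurableSet_orthant,
      ← measure_inter_add_sdiff (μ := π) A measurableSet_orthant,
      hinv _ (hA.inter measurableSet_orthant) Set.inter_subset_right,
      measure_mono_null (Set.sdiff_subset_compl _ _) hfull,
      measure_mono_null (Set.sdiff_subset_compl _ _) hsupp]
  · intro h
    refine ⟨inferInstance, hsupp, fun t ht A hA _ => ?_⟩
    rw [hTD.lintegral_transitionLaw Γ K H a t hsupp hA, h t ht]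

theorem integral_exp_neg_evolution (hTD : IsStormSequence P lam f T D) (hlam : 0 < lam)
    (hK : ∀ e, 0 < K e) (hH : ∀ e, 0 < H e) (ha : ∀ e, 0 < a e) {t : ℝ} (ht : 0 ≤ t)
    {s : E ⊕ E → ℝ} (hs : ∀ i, 0 ≤ s i) (π : Measure (E ⊕ E → ℝ)) [IsProbabilityMeasure π] :
    ∫ x, Real.exp (-(x ⬝ᵥ s)) ∂((π.prod (forcingLaw Γ K H a P T D t)).map
        (fun p => (flow Γ K H t).mulVec p.1 + p.2)) =
      (∫ x, Real.exp (-(x ⬝ᵥ (flow Γ K H t).transpose.mulVec s)) ∂π) *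
        Real.exp (-lam * ∫ v in (0 : ℝ)..t, killRate Γ K H a f s v) := by
  have := hTD.isProbabilityMeasure_forcingLaw Γ K H a t
  rw [integral_map (measurable_evolution Γ K H t).aemeasurable
    (continuous_exp_neg_dotProduct s).aestronglyMeasurable,
    ← hTD.integral_exp_neg_forcingLaw hlam hK hH ha ht hs, ← integral_prod_mul]
  refine integral_congr_ae (Eventually.of_forall fun p => ?_)
  simp only
  rw [add_dotProduct, neg_add, Real.exp_add, mulVec_dotProduct_eq]

/-- Invariance factors the transform of `π` at `s` into its value at `φ(t)ᵀ s`, which tends to 1,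
and `exp (-lam * ∫₀ᵗ θ)`. The left side is positive and does not depend on `t`, so the integrals
cannot diverge and their limit is determined. -/
theorem integrableOn_killRate_and_laplace_of_isInvariantLaw (hTD : IsStormSequence P lam f T D)
    (hlam : 0 < lam) (hK : ∀ e, 0 < K e) (hH : ∀ e, 0 < H e) (ha : ∀ e, 0 < a e)
    {π : Measure (E ⊕ E → ℝ)} (hπ : IsInvariantLaw (transitionLaw Γ K H a P T D) π)
    {s : E ⊕ E → ℝ} (hs : ∀ i, 0 ≤ s i) :
    IntegrableOn (killRate Γ K H a f s) (Set.Ioi 0) ∧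
      ∫ x, Real.exp (-(x ⬝ᵥ s)) ∂π =
        Real.exp (-lam * ∫ v in Set.Ioi 0, killRate Γ K H a f s v) := by
  have := hTD.isProbabilityMeasure_densityLaw
  have := hπ.prob
  have hinv := (hTD.isInvariantLaw_iff Γ K H a hπ.supported).1 hπ
  have hnn : ∀ᵐ x ∂π, ∀ i, 0 ≤ x i := by
    have : ∀ᵐ x ∂π, x ∈ orthant (E ⊕ E) := mem_ae_iff.2 hπ.supported
    filter_upwards [this] with x hx i using (hx i).le
  have heq : ∀ t, 0 < t → ∫ x, Real.exp (-(x ⬝ᵥ s)) ∂π =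
      (∫ x, Real.exp (-(x ⬝ᵥ (flow Γ K H t).transpose.mulVec s)) ∂π) *
        Real.exp (-lam * ∫ v in (0 : ℝ)..t, killRate Γ K H a f s v) := fun t ht => by
    conv_lhs => rw [← hinv t ht]
    exact hTD.integral_exp_neg_evolution hlam hK hH ha ht.le hs π
  have h1 : Tendsto (fun t => ∫ x, Real.exp (-(x ⬝ᵥ (flow Γ K H t).transpose.mulVec s)) ∂π)
      atTop (𝓝 1) := by
    have := tendsto_integral_exp_neg_dotProduct hnn (l := atTop)
      (u := fun t => (flow Γ K H t).transpose.mulVec s)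
      (by filter_upwards [eventually_ge_atTop 0] with t ht
          exact flow_transpose_mulVec_nonneg hK hH ht hs)
      (tendsto_flow_transpose_mulVec_zero hK hH s)
    simpa using this
  have hpos : 0 < ∫ x, Real.exp (-(x ⬝ᵥ s)) ∂π := by
    refine integral_exp_pos (Integrable.of_bound
      (continuous_exp_neg_dotProduct s).aestronglyMeasurable 1 ?_)
    filter_upwards [hnn] with x hx using norm_exp_neg_dotProduct_le_one hx hs
  have h2 : Tendsto (fun t => Real.exp (-lam * ∫ v in (0 : ℝ)..t, killRate Γ K H a f s v)) atTop
      (𝓝 (∫ x, Real.exp (-(x ⬝ᵥ s)) ∂π)) := by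
    have h3 := (tendsto_const_nhds (x := ∫ x, Real.exp (-(x ⬝ᵥ s)) ∂π)).div h1 one_ne_zero
    rw [div_one] at h3
    refine h3.congr' ?_
    filter_upwards [eventually_gt_atTop 0, h1.eventually_const_lt zero_lt_one] with t ht hgt
    simp only [Pi.div_apply]
    rw [div_eq_iff hgt.ne', heq t ht, mul_comm]
  have h4 : Tendsto (fun t => ∫ v in (0 : ℝ)..t, killRate Γ K H a f s v) atTop
      (𝓝 (-lam⁻¹ * Real.log (∫ x, Real.exp (-(x ⬝ᵥ s)) ∂π))) := by
    have h5 := ((Real.continuousAt_log hpos.ne').tendsto.comp h2).const_mul (-lam⁻¹)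
    refine h5.congr fun t => ?_
    simp only [Function.comp_apply, Real.log_exp]
    field_simp
  -- Taking logarithms above gave a finite limit of the integrals over `[0, t]`; for a nonnegative
  -- integrand this is integrability on the half-line.
  have hkill_int : IntegrableOn (killRate Γ K H a f s) (Set.Ioi 0) := by
    refine integrableOn_Ioi_of_intervalIntegral_norm_tendsto _ 0 (l := atTop)
      (fun t => ((continuous_killRate hK hH ha hs).integrableOn_Ioc)) tendsto_id (h4.congr fun t => ?_)
    refine intervalIntegral.integral_congr fun v _ => ?_
    exact (Real.norm_of_nonneg (killRate_nonneg hK hH ha hs v)).symm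
  refine ⟨hkill_int, tendsto_nhds_unique h2 ?_⟩
  exact (Real.continuous_exp.tendsto _).comp
    ((intervalIntegral_tendsto_integral_Ioi 0 hkill_int tendsto_id).const_mul (-lam))

/-- There is at most one invariant law. -/
theorem isInvariantLaw_unique (hTD : IsStormSequence P lam f T D) (hlam : 0 < lam)
    (hK : ∀ e, 0 < K e) (hH : ∀ e, 0 < H e) (ha : ∀ e, 0 < a e) {π π' : Measure (E ⊕ E → ℝ)}
    (hπ : IsInvariantLaw (transitionLaw Γ K H a P T D) π)
    (hπ' : IsInvariantLaw (transitionLaw Γ K H a P T D) π') : π = π' := by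
  have := hπ.prob
  have := hπ'.prob
  have hnn : ∀ ρ, IsInvariantLaw (transitionLaw Γ K H a P T D) ρ → ∀ᵐ x ∂ρ, ∀ i, 0 ≤ x i := by
    intro ρ hρ
    have : ∀ᵐ x ∂ρ, x ∈ orthant (E ⊕ E) := mem_ae_iff.2 hρ.supported
    filter_upwards [this] with x hx i using (hx i).le
  refine ext_of_integral_exp_neg_dotProduct (hnn π hπ) (hnn π' hπ') fun s hs => ?_
  rw [(hTD.integrableOn_killRate_and_laplace_of_isInvariantLaw hlam hK hH ha hπ
      fun i => (hs i).le).2,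
    (hTD.integrableOn_killRate_and_laplace_of_isInvariantLaw hlam hK hH ha hπ'
      fun i => (hs i).le).2]

end IsStormSequence

end InvariantLaw

/-! ### Construction of the stationary state and weak convergence -/

section Existence

open Filter Topology

variable {E : Type*} [Fintype E] [DecidableEq E] {Ω : Type*} [MeasurableSpace Ω] {P : Measure Ω}
  {lam : ℝ} {f : (E → ℝ) → ℝ} {T : ℕ → Ω → ℝ} {D : ℕ → Ω → (E → ℝ)} {Γ : RiverNetwork E}
  {K H a : E → ℝ}

/-- The stationary state: the superposition of all storms, the one at time `v` having age `v`. -/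
noncomputable def stationaryState (Γ : RiverNetwork E) (K H a : E → ℝ) (T : ℕ → Ω → ℝ)
    (D : ℕ → Ω → (E → ℝ)) (ω : Ω) : E ⊕ E → ℝ :=
  ∑' n, (flow Γ K H (T (n + 1) ω)).mulVec (jump H a (D (n + 1) ω))

theorem tendsto_exp_neg_integral_killRate {s : E ⊕ E → ℝ}
    (hkill_int : IntegrableOn (killRate Γ K H a f s) (Set.Ioi 0)) :
    Tendsto (fun m : ℕ => Real.exp (-lam * ∫ v in (0 : ℝ)..m, killRate Γ K H a f s v)) atTop
      (𝓝 (Real.exp (-lam * ∫ v in Set.Ioi 0, killRate Γ K H a f s v))) :=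
  (Real.continuous_exp.tendsto _).comp
    ((intervalIntegral_tendsto_integral_Ioi 0 hkill_int tendsto_natCast_atTop_atTop).const_mul (-lam))

theorem integral_killRate_flow_transpose {t : ℝ} (ht : 0 ≤ t) {s : E ⊕ E → ℝ}
    (hkill_int : IntegrableOn (killRate Γ K H a f s) (Set.Ioi 0)) :
    ∫ v in Set.Ioi 0, killRate Γ K H a f ((flow Γ K H t).transpose.mulVec s) v =
      (∫ v in Set.Ioi 0, killRate Γ K H a f s v) - ∫ v in (0 : ℝ)..t, killRate Γ K H a f s v := by
  have h2 : ∀ v ∈ Set.Ioi (0 : ℝ), killRate Γ K H a f ((flow Γ K H t).transpose.mulVec s) v =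
      killRate Γ K H a f s (v + t) := fun v hv => by
    rw [killRate_flow_transpose ht (le_of_lt hv), add_comm]
  have h3 := (measurePreserving_add_right volume t).setIntegral_preimage_emb
    (measurableEmbedding_addRight t) (killRate Γ K H a f s) (Set.Ioi t)
  rw [Set.preimage_add_const_Ioi, sub_self] at h3
  rw [setIntegral_congr_fun measurableSet_Ioi h2, h3, eq_sub_iff_add_eq',
    intervalIntegral.integral_of_le ht,
    ← setIntegral_union (Set.Ioc_disjoint_Ioi le_rfl) measurableSet_Ioi
      (hkill_int.mono_set Set.Ioc_subset_Ioi_self) (hkill_int.mono_set (Set.Ioi_subset_Ioi ht)),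
    Set.Ioc_union_Ioi_eq_Ioi ht]

namespace IsStormSequence

theorem ae_flow_jump_nonneg (hTD : IsStormSequence P lam f T D) (hK : ∀ e, 0 < K e)
    (hH : ∀ e, 0 < H e) (ha : ∀ e, 0 < a e) :
    ∀ᵐ ω ∂P, ∀ n i, 0 ≤ (flow Γ K H (T (n + 1) ω)).mulVec (jump H a (D (n + 1) ω)) i := by
  filter_upwards [hTD.ae_strictMono_time, hTD.ae_depth_mem_orthant] with ω h1 h3 n i
  refine mulVec_nonneg_of_nonneg (flow_nonneg hK hH ?_) (jump_nonneg hH ha (h3 n)) i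
  rw [← hTD.time_zero ω]
  exact h1.monotone (Nat.zero_le _)

variable [IsProbabilityMeasure P]

/-- Let `Y` be the total mass of the series. Its transform at `ε` satisfies `exp (-lam * ∫ θ) =
E[exp (-ε Y); Y < ∞] ≤ P(Y < ∞)`, where `θ` is the kill rate at `s = (ε, …, ε)`. As `ε → 0` the left
side tends to 1, so `Y` is almost surely finite. -/
theorem ae_summable_storms (hTD : IsStormSequence P lam f T D) (hlam : 0 < lam)
    (hK : ∀ e, 0 < K e) (hH : ∀ e, 0 < H e) (ha : ∀ e, 0 < a e)
    (hkill_int : ∀ s : E ⊕ E → ℝ, (∀ i, 0 ≤ s i) →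
      IntegrableOn (killRate Γ K H a f s) (Set.Ioi 0)) :
    ∀ᵐ ω ∂P, Summable fun n => (flow Γ K H (T (n + 1) ω)).mulVec (jump H a (D (n + 1) ω)) := by
  classical
  have := hTD.isProbabilityMeasure_densityLaw
  let y : ℕ → Ω → ℝ := fun n ω => ∑ i, (flow Γ K H (T (n + 1) ω)).mulVec (jump H a (D (n + 1) ω)) i
  have hy : ∀ n, Measurable (y n) := fun n => Finset.measurable_fun_sum _ fun i _ =>
    (measurable_pi_apply i).comp ((measurable_mulVec_jump continuous_flow H a).comp
      ((hTD.measurable_time _).prodMk (hTD.measurable_depth _)))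
  let Y : Ω → ENNReal := fun ω => ∑' n, ENNReal.ofReal (y n ω)
  have hY : Measurable Y := Measurable.tsum fun n => (hy n).ennreal_ofReal
  have hYB : MeasurableSet {ω | Y ω ≠ ⊤} := hY (measurableSet_singleton ⊤).compl
  let ε : ℕ → ℝ := fun k => 1 / ((k : ℝ) + 1)
  have hε : ∀ k, 0 < ε k := fun k => by positivity
  let u : ℕ → E ⊕ E → ℝ := fun k _ => ε k
  have hu : ∀ k i, 0 ≤ u k i := fun k i => (hε k).le
  have hbound : ∀ k, Real.exp (-lam * ∫ v in Set.Ioi 0, killRate Γ K H a f (u k) v) ≤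
      P.real {ω | Y ω ≠ ⊤} := by
    intro k
    -- The pointwise limit of the exponentials of the partial sums: where the nonnegative series
    -- diverges, they tend to 0.
    let h : Ω → ℝ := fun ω => if Y ω ≠ ⊤ then Real.exp (-(ε k * (Y ω).toReal)) else 0
    have hlim : Tendsto (fun m : ℕ => ∫ ω, Real.exp (-(stormSum (flow Γ K H) H a T D
        (stormCount T m ω) ω ⬝ᵥ u k)) ∂P) atTop (𝓝 (∫ ω, h ω ∂P)) := by
      refine tendsto_integral_of_dominated_convergence (fun _ => (1 : ℝ)) (fun m => ?_)
        (integrable_const _) (fun m => ?_) ?_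
      · exact ((continuous_exp_neg_dotProduct (u k)).measurable.comp_aemeasurable
          (hTD.aemeasurable_stormSum_stormCount continuous_flow H a m)).aestronglyMeasurable
      · filter_upwards [hTD.ae_stormSum_nonneg (A := flow Γ K H) (t := m) hH ha
          fun v hv => flow_nonneg hK hH hv.1] with ω hω
        exact norm_exp_neg_dotProduct_le_one hω (hu k)
      · filter_upwards [hTD.ae_strictMono_time, hTD.ae_tendsto_time,
          hTD.ae_flow_jump_nonneg (Γ := Γ) hK hH ha] with ω h1 h2 h3
        have hy0 : ∀ n, 0 ≤ y n ω := fun n => Finset.sum_nonneg fun i _ => h3 n i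
        have hcount : Tendsto (fun m : ℕ => stormCount T (m : ℝ) ω) atTop atTop :=
          (tendsto_stormCount h1 h2).comp tendsto_natCast_atTop_atTop
        have hdot : ∀ N, stormSum (flow Γ K H) H a T D N ω ⬝ᵥ u k =
            ε k * ∑ n ∈ Finset.range N, y n ω := by
          intro N
          rw [stormSum, sum_dotProduct, Finset.mul_sum]
          refine Finset.sum_congr rfl fun n _ => ?_
          simp only [dotProduct, u, y, Finset.mul_sum]
          exact Finset.sum_congr rfl fun i _ => mul_comm _ _
        simp_rw [hdot]
        by_cases hs : Summable fun n => y n ω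
        · have hYω : Y ω = ENNReal.ofReal (∑' n, y n ω) :=
            (ENNReal.ofReal_tsum_of_nonneg hy0 hs).symm
          have hh : h ω = Real.exp (-(ε k * ∑' n, y n ω)) := by
            simp only [h, hYω]
            rw [if_pos ENNReal.ofReal_ne_top, ENNReal.toReal_ofReal (tsum_nonneg hy0)]
          rw [hh]
          exact (Real.continuous_exp.tendsto _).comp
            ((hs.hasSum.tendsto_sum_nat.comp hcount).const_mul (ε k)).neg
        · have hYω : Y ω = ⊤ := by
            by_contra hne
            exact hs ((ENNReal.summable_toReal hne).congr fun n =>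
              ENNReal.toReal_ofReal (hy0 n))
          have hh : h ω = 0 := by simp [h, hYω]
          rw [hh]
          have := (not_summable_iff_tendsto_nat_atTop_of_nonneg hy0).1 hs
          exact Real.tendsto_exp_neg_atTop_nhds_zero.comp
            ((this.comp hcount).const_mul_atTop (hε k))
    have hlim2 := tendsto_exp_neg_integral_killRate (lam := lam) (hkill_int (u k) (hu k))
    have heq : (fun m : ℕ => ∫ ω, Real.exp (-(stormSum (flow Γ K H) H a T D
        (stormCount T m ω) ω ⬝ᵥ u k)) ∂P) =
        fun m : ℕ => Real.exp (-lam * ∫ v in (0 : ℝ)..m, killRate Γ K H a f (u k) v) := by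
      funext m
      exact hTD.integral_exp_neg_stormSum_flow hlam hK hH ha (Nat.cast_nonneg m) (hu k)
    rw [heq] at hlim
    rw [tendsto_nhds_unique hlim2 hlim, ← integral_indicator_one hYB]
    refine integral_mono_of_nonneg (Eventually.of_forall fun ω => ?_)
      ((integrable_const (1 : ℝ)).indicator hYB) (Eventually.of_forall fun ω => ?_)
    · simp only [h, Pi.zero_apply]
      split_ifs
      · exact (Real.exp_pos _).le
      · exact le_rfl
    · by_cases hω : Y ω = ⊤
      · simp [h, hω]
      · simp only [h, Set.indicator, Set.mem_ofPred_eq, ne_eq, hω, not_false_iff, if_true,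
          Pi.one_apply, Real.exp_le_one_iff, neg_nonpos]
        exact mul_nonneg (hε k).le ENNReal.toReal_nonneg
  -- Since `ε k ≤ 1` and the kill rate is monotone in `s`, its value at `s = 1` is an integrable
  -- dominating function.
  have hzero : Tendsto (fun k => ∫ v in Set.Ioi 0, killRate Γ K H a f (u k) v) atTop (𝓝 0) := by
    have hone : ∀ i : E ⊕ E, 0 ≤ (1 : E ⊕ E → ℝ) i := fun i => zero_le_one
    have := tendsto_integral_of_dominated_convergence (μ := volume.restrict (Set.Ioi (0 : ℝ)))
      (F := fun k v => killRate Γ K H a f (u k) v) (f := fun _ => (0 : ℝ))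
      (fun v => killRate Γ K H a f 1 v)
      (fun k => (continuous_killRate hK hH ha (hu k)).aestronglyMeasurable) (hkill_int 1 hone)
      (fun k => Eventually.of_forall fun v => by
        rw [Real.norm_of_nonneg (killRate_nonneg hK hH ha (hu k) v)]
        refine killRate_mono hK hH ha (hu k) (fun i => ?_) v
        exact div_le_one_of_le₀ (by linarith [Nat.cast_nonneg (α := ℝ) k]) (by positivity))
      (Eventually.of_forall fun v => tendsto_killRate_zero hK hH ha hu (by
        rw [tendsto_pi_nhds]
        intro i
        exact tendsto_one_div_add_atTop_nhds_zero_nat) v)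
    simpa using this
  have hge : 1 ≤ P.real {ω | Y ω ≠ ⊤} := by
    refine le_of_tendsto' (x := atTop) ?_ hbound
    simpa [Function.comp_def] using
      (Real.continuous_exp.tendsto _).comp (hzero.const_mul (-lam))
  have hae : ∀ᵐ ω ∂P, Y ω ≠ ⊤ := by
    refine mem_ae_iff.2 ((prob_compl_eq_zero_iff hYB).2 ?_)
    exact (ENNReal.toReal_eq_one_iff _).1 (le_antisymm measureReal_le_one hge)
  filter_upwards [hae, hTD.ae_flow_jump_nonneg (Γ := Γ) hK hH ha] with ω hω h3
  have hy0 : ∀ n, 0 ≤ y n ω := fun n => Finset.sum_nonneg fun i _ => h3 n i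
  have hs : Summable fun n => y n ω := (ENNReal.summable_toReal hω).congr fun n =>
    ENNReal.toReal_ofReal (hy0 n)
  rw [Pi.summable]
  intro i
  exact Summable.of_nonneg_of_le (fun n => h3 n i)
    (fun n => Finset.single_le_sum (fun i _ => h3 n i) (Finset.mem_univ i)) hs

theorem ae_tendsto_stationaryState (hTD : IsStormSequence P lam f T D) (hlam : 0 < lam)
    (hK : ∀ e, 0 < K e) (hH : ∀ e, 0 < H e) (ha : ∀ e, 0 < a e)
    (hkill_int : ∀ s : E ⊕ E → ℝ, (∀ i, 0 ≤ s i) →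
      IntegrableOn (killRate Γ K H a f s) (Set.Ioi 0)) :
    ∀ᵐ ω ∂P, Tendsto (fun t => stormSum (flow Γ K H) H a T D (stormCount T t ω) ω) atTop
      (𝓝 (stationaryState Γ K H a T D ω)) := by
  filter_upwards [hTD.ae_strictMono_time, hTD.ae_tendsto_time,
    hTD.ae_summable_storms hlam hK hH ha hkill_int] with ω h1 h2 h3
  exact h3.hasSum.tendsto_sum_nat.comp (tendsto_stormCount h1 h2)

theorem aemeasurable_stationaryState (hTD : IsStormSequence P lam f T D) (hlam : 0 < lam)
    (hK : ∀ e, 0 < K e) (hH : ∀ e, 0 < H e) (ha : ∀ e, 0 < a e)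
    (hkill_int : ∀ s : E ⊕ E → ℝ, (∀ i, 0 ≤ s i) →
      IntegrableOn (killRate Γ K H a f s) (Set.Ioi 0)) :
    AEMeasurable (stationaryState Γ K H a T D) P :=
  aemeasurable_of_tendsto_metrizable_ae atTop
    (fun N => (hTD.measurable_stormSum (A := flow Γ K H) continuous_flow H a N).aemeasurable)
    ((hTD.ae_summable_storms hlam hK hH ha hkill_int).mono fun _ h => h.hasSum.tendsto_sum_nat)

/-- The first storm alone suffices: it rains on every link, its age is positive, and by then the
runoff of each link has fed that link's own discharge. All other terms are nonnegative. -/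
theorem ae_stationaryState_mem_orthant (hTD : IsStormSequence P lam f T D) (hlam : 0 < lam)
    (hK : ∀ e, 0 < K e) (hH : ∀ e, 0 < H e) (ha : ∀ e, 0 < a e)
    (hkill_int : ∀ s : E ⊕ E → ℝ, (∀ i, 0 ≤ s i) →
      IntegrableOn (killRate Γ K H a f s) (Set.Ioi 0)) :
    ∀ᵐ ω ∂P, stationaryState Γ K H a T D ω ∈ orthant (E ⊕ E) := by
  filter_upwards [hTD.ae_strictMono_time, hTD.ae_depth_mem_orthant,
    hTD.ae_flow_jump_nonneg (Γ := Γ) hK hH ha,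
    hTD.ae_summable_storms hlam hK hH ha hkill_int] with ω h1 h2 h3 h4 i
  have hT : 0 < T (0 + 1) ω := by
    rw [← hTD.time_zero ω]
    exact h1 (Nat.zero_lt_succ 0)
  have hle : (flow Γ K H (T (0 + 1) ω)).mulVec (jump H a (D (0 + 1) ω)) i ≤
      stationaryState Γ K H a T D ω i :=
    le_hasSum (Pi.hasSum.1 h4.hasSum i) 0 fun n _ => h3 n i
  refine lt_of_lt_of_le ?_ hle
  obtain ⟨e, he⟩ : ∃ e, 0 < flow Γ K H (T (0 + 1) ω) i (Sum.inr e) := by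
    rcases i with e | e
    · exact ⟨e, flow_inl_inr_pos hK hH hT e⟩
    · exact ⟨e, flow_diag_pos hK hH hT.le _⟩
  have hj : 0 < jump H a (D (0 + 1) ω) (Sum.inr e) :=
    mul_pos (hH e) (mul_pos (ha e) (h2 0 e))
  exact (mul_pos he hj).trans_le (Finset.single_le_sum
    (f := fun j => flow Γ K H (T (0 + 1) ω) i j * jump H a (D (0 + 1) ω) j)
    (fun j _ => mul_nonneg (flow_nonneg hK hH hT.le i j) (jump_nonneg hH ha (h2 0) j))
    (Finset.mem_univ (Sum.inr e)))

theorem integral_exp_neg_stationaryState (hTD : IsStormSequence P lam f T D) (hlam : 0 < lam)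
    (hK : ∀ e, 0 < K e) (hH : ∀ e, 0 < H e) (ha : ∀ e, 0 < a e)
    (hkill_int : ∀ s : E ⊕ E → ℝ, (∀ i, 0 ≤ s i) →
      IntegrableOn (killRate Γ K H a f s) (Set.Ioi 0)) {s : E ⊕ E → ℝ} (hs : ∀ i, 0 ≤ s i) :
    ∫ ω, Real.exp (-(stationaryState Γ K H a T D ω ⬝ᵥ s)) ∂P =
      Real.exp (-lam * ∫ v in Set.Ioi 0, killRate Γ K H a f s v) := by
  refine tendsto_nhds_unique (f := fun m : ℕ => ∫ ω, Real.exp (-(stormSum (flow Γ K H) H a T D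
        (stormCount T m ω) ω ⬝ᵥ s)) ∂P) (l := atTop) ?_ ?_
  · refine tendsto_integral_of_dominated_convergence (fun _ => (1 : ℝ)) (fun m => ?_)
        (integrable_const _) (fun m => ?_) ?_
    · exact ((continuous_exp_neg_dotProduct s).measurable.comp_aemeasurable
        (hTD.aemeasurable_stormSum_stormCount continuous_flow H a m)).aestronglyMeasurable
    · filter_upwards [hTD.ae_stormSum_nonneg (A := flow Γ K H) (t := m) hH ha
        fun v hv => flow_nonneg hK hH hv.1] with ω hω
      exact norm_exp_neg_dotProduct_le_one hω hs
    · filter_upwards [hTD.ae_tendsto_stationaryState hlam hK hH ha hkill_int] with ω hω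
      exact ((continuous_exp_neg_dotProduct s).tendsto _).comp
        (hω.comp tendsto_natCast_atTop_atTop)
  · have heq : ∀ m : ℕ, ∫ ω, Real.exp (-(stormSum (flow Γ K H) H a T D
        (stormCount T m ω) ω ⬝ᵥ s)) ∂P =
        Real.exp (-lam * ∫ v in (0 : ℝ)..m, killRate Γ K H a f s v) := fun m =>
      hTD.integral_exp_neg_stormSum_flow hlam hK hH ha (Nat.cast_nonneg m) hs
    simp_rw [heq]
    exact tendsto_exp_neg_integral_killRate (hkill_int s hs)

/-- At `φ(t)ᵀ s` the exponent is the integral of the kill rate beyond age `t`; the forcing over a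
time `t` supplies the missing integral over `[0, t]`. Equality of Laplace transforms gives equality
of laws. -/
theorem isInvariantLaw_stationaryState (hTD : IsStormSequence P lam f T D) (hlam : 0 < lam)
    (hK : ∀ e, 0 < K e) (hH : ∀ e, 0 < H e) (ha : ∀ e, 0 < a e)
    (hkill_int : ∀ s : E ⊕ E → ℝ, (∀ i, 0 ≤ s i) →
      IntegrableOn (killRate Γ K H a f s) (Set.Ioi 0)) :
    IsInvariantLaw (transitionLaw Γ K H a P T D) (P.map (stationaryState Γ K H a T D)) := by
  have := hTD.isProbabilityMeasure_densityLaw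
  have hm := hTD.aemeasurable_stationaryState hlam hK hH ha hkill_int
  have := Measure.isProbabilityMeasure_map hm
  have hmem : ∀ᵐ x ∂(P.map (stationaryState Γ K H a T D)), x ∈ orthant (E ⊕ E) :=
    (ae_map_iff hm measurableSet_orthant).2
      (hTD.ae_stationaryState_mem_orthant hlam hK hH ha hkill_int)
  have hnn : ∀ᵐ x ∂(P.map (stationaryState Γ K H a T D)), ∀ i, 0 ≤ x i :=
    hmem.mono fun x hx i => (hx i).le
  have hlap : ∀ s : E ⊕ E → ℝ, (∀ i, 0 ≤ s i) →
      ∫ x, Real.exp (-(x ⬝ᵥ s)) ∂(P.map (stationaryState Γ K H a T D)) =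
        Real.exp (-lam * ∫ v in Set.Ioi 0, killRate Γ K H a f s v) := fun s hs => by
    rw [integral_map hm (continuous_exp_neg_dotProduct s).aestronglyMeasurable,
      hTD.integral_exp_neg_stationaryState hlam hK hH ha hkill_int hs]
  refine (hTD.isInvariantLaw_iff Γ K H a (mem_ae_iff.1 hmem)).2 fun t ht => ?_
  have := hTD.isProbabilityMeasure_forcingLaw Γ K H a t
  have := Measure.isProbabilityMeasure_map (μ := (P.map (stationaryState Γ K H a T D)).prod
    (forcingLaw Γ K H a P T D t)) (measurable_evolution Γ K H t).aemeasurable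
  refine ext_of_integral_exp_neg_dotProduct ?_ hnn fun s hs => ?_
  · rw [ae_map_iff (measurable_evolution Γ K H t).aemeasurable measurableSet_forall_nonneg]
    filter_upwards [Measure.quasiMeasurePreserving_fst.ae hnn,
      Measure.quasiMeasurePreserving_snd.ae (hTD.ae_nonneg_forcingLaw hK hH ha t)] with p h1 h2 i
    exact add_nonneg (mulVec_nonneg_of_nonneg (flow_nonneg hK hH ht.le) h1 i) (h2 i)
  · have hs0 : ∀ i, 0 ≤ s i := fun i => (hs i).le
    rw [hTD.integral_exp_neg_evolution hlam hK hH ha ht.le hs0, hlap s hs0,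
      hlap _ (flow_transpose_mulVec_nonneg hK hH ht.le hs0), ← Real.exp_add, ← mul_add]
    congr 2
    rw [integral_killRate_flow_transpose ht.le (hkill_int s hs0)]
    ring

/-- The forward forcing need not converge pathwise, but its time reversal has the same law and
converges almost surely to the stationary state. The initial condition is forgotten because `φ(t) x
→ 0`, and bounded convergence applies. -/
theorem tendsto_integral_transitionLaw (hTD : IsStormSequence P lam f T D) (hlam : 0 < lam)
    (hK : ∀ e, 0 < K e) (hH : ∀ e, 0 < H e) (ha : ∀ e, 0 < a e)
    (hkill_int : ∀ s : E ⊕ E → ℝ, (∀ i, 0 ≤ s i) →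
      IntegrableOn (killRate Γ K H a f s) (Set.Ioi 0)) (x : E ⊕ E → ℝ)
    (h : BoundedContinuousFunction (E ⊕ E → ℝ) ℝ) :
    Tendsto (fun t : ℝ => ∫ y, h y ∂(transitionLaw Γ K H a P T D t x)) atTop
      (𝓝 (∫ y, h y ∂(P.map (stationaryState Γ K H a T D)))) := by
  rw [integral_map (hTD.aemeasurable_stationaryState hlam hK hH ha hkill_int)
    h.continuous.aestronglyMeasurable]
  have heq : ∀ t, 0 ≤ t → ∫ y, h y ∂(transitionLaw Γ K H a P T D t x) =
      ∫ ω, h ((flow Γ K H t).mulVec x +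
        stormSum (flow Γ K H) H a T D (stormCount T t ω) ω) ∂P := by
    intro t ht
    have hc : Continuous fun z => h ((flow Γ K H t).mulVec x + z) := by fun_prop
    rw [hTD.transitionLaw_eq_map, integral_map (by fun_prop)
      h.continuous.aestronglyMeasurable, forcingLaw,
      hTD.map_stormSum_flow_sub_eq hlam hK hH ha ht, integral_map
        (hTD.aemeasurable_stormSum_stormCount continuous_flow H a t) hc.aestronglyMeasurable]
  have hlim : Tendsto (fun t : ℝ => ∫ ω, h ((flow Γ K H t).mulVec x +
      stormSum (flow Γ K H) H a T D (stormCount T t ω) ω) ∂P) atTop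
      (𝓝 (∫ ω, h (stationaryState Γ K H a T D ω) ∂P)) := by
    refine tendsto_integral_filter_of_dominated_convergence (fun _ => ‖h‖)
      (Eventually.of_forall fun t => ?_)
      (Eventually.of_forall fun t => Eventually.of_forall fun ω => h.norm_coe_le_norm _)
      (integrable_const _) ?_
    · have hc : Continuous fun z => h ((flow Γ K H t).mulVec x + z) := by fun_prop
      exact (hc.measurable.comp_aemeasurable
        (hTD.aemeasurable_stormSum_stormCount continuous_flow H a t)).aestronglyMeasurable
    · filter_upwards [hTD.ae_tendsto_stationaryState hlam hK hH ha hkill_int] with ω hω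
      have := (tendsto_flow_mulVec_zero (Γ := Γ) hK hH x).add hω
      rw [zero_add] at this
      exact (h.continuous.tendsto _).comp this
  refine hlim.congr' ?_
  filter_upwards [eventually_ge_atTop 0] with t ht
  exact (heq t ht).symm

end IsStormSequence

end Existence

/-! ### Absolute continuity from the randomness of two storms -/

section Density

open Filter Topology

variable {E : Type*} [Fintype E] [DecidableEq E] {lam : ℝ} {f : (E → ℝ) → ℝ}
  {Γ : RiverNetwork E} {K H a : E → ℝ}

/-- The stationary renewal equation: the Laplace transform of the invariant law is unchanged by
waiting for one storm. -/
theorem integral_expMeasure_killRate [IsProbabilityMeasure (densityLaw f)] (hlam : 0 < lam)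
    (hK : ∀ e, 0 < K e) (hH : ∀ e, 0 < H e) (ha : ∀ e, 0 < a e) {s : E ⊕ E → ℝ}
    (hs : ∀ i, 0 ≤ s i) (hkill_int : IntegrableOn (killRate Γ K H a f s) (Set.Ioi 0)) :
    ∫ w, (1 - killRate Γ K H a f s w) * Real.exp (-lam * ∫ v in Set.Ioi 0,
        killRate Γ K H a f ((flow Γ K H w).transpose.mulVec s) v) ∂(expMeasure lam) =
      Real.exp (-lam * ∫ v in Set.Ioi 0, killRate Γ K H a f s v) := by
  set θ := killRate Γ K H a f s with hθdef
  have hθ : Continuous θ := continuous_killRate hK hH ha hs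
  have hθ0 : ∀ v, 0 ≤ θ v := killRate_nonneg hK hH ha hs
  have hθ1 : ∀ v, θ v ≤ 1 := fun v => by
    have : 0 ≤ ∫ d, Real.exp (-((flow Γ K H |v|).mulVec (jump H a d) ⬝ᵥ s)) ∂(densityLaw f) :=
      integral_nonneg fun d => (Real.exp_pos _).le
    simp only [hθdef, killRate]
    linarith
  set I := ∫ v in Set.Ioi 0, θ v with hI
  let p : ℝ → ℝ := fun w => ∫ v in (0 : ℝ)..w, θ v
  have hp : ∀ w, HasDerivAt p (θ w) w := fun w =>
    intervalIntegral.integral_hasDerivAt_right (hθ.intervalIntegrable _ _)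
      hθ.stronglyMeasurable.stronglyMeasurableAtFilter hθ.continuousAt
  have hpc : Continuous p := continuous_iff_continuousAt.2 fun w => (hp w).continuousAt
  have hpI : ∀ w, 0 ≤ w → p w ≤ I := fun w hw => by
    simp only [p, hI]
    rw [intervalIntegral.integral_of_le hw]
    exact setIntegral_mono_set hkill_int (Eventually.of_forall hθ0) Set.Ioc_subset_Ioi_self.eventuallyLE
  -- `I - p w` is the integral of the kill rate beyond age `w`, hence the exponent at `φ(w)ᵀ s`. `G`
  -- is therefore an antiderivative of the integrand; it tends to 0 at infinity, and `-G 0` is the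
  -- claimed value.
  let G : ℝ → ℝ := fun w => -(Real.exp (-(lam * w)) * Real.exp (-lam * (I - p w)))
  let G' : ℝ → ℝ := fun w =>
    lam * Real.exp (-(lam * w)) * ((1 - θ w) * Real.exp (-lam * (I - p w)))
  have hGd : ∀ w, HasDerivAt G (G' w) w := by
    intro w
    have h3 := (((hp w).const_sub I).const_mul (-lam)).exp
    have h4 : HasDerivAt (fun w => Real.exp (-(lam * w)))
        (Real.exp (-(lam * w)) * -(lam * 1)) w :=
      ((hasDerivAt_id w).const_mul lam).neg.exp
    have h5 := (h4.mul h3).neg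
    convert! h5 using 1
    simp only [G']
    ring
  have hG'c : Continuous G' := by fun_prop
  have hbound : ∀ w, 0 ≤ w → Real.exp (-lam * (I - p w)) ≤ 1 := fun w hw => by
    rw [Real.exp_le_one_iff]
    nlinarith [hpI w hw]
  have hG'i : IntegrableOn G' (Set.Ioi 0) := by
    refine Integrable.mono' (integrableOn_mul_exp_neg hlam 0) hG'c.aestronglyMeasurable ?_
    filter_upwards [ae_restrict_mem measurableSet_Ioi] with w hw
    have h1 : 0 ≤ (1 - θ w) * Real.exp (-lam * (I - p w)) :=
      mul_nonneg (sub_nonneg.2 (hθ1 w)) (Real.exp_pos _).le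
    have h2 : (1 - θ w) * Real.exp (-lam * (I - p w)) ≤ 1 :=
      mul_le_one₀ (by linarith [hθ0 w]) (Real.exp_pos _).le (hbound w (le_of_lt hw))
    have h3 : 0 ≤ lam * Real.exp (-(lam * w)) := by positivity
    rw [Real.norm_of_nonneg (mul_nonneg h3 h1)]
    exact mul_le_of_le_one_right h3 h2
  have hG0 : Tendsto G atTop (𝓝 0) := by
    have h1 : Tendsto (fun w : ℝ => Real.exp (-(lam * w))) atTop (𝓝 0) :=
      Real.tendsto_exp_neg_atTop_nhds_zero.comp (tendsto_id.const_mul_atTop hlam)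
    refine squeeze_zero_norm' ?_ h1
    filter_upwards [eventually_ge_atTop 0] with w hw
    simp only [G]
    rw [norm_neg, Real.norm_of_nonneg (by positivity)]
    exact mul_le_of_le_one_right (Real.exp_pos _).le (hbound w hw)
  rw [integral_expMeasure hlam]
  have hcongr : ∀ w ∈ Set.Ioi (0 : ℝ), lam * Real.exp (-(lam * w)) *
      ((1 - θ w) * Real.exp (-lam * ∫ v in Set.Ioi 0,
        killRate Γ K H a f ((flow Γ K H w).transpose.mulVec s) v)) = G' w := fun w hw => by
    rw [integral_killRate_flow_transpose (le_of_lt hw) hkill_int]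
  rw [setIntegral_congr_fun measurableSet_Ioi hcongr, integral_Ioi_of_hasDerivAt_of_tendsto
    (hGd 0).continuousAt.continuousWithinAt (fun w _ => hGd w) hG'i hG0]
  simp [G, p]

/-- The linear map superposing one storm of age `u` and one of age `v`. -/
noncomputable def twoStormMap (Γ : RiverNetwork E) (K H a : E → ℝ) (u v : ℝ) :
    ((E → ℝ) × (E → ℝ)) →ₗ[ℝ] (E ⊕ E → ℝ) where
  toFun d := (flow Γ K H u).mulVec (jump H a d.1) + (flow Γ K H v).mulVec (jump H a d.2)
  map_add' x y := by
    have h : ∀ d d' : E → ℝ, jump H a (d + d') = jump H a d + jump H a d' := by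
      intro d d'
      funext i
      rcases i with e | e
      · simp [jump]
      · simp [jump]; ring
    simp only [Prod.fst_add, Prod.snd_add, h, Matrix.mulVec_add]
    abel
  map_smul' c x := by
    have h : ∀ d : E → ℝ, jump H a (c • d) = c • jump H a d := by
      intro d
      funext i
      rcases i with e | e
      · simp [jump]
      · simp [jump]; ring
    simp only [Prod.smul_fst, Prod.smul_snd, h, Matrix.mulVec_smul, smul_add, RingHom.id_apply]

/-- Undoing the invertible factor `φ(u)` leaves `J(d) + φ(v) J(d') = 0`. Its discharge coordinates
involve only `d'`, because `J(d)` has none, and the injective runoff-to-discharge block forces `d' =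
0`; the runoff coordinates then force `d = 0`. -/
theorem twoStormMap_injective (hK : ∀ e, 0 < K e) (hH : ∀ e, 0 < H e) (ha : ∀ e, 0 < a e)
    {u v : ℝ} (hv : 0 < v) : Function.Injective (twoStormMap Γ K H a u (u + v)) := by
  rw [← LinearMap.ker_eq_bot, LinearMap.ker_eq_bot']
  rintro ⟨d, d'⟩ h
  have h0 : (flow Γ K H u).mulVec (jump H a d + (flow Γ K H v).mulVec (jump H a d')) = 0 := by
    rw [Matrix.mulVec_add, Matrix.mulVec_mulVec, ← flow_add]
    exact h
  have h1 : jump H a d + (flow Γ K H v).mulVec (jump H a d') = 0 := by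
    have h2 : (flow Γ K H (-u)).mulVec ((flow Γ K H u).mulVec
        (jump H a d + (flow Γ K H v).mulVec (jump H a d'))) = 0 := by
      rw [h0, Matrix.mulVec_zero]
    rwa [Matrix.mulVec_mulVec, ← flow_add, neg_add_cancel, flow_zero, Matrix.one_mulVec] at h2
  have hzero : ∀ b : E → ℝ, (fun e => H e * (a e * b e)) = 0 → b = 0 := by
    intro b hb
    funext e
    have := congrFun hb e
    have hne : H e * a e ≠ 0 := (mul_pos (hH e) (ha e)).ne'
    rw [← mul_assoc] at this
    exact (mul_eq_zero.1 this).resolve_left hne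
  have hd' : d' = 0 := by
    refine hzero d' (eq_zero_of_flow_inl_inr_sum_eq_zero (Γ := Γ) hK hH hv fun e => ?_)
    have := congrFun h1 (Sum.inl e)
    simpa [Matrix.mulVec, dotProduct, jump, Fintype.sum_sum_type] using this
  have hj0 : jump H a (0 : E → ℝ) = 0 := by
    funext i
    rcases i with e | e <;> simp [jump]
  have hd : d = 0 := by
    refine hzero d ?_
    rw [hd', hj0, Matrix.mulVec_zero, add_zero] at h1
    funext e
    exact congrFun h1 (Sum.inr e)
  rw [hd, hd']
  rfl

/-- Two depth vectors have as many coordinates as one state, so the injective linear map is an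
isomorphism and carries Lebesgue measure to a Haar measure; null sets pull back to null sets, also
after translation by `c`. -/
theorem twoStormMap_preimage_null (hK : ∀ e, 0 < K e) (hH : ∀ e, 0 < H e) (ha : ∀ e, 0 < a e)
    {u v : ℝ} (hv : 0 < v) {N : Set (E ⊕ E → ℝ)} (hN : MeasurableSet N) (hN0 : volume N = 0)
    (c : E ⊕ E → ℝ) :
    (volume : Measure ((E → ℝ) × (E → ℝ)))
      {d | twoStormMap Γ K H a u (u + v) d + c ∈ N} = 0 := by
  let L := ((twoStormMap Γ K H a u (u + v)).linearEquivOfInjective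
    (twoStormMap_injective hK hH ha hv) (by simp)).toContinuousLinearEquiv
  have : (volume : Measure ((E → ℝ) × (E → ℝ))).IsAddHaarMeasure :=
    Measure.prod.instIsAddHaarMeasure (volume : Measure (E → ℝ)) (volume : Measure (E → ℝ))
  have := L.isAddHaarMeasure_map (volume : Measure ((E → ℝ) × (E → ℝ)))
  have hac : (volume : Measure ((E → ℝ) × (E → ℝ))).map L ≪ volume :=
    Measure.absolutelyContinuous_isAddHaarMeasure _ _
  have hpre : volume ((fun x => x + c) ⁻¹' N) = 0 := by rwa [measure_preimage_add_right]
  have h1 := hac hpre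
  rwa [Measure.map_apply L.continuous.measurable ((measurable_add_const c) hN)] at h1

theorem densityLaw_absolutelyContinuous {ι : Type*} [Fintype ι] (f : (ι → ℝ) → ℝ) :
    densityLaw f ≪ volume :=
  (withDensity_absolutelyContinuous _ _).trans Measure.restrict_le_self.absolutelyContinuous

/-- The superposition of two storms of ages `w.1` and `w.1 + w.2` with depths `d` and of the state
`x` at age `w.1 + w.2`, for `p = ((w, x), d)`. -/
noncomputable def twoStormState (Γ : RiverNetwork E) (K H a : E → ℝ)
    (p : ((ℝ × ℝ) × (E ⊕ E → ℝ)) × ((E → ℝ) × (E → ℝ))) : E ⊕ E → ℝ :=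
  twoStormMap Γ K H a p.1.1.1 (p.1.1.1 + p.1.1.2) p.2 +
    (flow Γ K H (p.1.1.1 + p.1.1.2)).mulVec p.1.2

theorem measurable_flow_add_mulVec (Γ : RiverNetwork E) (K H : E → ℝ) :
    Measurable fun q : (ℝ × ℝ) × (E ⊕ E → ℝ) => (flow Γ K H (q.1.1 + q.1.2)).mulVec q.2 := by
  refine measurable_pi_lambda _ fun i => Finset.measurable_fun_sum _ fun j _ => ?_
  refine Measurable.mul ?_ (by fun_prop)
  exact (continuous_flow_apply i j).measurable.comp (by fun_prop)

theorem measurable_twoStormState (Γ : RiverNetwork E) (K H a : E → ℝ) :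
    Measurable (twoStormState Γ K H a) := by
  have hj := measurable_mulVec_jump (continuous_flow (Γ := Γ) (K := K) (H := H)) H a
  refine Measurable.add (Measurable.add ?_ ?_) ?_
  · exact hj.comp (Measurable.prodMk (by fun_prop) (by fun_prop) : Measurable fun p :
      ((ℝ × ℝ) × (E ⊕ E → ℝ)) × ((E → ℝ) × (E → ℝ)) => (p.1.1.1, p.2.1))
  · exact hj.comp (Measurable.prodMk (by fun_prop) (by fun_prop) : Measurable fun p :
      ((ℝ × ℝ) × (E ⊕ E → ℝ)) × ((E → ℝ) × (E → ℝ)) => (p.1.1.1 + p.1.1.2, p.2.2))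
  · exact (measurable_flow_add_mulVec Γ K H).comp measurable_fst

theorem twoStormState_nonneg (hK : ∀ e, 0 < K e) (hH : ∀ e, 0 < H e) (ha : ∀ e, 0 < a e)
    {w : ℝ × ℝ} (hw : 0 < w.1 ∧ 0 < w.2) {x : E ⊕ E → ℝ} (hx : ∀ i, 0 ≤ x i)
    {d : (E → ℝ) × (E → ℝ)} (hd : d.1 ∈ orthant E ∧ d.2 ∈ orthant E) (i : E ⊕ E) :
    0 ≤ twoStormState Γ K H a ((w, x), d) i := by
  have hsum : 0 ≤ w.1 + w.2 := add_nonneg hw.1.le hw.2.le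
  refine add_nonneg (add_nonneg ?_ ?_) ?_
  · exact mulVec_nonneg_of_nonneg (flow_nonneg hK hH hw.1.le) (jump_nonneg hH ha hd.1) i
  · exact mulVec_nonneg_of_nonneg (flow_nonneg hK hH hsum) (jump_nonneg hH ha hd.2) i
  · exact mulVec_nonneg_of_nonneg (flow_nonneg hK hH hsum) hx i

theorem ae_pos_expMeasure_prod (hlam : 0 < lam) :
    ∀ᵐ w ∂((expMeasure lam).prod (expMeasure lam)), 0 < w.1 ∧ 0 < w.2 := by
  have := isProbabilityMeasure_expMeasure hlam
  filter_upwards [Measure.quasiMeasurePreserving_fst.ae (ae_pos_expMeasure lam),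
    Measure.quasiMeasurePreserving_snd.ae (ae_pos_expMeasure lam)] with w h1 h2 using ⟨h1, h2⟩

theorem ae_mem_orthant_densityLaw_prod {E : Type*} [Fintype E] (f : (E → ℝ) → ℝ) [IsProbabilityMeasure (densityLaw f)] :
    ∀ᵐ d ∂((densityLaw f).prod (densityLaw f)), d.1 ∈ orthant E ∧ d.2 ∈ orthant E := by
  filter_upwards [Measure.quasiMeasurePreserving_fst.ae (ae_mem_orthant_densityLaw f),
    Measure.quasiMeasurePreserving_snd.ae (ae_mem_orthant_densityLaw f)] with d h1 h2
    using ⟨h1, h2⟩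

theorem integral_exp_neg_twoStormState (f : (E → ℝ) → ℝ) [IsProbabilityMeasure (densityLaw f)]
    {w : ℝ × ℝ} (hw : 0 < w.1 ∧ 0 < w.2) (x s : E ⊕ E → ℝ) :
    ∫ d, Real.exp (-(twoStormState Γ K H a ((w, x), d) ⬝ᵥ s))
        ∂((densityLaw f).prod (densityLaw f)) =
      (1 - killRate Γ K H a f s w.1) * (1 - killRate Γ K H a f s (w.1 + w.2)) *
        Real.exp (-(x ⬝ᵥ (flow Γ K H (w.1 + w.2)).transpose.mulVec s)) := by
  have e1 : ∀ d : (E → ℝ) × (E → ℝ), Real.exp (-(twoStormState Γ K H a ((w, x), d) ⬝ᵥ s)) =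
      Real.exp (-((flow Γ K H w.1).mulVec (jump H a d.1) ⬝ᵥ s)) *
      Real.exp (-((flow Γ K H (w.1 + w.2)).mulVec (jump H a d.2) ⬝ᵥ s)) *
      Real.exp (-((flow Γ K H (w.1 + w.2)).mulVec x ⬝ᵥ s)) := by
    intro d
    rw [← Real.exp_add, ← Real.exp_add, ← neg_add, ← neg_add, ← add_dotProduct,
      ← add_dotProduct]
    rfl
  simp_rw [e1]
  rw [integral_mul_const, integral_prod_mul
    (fun d => Real.exp (-((flow Γ K H w.1).mulVec (jump H a d) ⬝ᵥ s)))
    (fun d => Real.exp (-((flow Γ K H (w.1 + w.2)).mulVec (jump H a d) ⬝ᵥ s))),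
    mulVec_dotProduct_eq _ x s]
  simp only [killRate, sub_sub_cancel, abs_of_pos hw.1, abs_of_pos (add_pos hw.1 hw.2)]

/-- A law on the orthant with the stationary Laplace transform is unchanged by waiting for two
storms. -/
theorem map_twoStormState_eq [IsProbabilityMeasure (densityLaw f)] (hlam : 0 < lam)
    (hK : ∀ e, 0 < K e) (hH : ∀ e, 0 < H e) (ha : ∀ e, 0 < a e)
    (hkill_int : ∀ s : E ⊕ E → ℝ, (∀ i, 0 ≤ s i) →
      IntegrableOn (killRate Γ K H a f s) (Set.Ioi 0))
    {π : Measure (E ⊕ E → ℝ)} [IsProbabilityMeasure π] (hπ0 : ∀ᵐ x ∂π, ∀ i, 0 ≤ x i)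
    (hπ : ∀ s : E ⊕ E → ℝ, (∀ i, 0 ≤ s i) → ∫ x, Real.exp (-(x ⬝ᵥ s)) ∂π =
      Real.exp (-lam * ∫ v in Set.Ioi 0, killRate Γ K H a f s v)) :
    ((((expMeasure lam).prod (expMeasure lam)).prod π).prod
      ((densityLaw f).prod (densityLaw f))).map (twoStormState Γ K H a) = π := by
  have := isProbabilityMeasure_expMeasure hlam
  have hF := measurable_twoStormState Γ K H a
  have hw := ae_pos_expMeasure_prod hlam
  have hwx : ∀ᵐ q ∂(((expMeasure lam).prod (expMeasure lam)).prod π),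
      (0 < q.1.1 ∧ 0 < q.1.2) ∧ ∀ i, 0 ≤ q.2 i := by
    filter_upwards [Measure.quasiMeasurePreserving_fst.ae hw,
      Measure.quasiMeasurePreserving_snd.ae hπ0] with q h1 h2 using ⟨h1, h2⟩
  have hF0 : ∀ᵐ p ∂((((expMeasure lam).prod (expMeasure lam)).prod π).prod
      ((densityLaw f).prod (densityLaw f))), ∀ i, 0 ≤ twoStormState Γ K H a p i := by
    filter_upwards [Measure.quasiMeasurePreserving_fst.ae hwx,
      Measure.quasiMeasurePreserving_snd.ae (ae_mem_orthant_densityLaw_prod f)] with p h1 h2 i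
    exact twoStormState_nonneg hK hH ha h1.1 h1.2 h2 i
  have hprob := Measure.isProbabilityMeasure_map (μ := (((expMeasure lam).prod
    (expMeasure lam)).prod π).prod ((densityLaw f).prod (densityLaw f))) hF.aemeasurable
  refine ext_of_integral_exp_neg_dotProduct
    ((ae_map_iff hF.aemeasurable measurableSet_forall_nonneg).2 hF0) hπ0 fun s hs => ?_
  have hs0 : ∀ i, 0 ≤ s i := fun i => (hs i).le
  have hs1 : ∀ {w : ℝ}, 0 < w → ∀ i, 0 ≤ (flow Γ K H w).transpose.mulVec s i := fun hw =>
    flow_transpose_mulVec_nonneg hK hH hw.le hs0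
  have hem := (continuous_exp_neg_dotProduct s).measurable
  have hFi : Integrable (fun p => Real.exp (-(twoStormState Γ K H a p ⬝ᵥ s)))
      ((((expMeasure lam).prod (expMeasure lam)).prod π).prod
        ((densityLaw f).prod (densityLaw f))) :=
    Integrable.of_bound (hem.comp hF).aestronglyMeasurable 1
      (hF0.mono fun p hp => norm_exp_neg_dotProduct_le_one hp hs0)
  have step1 : ∀ᵐ q ∂(((expMeasure lam).prod (expMeasure lam)).prod π),
      ∫ d, Real.exp (-(twoStormState Γ K H a (q, d) ⬝ᵥ s))
        ∂((densityLaw f).prod (densityLaw f)) =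
      (1 - killRate Γ K H a f s q.1.1) * (1 - killRate Γ K H a f s (q.1.1 + q.1.2)) *
        Real.exp (-(q.2 ⬝ᵥ (flow Γ K H (q.1.1 + q.1.2)).transpose.mulVec s)) :=
    hwx.mono fun q hq => integral_exp_neg_twoStormState f hq.1 q.2 s
  have hi1 := hFi.integral_prod_left.congr step1
  -- The factors of the second storm and of the old state are rewritten with observer `φ(w.1)ᵀ s`
  -- and age `w.2`. The renewal equation then integrates out `w.2` at this observer, and `w.1` at
  -- `s`.
  have step2 : ∀ᵐ w ∂((expMeasure lam).prod (expMeasure lam)),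
      ∫ x, (1 - killRate Γ K H a f s w.1) * (1 - killRate Γ K H a f s (w.1 + w.2)) *
        Real.exp (-(x ⬝ᵥ (flow Γ K H (w.1 + w.2)).transpose.mulVec s)) ∂π =
      (1 - killRate Γ K H a f s w.1) *
        ((1 - killRate Γ K H a f ((flow Γ K H w.1).transpose.mulVec s) w.2) *
          Real.exp (-lam * ∫ v in Set.Ioi 0, killRate Γ K H a f
            ((flow Γ K H w.2).transpose.mulVec ((flow Γ K H w.1).transpose.mulVec s)) v)) := by
    filter_upwards [hw] with w hw
    rw [integral_const_mul, hπ _ (hs1 (add_pos hw.1 hw.2)),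
      killRate_flow_transpose hw.1.le hw.2.le, mul_assoc, Matrix.mulVec_mulVec,
      ← Matrix.transpose_mul, ← flow_add]
  have hi2 := hi1.integral_prod_left.congr step2
  rw [integral_map hF.aemeasurable hem.aestronglyMeasurable, integral_prod _ hFi,
    integral_congr_ae step1, integral_prod _ hi1, integral_congr_ae step2, integral_prod _ hi2,
    hπ s hs0, ← integral_expMeasure_killRate hlam hK hH ha hs0 (hkill_int s hs0)]
  refine integral_congr_ae ?_
  filter_upwards [ae_pos_expMeasure lam] with w hw
  rw [integral_const_mul, integral_expMeasure_killRate hlam hK hH ha (hs1 hw) (hkill_int _ (hs1 hw))]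

/-- A law on the orthant with the stationary Laplace transform is absolutely continuous. -/
theorem absolutelyContinuous_of_laplace [IsProbabilityMeasure (densityLaw f)] (hlam : 0 < lam)
    (hK : ∀ e, 0 < K e) (hH : ∀ e, 0 < H e) (ha : ∀ e, 0 < a e)
    (hkill_int : ∀ s : E ⊕ E → ℝ, (∀ i, 0 ≤ s i) →
      IntegrableOn (killRate Γ K H a f s) (Set.Ioi 0))
    {π : Measure (E ⊕ E → ℝ)} [IsProbabilityMeasure π] (hπ0 : ∀ᵐ x ∂π, ∀ i, 0 ≤ x i)
    (hπ : ∀ s : E ⊕ E → ℝ, (∀ i, 0 ≤ s i) → ∫ x, Real.exp (-(x ⬝ᵥ s)) ∂π =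
      Real.exp (-lam * ∫ v in Set.Ioi 0, killRate Γ K H a f s v)) :
    π ≪ volume := by
  have := isProbabilityMeasure_expMeasure hlam
  have hF := measurable_twoStormState Γ K H a
  have hmap := map_twoStormState_eq hlam hK hH ha hkill_int hπ0 hπ
  refine Measure.AbsolutelyContinuous.mk fun N hN hN0 => ?_
  suffices h : ((((expMeasure lam).prod (expMeasure lam)).prod π).prod
      ((densityLaw f).prod (densityLaw f))) (twoStormState Γ K H a ⁻¹' N) = 0 by
    rwa [← Measure.map_apply hF hN, hmap] at h
  -- By Fubini the ages and the old state are frozen, and only the two depths remain random.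
  rw [Measure.measure_prod_null (hF hN)]
  filter_upwards [Measure.quasiMeasurePreserving_fst.ae (ae_pos_expMeasure_prod hlam)] with q hq
  have hac : (densityLaw f).prod (densityLaw f) ≪ (volume : Measure ((E → ℝ) × (E → ℝ))) :=
    (densityLaw_absolutelyContinuous f).prod (densityLaw_absolutelyContinuous f)
  have hnull := twoStormMap_preimage_null (Γ := Γ) hK hH ha (u := q.1.1) hq.2 hN hN0
    ((flow Γ K H (q.1.1 + q.1.2)).mulVec q.2)
  exact hac hnull

end Density

/-! ### From depths to jumps, the log-moment condition and the change of variables -/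

section Scaling

open Filter Topology

theorem measurable_scale {E : Type*} (H a : E → ℝ) :
    Measurable fun (d : E → ℝ) (e : E) => H e * (a e * d e) := by
  fun_prop

variable {E : Type*} [Fintype E] {H a : E → ℝ} {f : (E → ℝ) → ℝ}

theorem lintegral_scale (hH : ∀ e, 0 < H e) (ha : ∀ e, 0 < a e) {g : (E → ℝ) → ENNReal}
    (hg : Measurable g) :
    ∫⁻ y, g y = ENNReal.ofReal (∏ e, H e * a e) * ∫⁻ d : E → ℝ, g fun e => H e * (a e * d e) := by
  classical
  have hpos : 0 < ∏ e, H e * a e := Finset.prod_pos fun e _ => mul_pos (hH e) (ha e)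
  have hdet : Matrix.det (Matrix.diagonal fun e => H e * a e) ≠ 0 := by
    rw [Matrix.det_diagonal]; exact hpos.ne'
  have hlin : ∀ d : E → ℝ, Matrix.toLin' (Matrix.diagonal fun e => H e * a e) d =
      fun e => H e * (a e * d e) := by
    intro d
    funext e
    rw [Matrix.toLin'_apply, Matrix.mulVec_diagonal, mul_assoc]
  have hm : Measurable (Matrix.toLin' (Matrix.diagonal fun e => H e * a e)) := by
    have : (Matrix.toLin' (Matrix.diagonal fun e => H e * a e) : (E → ℝ) → E → ℝ) =
        fun d e => H e * (a e * d e) := funext hlin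
    rw [this]
    exact measurable_scale H a
  conv_lhs => rw [← Real.smul_map_diagonal_volume_pi hdet]
  rw [lintegral_smul_measure, lintegral_map hg hm, Matrix.det_diagonal, abs_of_pos hpos,
    smul_eq_mul]
  simp_rw [hlin]

theorem jumpDensity_scale (hH : ∀ e, 0 < H e) (ha : ∀ e, 0 < a e) (d : E → ℝ) :
    jumpDensity H a f (fun e => H e * (a e * d e)) = 1 / (∏ e, H e * a e) * f d := by
  rw [jumpDensity]
  congr 2
  funext e
  have := (hH e).ne'
  have := (ha e).ne'
  field_simp

theorem measurable_jumpDensity (hf : Measurable f) : Measurable (jumpDensity H a f) :=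
  measurable_const.mul (hf.comp (by fun_prop))

theorem jumpDensity_nonneg (hH : ∀ e, 0 < H e) (ha : ∀ e, 0 < a e) (hf : IsOrthantDensity f)
    {y : E → ℝ} (hy : y ∈ orthant E) : 0 ≤ jumpDensity H a f y := by
  refine mul_nonneg (one_div_nonneg.2 (Finset.prod_nonneg fun e _ => ?_))
    (hf.nonneg _ fun e => div_pos (hy e) (mul_pos (hH e) (ha e)))
  exact (mul_pos (hH e) (ha e)).le

/-- The factor `1 / ∏ H a` is the inverse Jacobian of the diagonal scaling, which preserves the open
orthant. -/
theorem densityLaw_jumpDensity (hH : ∀ e, 0 < H e) (ha : ∀ e, 0 < a e) (hf : Measurable f) :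
    densityLaw (jumpDensity H a f) =
      (densityLaw f).map fun d e => H e * (a e * d e) := by
  have hpos : 0 < ∏ e, H e * a e := Finset.prod_pos fun e _ => mul_pos (hH e) (ha e)
  ext A hA
  have hpre := measurable_scale H a hA
  rw [Measure.map_apply (measurable_scale H a) hA, densityLaw, densityLaw,
    withDensity_apply _ hA, withDensity_apply _ hpre, Measure.restrict_restrict hA,
    Measure.restrict_restrict hpre, ← lintegral_indicator (hA.inter measurableSet_orthant),
    ← lintegral_indicator (hpre.inter measurableSet_orthant),
    lintegral_scale hH ha ((measurable_jumpDensity hf).ennreal_ofReal.indicator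
      (hA.inter measurableSet_orthant)), ← lintegral_const_mul' _ _ ENNReal.ofReal_ne_top]
  refine lintegral_congr fun d => ?_
  have horth : (fun e => H e * (a e * d e)) ∈ orthant E ↔ d ∈ orthant E := by
    refine forall_congr' fun e => ?_
    beta_reduce
    rw [← mul_assoc]
    exact mul_pos_iff_of_pos_left (mul_pos (hH e) (ha e))
  by_cases hd : (fun e => H e * (a e * d e)) ∈ A ∧ d ∈ orthant E
  · rw [Set.indicator_of_mem (show (fun e => H e * (a e * d e)) ∈ A ∩ orthant E from
      ⟨hd.1, horth.2 hd.2⟩), Set.indicator_of_mem (show d ∈ _ ∩ orthant E from ⟨hd.1, hd.2⟩),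
      jumpDensity_scale hH ha, ← ENNReal.ofReal_mul hpos.le]
    congr 1
    field_simp
  · rw [Set.indicator_of_notMem (fun h => hd ⟨h.1, horth.1 h.2⟩),
      Set.indicator_of_notMem (fun h => hd ⟨h.1, h.2⟩), mul_zero]

theorem densityLaplace_jumpDensity (hH : ∀ e, 0 < H e) (ha : ∀ e, 0 < a e)
    (hf : IsOrthantDensity f) (σ : E → ℝ) :
    densityLaplace (jumpDensity H a f) σ =
      ∫ d, Real.exp (-((fun e => H e * (a e * d e)) ⬝ᵥ σ)) ∂(densityLaw f) := by
  have h1 : densityLaplace (jumpDensity H a f) σ =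
      ∫ y, Real.exp (-(y ⬝ᵥ σ)) ∂(densityLaw (jumpDensity H a f)) := by
    rw [densityLaw, integral_withDensity_eq_integral_toReal_smul
      (measurable_jumpDensity hf.measurable).ennreal_ofReal (by simp), densityLaplace]
    refine setIntegral_congr_fun measurableSet_orthant fun y hy => ?_
    simp only [smul_eq_mul]
    rw [ENNReal.toReal_ofReal (jumpDensity_nonneg hH ha hf hy), mul_comm]
  rw [h1, densityLaw_jumpDensity hH ha hf.measurable, integral_map
    (measurable_scale H a).aemeasurable (continuous_exp_neg_dotProduct σ).aestronglyMeasurable]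

theorem measurable_euclNorm : Measurable (euclNorm : (E → ℝ) → ℝ) := by
  refine Continuous.measurable ?_
  unfold euclNorm
  fun_prop

theorem euclNorm_le_sum {y : E → ℝ} (hy : ∀ e, 0 ≤ y e) : euclNorm y ≤ ∑ e, y e := by
  rw [euclNorm, Real.sqrt_le_left (Finset.sum_nonneg fun e _ => hy e)]
  exact Finset.sum_sq_le_sq_sum_of_nonneg fun e _ => hy e

theorem sum_le_card_mul_euclNorm (y : E → ℝ) : ∑ e, y e ≤ Fintype.card E * euclNorm y := by
  have h : ∀ e, y e ≤ euclNorm y := fun e =>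
    Real.le_sqrt_of_sq_le (Finset.single_le_sum (f := fun e => y e ^ 2)
      (fun e _ => sq_nonneg _) (Finset.mem_univ e))
  calc ∑ e, y e ≤ ∑ _e : E, euclNorm y := Finset.sum_le_sum fun e _ => h e
    _ = Fintype.card E * euclNorm y := by simp

/-- The positive part of the logarithm vanishes on `|y| < 1`, so it encodes the truncation of the
domain. -/
theorem lintegral_logMoment {g : (E → ℝ) → ℝ} (hg : Measurable g)
    (hg0 : ∀ y ∈ orthant E, 0 ≤ g y) :
    ∫⁻ y in {y | y ∈ orthant E ∧ 1 ≤ euclNorm y}, ENNReal.ofReal (Real.log (euclNorm y) * g y) =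
      ∫⁻ y, ENNReal.ofReal (Real.posLog (euclNorm y)) ∂(densityLaw g) := by
  have hB : MeasurableSet {y : E → ℝ | 1 ≤ euclNorm y} :=
    measurableSet_le measurable_const measurable_euclNorm
  have hlog : Measurable fun y : E → ℝ => ENNReal.ofReal (Real.posLog (euclNorm y)) :=
    (Real.continuous_posLog.measurable.comp measurable_euclNorm).ennreal_ofReal
  rw [densityLaw, lintegral_withDensity_eq_lintegral_mul _ hg.ennreal_ofReal hlog,
    show {y : E → ℝ | y ∈ orthant E ∧ 1 ≤ euclNorm y} = {y | 1 ≤ euclNorm y} ∩ orthant E from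
      Set.ext fun y => and_comm, ← Measure.restrict_restrict hB,
    ← lintegral_indicator hB]
  refine setLIntegral_congr_fun measurableSet_orthant fun y hy => ?_
  simp only [Set.indicator, Set.mem_ofPred_eq, Pi.mul_apply]
  have hn : 0 ≤ euclNorm y := Real.sqrt_nonneg _
  split_ifs with h
  · rw [Real.posLog_eq_log (by rwa [abs_of_nonneg hn]), mul_comm, ENNReal.ofReal_mul (hg0 y hy)]
  · rw [(Real.posLog_eq_zero_iff _).2 (by rw [abs_of_nonneg hn]; exact (not_le.1 h).le)]
    simp

/-- On the orthant the Euclidean norm and the sum of coordinates are comparable up to the factor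
`card E`, which changes `log⁺` by at most an additive constant, integrable under a probability law.
-/
theorem hasLogMoment_jumpDensity_iff (hH : ∀ e, 0 < H e) (ha : ∀ e, 0 < a e)
    (hf : IsOrthantDensity f) [IsProbabilityMeasure (densityLaw f)] :
    HasLogMoment (jumpDensity H a f) ↔
      ∫⁻ d, ENNReal.ofReal (Real.posLog (∑ e, H e * (a e * d e))) ∂(densityLaw f) < ⊤ := by
  have hlog : Measurable fun y : E → ℝ => ENNReal.ofReal (Real.posLog (euclNorm y)) :=
    (Real.continuous_posLog.measurable.comp measurable_euclNorm).ennreal_ofReal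
  have hpos : ∀ᵐ d ∂(densityLaw f), ∀ e, 0 ≤ H e * (a e * d e) := by
    filter_upwards [ae_mem_orthant_densityLaw f] with d hd e
    exact (mul_pos (hH e) (mul_pos (ha e) (hd e))).le
  rw [HasLogMoment, lintegral_logMoment (measurable_jumpDensity hf.measurable)
    (fun y hy => jumpDensity_nonneg hH ha hf hy), densityLaw_jumpDensity hH ha hf.measurable,
    lintegral_map hlog (measurable_scale H a)]
  constructor
  · intro h
    calc ∫⁻ d, ENNReal.ofReal (Real.posLog (∑ e, H e * (a e * d e))) ∂(densityLaw f)
        ≤ ∫⁻ d, (ENNReal.ofReal (Real.log (Fintype.card E)) +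
            ENNReal.ofReal (Real.posLog (euclNorm fun e => H e * (a e * d e)))) ∂(densityLaw f) := by
          refine lintegral_mono_ae ?_
          filter_upwards [hpos] with d hd
          rw [← ENNReal.ofReal_add (Real.log_natCast_nonneg _) Real.posLog_nonneg]
          refine ENNReal.ofReal_le_ofReal ?_
          exact (Real.posLog_le_posLog (Finset.sum_nonneg fun e _ => hd e)
            (sum_le_card_mul_euclNorm _)).trans Real.posLog_nat_mul
      _ = ENNReal.ofReal (Real.log (Fintype.card E)) + ∫⁻ d, ENNReal.ofReal
            (Real.posLog (euclNorm fun e => H e * (a e * d e))) ∂(densityLaw f) := by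
          rw [lintegral_add_left measurable_const]
          simp
      _ < ⊤ := ENNReal.add_lt_top.2 ⟨ENNReal.ofReal_lt_top, h⟩
  · refine lt_of_le_of_lt (lintegral_mono_ae ?_)
    filter_upwards [hpos] with d hd
    exact ENNReal.ofReal_le_ofReal
      (Real.posLog_le_posLog (Real.sqrt_nonneg _) (euclNorm_le_sum hd))

variable [DecidableEq E] {Γ : RiverNetwork E} {K : E → ℝ}

/-- At `u = exp (-(H r * v))`, with `r` the root, the factor `H r` cancels and `u ^ (-Mᵀ / H r)`
becomes `φ(v)ᵀ`; its transpose acts on the jump, of which only the runoff coordinates are nonzero.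
-/
theorem laplaceIntegrand_exp (hH : ∀ e, 0 < H e) (ha : ∀ e, 0 < a e) (hf : IsOrthantDensity f)
    (s : E ⊕ E → ℝ) {v : ℝ} (hv : 0 ≤ v) :
    laplaceIntegrand Γ K H (jumpDensity H a f) s (Real.exp (-(H Γ.root * v))) =
      killRate Γ K H a f s v / Real.exp (-(H Γ.root * v)) := by
  have hpow : matrixPow (Real.exp (-(H Γ.root * v)))
      (-((1 / H Γ.root) • (driftMatrix Γ K H).transpose)) = (flow Γ K H v).transpose := by
    rw [matrixPow, Real.log_exp, flow, ← Matrix.exp_transpose, Matrix.transpose_smul]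
    congr 1
    rw [smul_neg, neg_smul, neg_neg, smul_smul]
    congr 1
    have := (hH Γ.root).ne'
    field_simp
  rw [laplaceIntegrand, hpow, densityLaplace_jumpDensity hH ha hf, killRate, abs_of_nonneg hv]
  congr 2
  refine integral_congr_ae (Eventually.of_forall fun d => ?_)
  simp only
  rw [mulVec_dotProduct_eq]
  congr 2
  simp [dotProduct, jump, Fintype.sum_sum_type]

theorem image_exp_neg_mul_Ioi {h : ℝ} (hh : 0 < h) :
    (fun v => Real.exp (-(h * v))) '' Set.Ioi 0 = Set.Ioo 0 1 := by
  ext u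
  constructor
  · rintro ⟨v, hv, rfl⟩
    have hv : 0 < v := hv
    exact ⟨Real.exp_pos _, Real.exp_lt_one_iff.2 (neg_lt_zero.2 (mul_pos hh hv))⟩
  · rintro ⟨h0, h1⟩
    refine ⟨-Real.log u / h, div_pos (neg_pos.2 (Real.log_neg h0 h1)) hh, ?_⟩
    simp only
    rw [mul_div_cancel₀ _ hh.ne', neg_neg, Real.exp_log h0]

/-- The Jacobian of `v ↦ exp (-(h * v))` is `h * u` in absolute value: it cancels the division by
`u` and leaves the factor `h`. Any positive constant in place of `H Γ.root` would serve equally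
well. -/
theorem intervalIntegrable_laplaceIntegrand_and_integral (hH : ∀ e, 0 < H e) (ha : ∀ e, 0 < a e)
    (hf : IsOrthantDensity f) {s : E ⊕ E → ℝ}
    (hkill_int : IntegrableOn (killRate Γ K H a f s) (Set.Ioi 0)) :
    IntervalIntegrable (laplaceIntegrand Γ K H (jumpDensity H a f) s) volume 0 1 ∧
      ∫ u in (0 : ℝ)..1, laplaceIntegrand Γ K H (jumpDensity H a f) s u =
        H Γ.root * ∫ v in Set.Ioi 0, killRate Γ K H a f s v := by
  set h := H Γ.root with hh
  have hpos : 0 < h := hH Γ.root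
  have hderiv : ∀ v ∈ Set.Ioi (0 : ℝ), HasDerivWithinAt (fun v => Real.exp (-(h * v)))
      (Real.exp (-(h * v)) * -(h * 1)) (Set.Ioi 0) v := fun v _ =>
    ((hasDerivAt_id v).const_mul h).neg.exp.hasDerivWithinAt
  have hinj : Set.InjOn (fun v => Real.exp (-(h * v))) (Set.Ioi 0) := fun v _ w _ hvw => by
    have := Real.exp_injective hvw
    exact mul_left_cancel₀ hpos.ne' (neg_injective this)
  have hcongr : ∀ v ∈ Set.Ioi (0 : ℝ), |Real.exp (-(h * v)) * -(h * 1)| •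
      laplaceIntegrand Γ K H (jumpDensity H a f) s (Real.exp (-(h * v))) =
        h * killRate Γ K H a f s v := by
    intro v hv
    rw [laplaceIntegrand_exp hH ha hf s (le_of_lt hv), mul_neg, abs_neg, mul_one,
      abs_of_pos (mul_pos (Real.exp_pos _) hpos), smul_eq_mul, ← hh]
    have := (Real.exp_pos (-(h * v))).ne'
    field_simp
  constructor
  · rw [intervalIntegrable_iff_integrableOn_Ioc_of_le zero_le_one,
      integrableOn_Ioc_iff_integrableOn_Ioo, ← image_exp_neg_mul_Ioi hpos,
      integrableOn_image_iff_integrableOn_abs_deriv_smul measurableSet_Ioi hderiv hinj,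
      integrableOn_congr_fun hcongr measurableSet_Ioi]
    exact hkill_int.const_mul h
  · rw [intervalIntegral.integral_of_le zero_le_one, integral_Ioc_eq_integral_Ioo,
      ← image_exp_neg_mul_Ioi hpos,
      integral_image_eq_integral_abs_deriv_smul measurableSet_Ioi hderiv hinj,
      setIntegral_congr_fun measurableSet_Ioi hcongr, integral_const_mul]

end Scaling

/-! ### The theorem -/

theorem proposition1 {E : Type*} [Fintype E] [DecidableEq E] (Γ : RiverNetwork E)
    (K H a : E → ℝ) (hK : ∀ e, 0 < K e) (hH : ∀ e, 0 < H e) (ha : ∀ e, 0 < a e)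
    (lam : ℝ) (hlam : 0 < lam) (fP : (E → ℝ) → ℝ) (hfP : IsOrthantDensity fP)
    {Ω : Type*} [MeasurableSpace Ω] (P : MeasureTheory.Measure Ω)
    [MeasureTheory.IsProbabilityMeasure P]
    (T : ℕ → Ω → ℝ) (D : ℕ → Ω → (E → ℝ)) (hTD : IsStormSequence P lam fP T D) :
    ((∃! π : MeasureTheory.Measure (E ⊕ E → ℝ),
        IsInvariantLaw (transitionLaw Γ K H a P T D) π) ↔
      HasLogMoment (jumpDensity H a fP)) ∧
    (HasLogMoment (jumpDensity H a fP) →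
      ∀ π : MeasureTheory.Measure (E ⊕ E → ℝ),
        IsInvariantLaw (transitionLaw Γ K H a P T D) π →
        π ≪ MeasureTheory.volume ∧
        (∀ s ∈ orthant (E ⊕ E),
          IntervalIntegrable (laplaceIntegrand Γ K H (jumpDensity H a fP) s)
            MeasureTheory.volume 0 1 ∧
          measureLaplace π s =
            Real.exp (-(lam / H Γ.root) *
              ∫ u in (0 : ℝ)..1, laplaceIntegrand Γ K H (jumpDensity H a fP) s u)) ∧
        (∀ x ∈ orthant (E ⊕ E), ∀ h : BoundedContinuousFunction (E ⊕ E → ℝ) ℝ,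
          Filter.Tendsto (fun t : ℝ => ∫ y, h y ∂(transitionLaw Γ K H a P T D t x))
            Filter.atTop (nhds (∫ y, h y ∂π)))) := by
  have := hTD.isProbabilityMeasure_densityLaw
  have hkill_int : HasLogMoment (jumpDensity H a fP) → ∀ s : E ⊕ E → ℝ, (∀ i, 0 ≤ s i) →
      IntegrableOn (killRate Γ K H a fP s) (Set.Ioi 0) := fun hlog s hs =>
    integrableOn_killRate_of_lintegral_posLog hK hH ha hs
      ((hasLogMoment_jumpDensity_iff hH ha hfP).1 hlog)
  refine ⟨⟨?_, fun hlog => ?_⟩, fun hlog π hπ => ?_⟩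
  · rintro ⟨π, hπ, -⟩
    refine (hasLogMoment_jumpDensity_iff hH ha hfP).2
      (lintegral_posLog_lt_top_of_integrableOn_killRate (Γ := Γ) hK hH ha ?_)
    -- Existence of an invariant law alone already forces the log-moment condition, through the
    -- observer `s = 1`.
    exact (hTD.integrableOn_killRate_and_laplace_of_isInvariantLaw hlam hK hH ha hπ
      fun _ => zero_le_one).1
  · have hinv := hTD.isInvariantLaw_stationaryState hlam hK hH ha (hkill_int hlog)
    exact ⟨_, hinv, fun π hπ => hTD.isInvariantLaw_unique hlam hK hH ha hπ hinv⟩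
  · have := hπ.prob
    have hmem : ∀ᵐ x ∂π, x ∈ orthant (E ⊕ E) := mem_ae_iff.2 hπ.supported
    refine ⟨?_, fun s hs => ?_, fun x _ h => ?_⟩
    · exact absolutelyContinuous_of_laplace hlam hK hH ha (hkill_int hlog)
        (hmem.mono fun x hx i => (hx i).le) fun s hs =>
          (hTD.integrableOn_killRate_and_laplace_of_isInvariantLaw hlam hK hH ha hπ hs).2
    · have hs0 : ∀ i, 0 ≤ s i := fun i => (hs i).le
      obtain ⟨h1, h2⟩ := intervalIntegrable_laplaceIntegrand_and_integral hH ha hfP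
        (hkill_int hlog s hs0)
      refine ⟨h1, ?_⟩
      rw [measureLaplace, Measure.restrict_eq_self_of_ae_mem hmem,
        (hTD.integrableOn_killRate_and_laplace_of_isInvariantLaw hlam hK hH ha hπ hs0).2, h2]
      congr 1
      have := (hH Γ.root).ne'
      field_simp
    · rw [hTD.isInvariantLaw_unique hlam hK hH ha hπ
        (hTD.isInvariantLaw_stationaryState hlam hK hH ha (hkill_int hlog))]
      exact hTD.tendsto_integral_transitionLaw hlam hK hH ha (hkill_int hlog) x h
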